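/- **Setting.** Let $k,r$ be integers with $k\ge 1$, $r\ge k+2$, and let $q\in\mathbb C$, $0<|q|<1$; put $q^s=e^{s\log q}$, $[s]=\frac{q^s-q^{-s}}{q-q^{-1}}$, and write points of $\mathbb C^\times$ as $z=q^{2u}$, $\log z=2u\log q$. Put $[u]_x=\vartheta_1(u/x\,|\,\tau_x)$ with $q^{2x}=e^{-2\pi i/\tau_x}$, i.e. $\tau_x=-\pi i/(x\log q)$, and $\vartheta_1(v|\tau)=i\sum_{n\in\mathbb Z}(-1)^ne^{\pi i(n-1/2)^2\tau}e^{2\pi i(n-1/2)v}$. *Bosons.* Let $a_{j,m}$ ($j=0,1,2$, $m\in\mathbb Z\setminus\{0\}$), $P_j,Q_j$ satisfy $[a_{0,m},a_{0,n}]=\frac{[2m][km][rm]}{m[(r-k)m]}\delta_{m+n,0}$, $[a_{1,m},a_{1,n}]=\frac{[2m][(k+2)m]}{m}\delta_{m+n,0}$, $[a_{2,m},a_{2,n}]=-\frac{[2m][km]}{m}\delta_{m+n,0}$, $[P_0,Q_0]=-i$, $[P_1,Q_1]=2(k+2)$, $[P_2,Q_2]=-2k$, all other commutators being zero, and put $a'_{0,m}=\frac{[(r-k)m]}{[rm]}a_{0,m}$.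 Put $$\phi_0(k|z)=\tfrac1k\sqrt{\tfrac{2kr}{r-k}}\,(iQ_0+P_0\log z)+\sum_{m\ne0}\tfrac{a_{0,m}}{[km]}z^{-m},\qquad \phi_0'(k|z)=\tfrac1k\sqrt{\tfrac{2k(r-k)}{r}}\,(iQ_0+P_0\log z)+\sum_{m\ne0}\tfrac{a'_{0,m}}{[km]}z^{-m},$$ and for $j=1,2$ $$\phi_j(C|z;D)=-\tfrac1C(Q_j+P_j\log z)+\sum_{m\neq0}\tfrac{a_{j,m}}{[Cm]}z^{-m}q^{D|m|},\qquad \phi_j^{(\pm)}(z;C)=\tfrac{P_j}2\log q+(q-q^{-1})\sum_{m>0}\tfrac{[m]}{[2m]}a_{j,\pm m}z^{\mp m}q^{Cm}.$$ *Currents.* With $:\ :$ the normal ordering ($a_{j,-m}$, $m>0$, and $Q_j$ to the left of $a_{j,m}$, $m>0$, and $P_j$), put $E(z)=\Psi^-(z):e^{-\phi_0(k|z)}:$, $F(z)=\Psi^+(z):e^{\phi'_0(k|z)}:$, where $$\Psi^\pm(z)=\tfrac{\mp1}{q-q^{-1}}:e^{\pm\phi_2(k|z;\pm\frac k2)}\Bigl(e^{-\phi_2^{(+)}(z;\mp\frac{k+2}2)\pm\phi_1^{(+)}(z;\mp\frac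 k2)}-e^{\phi_2^{(-)}(z;\mp\frac{k+2}2)\mp\phi_1^{(-)}(z;\mp\frac k2)}\Bigr):,$$ $$S(z)=\tfrac{-1}{q-q^{-1}}:e^{\phi_1(k+2|z;-\frac{k+2}2)}\Bigl(e^{\phi_2^{(+)}(z;\frac{k+2}2)+\phi_1^{(+)}(z;\frac k2)}-e^{-\phi_2^{(-)}(z;\frac{k+2}2)-\phi_1^{(-)}(z;\frac k2)}\Bigr):,\qquad \eta(z)=:e^{-\phi_1(2|z;\frac k2)-\phi_2(2|z;\frac{k+2}2)}:.$$ *Fock modules.* For $J,M,n',n\in\mathbb Z$ let $\mathcal F_{J,M;n',n}=\mathbb C[a_{j,-m}:j=0,1,2,\ m>0]\,|J,M;n',n\rangle$, where $|J,M;n',n\rangle$ is annihilated by all $a_{j,m}$, $m>0$, and has $P_0=-\sqrt2\,\alpha_{n',n}$, $P_1=J$, $P_2=-M$, with $\alpha_{n',n}=-\frac{1-n'}2\sqrt{\frac{r-k}{kr}}+\frac{1-n}2\sqrt{\frac r{k(r-k)}}$. It is graded by $\deg a_{j,-m}=m$. Operators are given by their matrix entries in the monomial basis; they map a Fock module to the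 completion by degree of another one. *Screening operators.* With $\hat\Pi=\sqrt{\frac{2r(r-k)}k}P_0-\frac{r-k}kP_2$ and $\hat\Pi'=\sqrt{\frac{2r(r-k)}k}P_0-\frac rkP_2$, all contours being $|z|=1$, $$Q_+=\oint\!\tfrac{dz}{2\pi iz}E(z)\tfrac{[u-\frac12+\hat\Pi]_{r-k}}{[u-\frac12]_{r-k}},\quad Q_-=\oint\!\tfrac{dz}{2\pi iz}F(z)\tfrac{[u+\frac12-\hat\Pi']_{r}}{[u+\frac12]_{r}},\quad Q=\oint\!\tfrac{dz}{2\pi iz}S(z)\tfrac{[u-\frac12+P_1]_{k+2}}{[u-\frac12]_{k+2}},\quad \eta_0=\oint\!\tfrac{dz}{2\pi i}\eta(z).$$ *Products.* A product of $N$ operators $Q_+$ (respectively $Q_-$, $Q$) is understood as the $N$-fold integral over $|z_1|=\dots=|z_N|=1$ of the product of the $N$ integrands, in which each matrix entry of $E(z_1)\cdots E(z_N)$ (respectively of the product of the currents $F$, $S$), a convergent series for $|z_1|\gg\dots\gg|z_N|$, is replaced by its analytic continuation, in the variables $u_1,\dots,u_N$, to the domain where $[u_i-u_j+1]_x\ne0$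 for all $i\ne j$; here $x=r-k$ (respectively $r$, $k+2$). **Theorem 5.5.** The screening operators $Q_+,Q_-,Q,\eta_0$ are nilpotent. Precisely, on every $\mathcal F_{J,M;n',n}$ the continuations needed below exist, the values of the integrals are uniquely determined, and $$Q_+^nQ_+^{r-k-n}=Q_+^{r-k-n}Q_+^n=Q_+^{r-k}=0\quad(0\le n\le r-k),$$ $$Q_-^nQ_-^{r-n}=Q_-^{r-n}Q_-^n=Q_-^r=0\quad(0\le n\le r),$$ $$Q^nQ^{k+2-n}=Q^{k+2-n}Q^n=Q^{k+2}=0\quad(0\le n\le k+2),$$ and, if $J\equiv M\pmod 2$ (which makes the integrand of $\eta_0$ single valued), $\eta_0^2=0$. Moreover, for $Q_+$, $Q$ and (if $J\equiv M \pmod 2$) $\eta_0$ these identities hold for the literal compositions of operators: for all powers and products involved, the sums over the degree of the intermediate states converge absolutely for every matrix entry, and the resulting operators $Q_+^{r-k}$, $Q_+^nQ_+^{r-k-n}$, $Q^{k+2}$, $Q^nQ^{k+2-n}$, $\eta_0^2$ are zero. Hence the Fock modules (completed by degree) form complexes, in the sense that consecutive arrows compose to zero, with arrows alternately $Q_+^n$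 and $Q_+^{r-k-n}$, respectively alternately $Q^n$ and $Q^{k+2-n}$, respectively $\eta_0$. -/

import Mathlib

noncomputable section

namespace ThetaScreening

open Complex

/-! ## `q`-numbers and theta functions

Throughout `q` is a complex number with `0 < |q| < 1`, and `q ^ s = exp (s log q)`.
A point `z` of the punctured plane is written `z = q ^ (2 u)`; functions of `z` that involve
`log z = 2 u log q` are written as functions of `u`. -/

/-- `[s] = (q ^ s - q ^ (-s)) / (q - q⁻¹)`. -/
def qnum (q s : ℂ) : ℂ := (q ^ s - q ^ (-s)) / (q - q⁻¹)

/-- The Jacobi theta function `ϑ₁(v | τ)`. -/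
def theta1 (v τ : ℂ) : ℂ :=
  I * ∑' n : ℤ, (-1 : ℂ) ^ n * exp (Real.pi * I * ((n : ℂ) - 1 / 2) ^ 2 * τ)
    * exp (2 * Real.pi * I * ((n : ℂ) - 1 / 2) * v)

/-- `[u]_x = ϑ₁(u / x | τ_x)` with `q ^ (2 x) = exp (-2 π i / τ_x)`. -/
def bracket (q x u : ℂ) : ℂ := theta1 (u / x) (-(Real.pi * I) / (x * log q))

/-! ## The boson Fock space -/

/-- The index `(j, m)` stands for the creation operator `a_{j,-(m+1)}`, `j = 0, 1, 2`. -/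
abbrev Osc := Fin 3 × ℕ

/-- A basis vector `∏ a_{j,-(m+1)} ^ e(j,m) |P⟩` of a Fock module, recorded by its exponents. -/
abbrev Basis := Osc →₀ ℕ

/-- The eigenvalues of the zero modes `P_0, P_1, P_2` on a Fock module. -/
abbrev Momentum := Fin 3 → ℂ

/-- The degree of a basis vector: `a_{j,-m}` has degree `m`. -/
def degree (e : Basis) : ℕ := e.sum fun i n => n * (i.2 + 1)

theorem finite_degree (d : ℕ) : {e : Basis | degree e = d}.Finite := by
  classical
  refine Set.Finite.subset (Finset.finite_toSet
    (((Finset.univ : Finset (Fin 3)) ×ˢ Finset.range d).finsupp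
      fun _ => Finset.range (d + 1))) ?_
  intro e he
  have he' : degree e = d := he
  have key : ∀ i ∈ e.support, e i * (i.2 + 1) ≤ d := by
    intro i hi
    rw [← he']
    exact Finset.single_le_sum (f := fun i : Osc => e i * (i.2 + 1))
      (fun _ _ => Nat.zero_le _) hi
  have hle : ∀ i, e i ≤ d := by
    intro i
    by_cases hi : i ∈ e.support
    · exact le_trans (Nat.le_mul_of_pos_right _ (Nat.succ_pos _)) (key i hi)
    · rw [Finsupp.notMem_support_iff.mp hi]
      exact Nat.zero_le _
  simp only [Finset.mem_coe, Finset.mem_finsupp_iff]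
  refine ⟨?_, ?_⟩
  · intro i hi
    have h1 : 1 ≤ e i := Nat.one_le_iff_ne_zero.mpr (Finsupp.mem_support_iff.mp hi)
    have h2 := key i hi
    have h3 : i.2 + 1 ≤ d := le_trans (Nat.le_mul_of_pos_left _ h1) h2
    simp only [Finset.mem_product, Finset.mem_univ, Finset.mem_range, true_and]
    omega
  · intro i _
    simpa using Nat.lt_succ_of_le (hle i)

/-- The finitely many basis vectors of degree `d`. -/
def level (d : ℕ) : Finset Basis := (finite_degree d).toFinset

/-! ## Operators between Fock modules, given by their matrix entries -/

/-- A family of operators, one on every Fock module. The operator maps the module of momentum `p`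
to (the completion by degree of) the module of momentum `p + shift`;
`entry p e f` is the coefficient of the basis vector `e` in the image of the basis vector `f`. -/
structure Op where
  shift : Momentum
  entry : Momentum → Basis → Basis → ℂ

namespace Op

/-- The identity. -/
def id : Op where
  shift := 0
  entry _ e f := if e = f then 1 else 0

/-- The contribution to `A ∘ B` of the intermediate states of degree `d`. -/
def compTerm (A B : Op) (p : Momentum) (e f : Basis) (d : ℕ) : ℂ :=
  ∑ g ∈ level d, A.entry (p + B.shift) e g * B.entry p g f

/-- The composite `A ∘ B` is defined on the module of momentum `p`: for each matrix entry,
the sum over the degree of the intermediate states converges absolutely. -/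
def Composable (A B : Op) (p : Momentum) : Prop :=
  ∀ e f, Summable (compTerm A B p e f)

/-- The composite `A ∘ B`. -/
def comp (A B : Op) : Op where
  shift := A.shift + B.shift
  entry p e f := ∑' d, compTerm A B p e f d

/-- `A₁ ∘ (A₂ ∘ (⋯ ∘ Aₙ))`. -/
def prod : List Op → Op
  | [] => Op.id
  | A :: l => comp A (prod l)

/-- All the composites formed in `prod` are defined on the module of momentum `p`. -/
def ProdComposable : List Op → Momentum → Prop
  | [], _ => True
  | A :: l, p => ProdComposable l p ∧ Composable A (prod l) p

/-- The power `A ^ n`. -/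
def pow (A : Op) (n : ℕ) : Op := prod (List.replicate n A)

/-- The power `A ^ n` is defined on the module of momentum `p`. -/
def PowDefined (A : Op) (n : ℕ) (p : Momentum) : Prop :=
  ProdComposable (List.replicate n A) p

/-- `A` vanishes on the module of momentum `p`. -/
def VanishesOn (A : Op) (p : Momentum) : Prop := ∀ e f, A.entry p e f = 0

/-- On the module of momentum `p`, the power `A ^ N` is defined and zero, and so is each of the
composites `A ^ a ∘ A ^ b` with `a + b = N`. -/
def NilpotentOn (A : Op) (N : ℕ) (p : Momentum) : Prop :=
  (A.PowDefined N p ∧ (A.pow N).VanishesOn p) ∧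
  ∀ a b : ℕ, a + b = N →
    A.PowDefined b p ∧ A.PowDefined a (p + (A.pow b).shift) ∧
      Composable (A.pow a) (A.pow b) p ∧ (comp (A.pow a) (A.pow b)).VanishesOn p

end Op

/-! ## Boson fields and normal ordered exponentials -/

/-- A formal linear combination of the bosons: at `j`, the coefficient of `Q_j`, the coefficient
of `P_j`, and the coefficients of the `a_{j,m}`, `m ∈ ℤ \ {0}`. -/
abbrev BosonField := Fin 3 → ℂ × ℂ × (ℤ → ℂ)

/-- The scalars in `[a_{j,m}, a_{j,-m}]`. -/
def oscComm (q : ℂ) (k r : ℕ) (j : Fin 3) (m : ℂ) : ℂ :=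
  ![qnum q (2 * m) * qnum q (k * m) / m * (qnum q (r * m) / qnum q (((r : ℂ) - k) * m)),
    qnum q (2 * m) * qnum q (((k : ℂ) + 2) * m) / m,
    -(qnum q (2 * m) * qnum q (k * m) / m)] j

/-- The scalars `[P_j, Q_j]`. -/
def zeroComm (k : ℕ) (j : Fin 3) : ℂ := ![-I, 2 * ((k : ℂ) + 2), -(2 * (k : ℂ))] j

/-- `exp (∑ c(j,m) a_{j,-(m+1)})` as a power series in the creation operators. It is the product
of the exponential series of the single terms. -/
def expCreation (c : Osc → ℂ) : MvPowerSeries Osc ℂ :=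
  fun e => e.prod fun i n => c i ^ n / (n.factorial : ℂ)

/-- `exp (∑ b(j,m) a_{j,m+1})` on polynomials in the creation operators. As `a_{j,m}` acts as
`[a_{j,m}, a_{j,-m}] ∂/∂a_{j,-m}`, this is the translation of the variables. -/
def expAnnihilation (q : ℂ) (k r : ℕ) (b : Osc → ℂ) :
    MvPolynomial Osc ℂ →ₐ[ℂ] MvPolynomial Osc ℂ :=
  MvPolynomial.aeval fun i =>
    MvPolynomial.X i + MvPolynomial.C (b i * oscComm q k r i.1 ((i.2 : ℂ) + 1))

/-- The normal ordered exponential `:exp X:`, that is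
`exp(creation part) exp(annihilation part) exp(∑ c_j Q_j) exp(∑ d_j P_j)`.
The factor `exp(c_j Q_j)` raises `P_j` by `c_j [P_j, Q_j]`. -/
def normalExp (q : ℂ) (k r : ℕ) (X : BosonField) : Op where
  shift := fun j => zeroComm k j * (X j).1
  entry p e f :=
    exp (∑ j, (X j).2.1 * p j) *
      MvPowerSeries.coeff e
        (expCreation (fun i => (X i.1).2.2 (-((i.2 : ℤ) + 1))) *
          ((expAnnihilation q k r (fun i => (X i.1).2.2 ((i.2 : ℤ) + 1))
            (MvPolynomial.monomial f 1) : MvPolynomial Osc ℂ) : MvPowerSeries Osc ℂ))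

/-- The coefficients `[A m] / ([B m] [C m]) z^{-m} q^{D |m|}`, `m ≠ 0`. -/
def oscCoeff (q A B C u D : ℂ) (m : ℤ) : ℂ :=
  if m = 0 then 0 else
    qnum q (A * m) / (qnum q (B * m) * qnum q (C * m)) * q ^ (-(2 * u * m)) *
      q ^ (D * (|m| : ℤ))

/-- `φ_0(A; B, C | z; D)`. -/
def phiZero (q : ℂ) (k r : ℕ) (A B C u D : ℂ) : BosonField :=
  let c : ℂ := A / (B * C) * (Real.sqrt (2 * k * r / ((r : ℝ) - k)) : ℝ)
  Pi.single 0 (c * I, c * (2 * u * log q), oscCoeff q A B C u D)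

/-- `φ'_0(A; B, C | z; D)`, written through `a'_{0,m} = [(r-k)m]/[rm] a_{0,m}`. -/
def phiZero' (q : ℂ) (k r : ℕ) (A B C u D : ℂ) : BosonField :=
  let c : ℂ := A / (B * C) * (Real.sqrt (2 * k * ((r : ℝ) - k) / r) : ℝ)
  Pi.single 0 (c * I, c * (2 * u * log q), fun m =>
    oscCoeff q A B C u D m * (qnum q (((r : ℂ) - k) * m) / qnum q (r * m)))

/-- `φ_j(A; B, C | z; D)`, `j = 1, 2`. -/
def phi (q : ℂ) (j : Fin 3) (A B C u D : ℂ) : BosonField :=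
  Pi.single j (-(A / (B * C)), -(A / (B * C)) * (2 * u * log q), oscCoeff q A B C u D)

/-- `φ_j^{(+)}(A; B | z; C)`, `j = 1, 2`. -/
def phiPlus (q : ℂ) (j : Fin 3) (A B u C : ℂ) : BosonField :=
  Pi.single j (0, log q / 2, fun m =>
    if 0 < m then
      (q - q⁻¹) * (qnum q (A * m) / qnum q (B * m)) * q ^ (-(2 * u * m)) * q ^ (C * m)
    else 0)

/-- `φ_j^{(-)}(A; B | z; C)`, `j = 1, 2`; here `m` is the (negative) index of `a_{j,m}`. -/
def phiMinus (q : ℂ) (j : Fin 3) (A B u C : ℂ) : BosonField :=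
  Pi.single j (0, log q / 2, fun m =>
    if m < 0 then
      (q - q⁻¹) * (qnum q (A * (-m : ℤ)) / qnum q (B * (-m : ℤ))) * q ^ (2 * u * (-m : ℤ)) *
        q ^ (C * (-m : ℤ))
    else 0)

/-! ## The currents -/

/-- `c (:exp X: - :exp Y:)`, where `X` and `Y` have the same `Q`-part. -/
def twoTerm (q : ℂ) (k r : ℕ) (c : ℂ) (X Y : BosonField) : Op where
  shift := (normalExp q k r X).shift
  entry p e f := c * ((normalExp q k r X).entry p e f - (normalExp q k r Y).entry p e f)

/-- `E(z) = Ψ(z) :exp(-φ_0(k|z)):`; the parafermion current `Ψ = Ψ⁻` only involves the bosons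
`j = 1, 2`, so the product is normal ordered. -/
def currentE (q : ℂ) (k r : ℕ) (u : ℂ) : Op :=
  let X : BosonField := -phiZero q k r 1 1 k u 0 - phi q 2 1 1 k u (-(k / 2))
  twoTerm q k r (1 / (q - q⁻¹))
    (X + (-phiPlus q 2 1 2 u ((k + 2) / 2) - phiPlus q 1 1 2 u (k / 2)))
    (X + (phiMinus q 2 1 2 u ((k + 2) / 2) + phiMinus q 1 1 2 u (k / 2)))

/-- `F(z) = Ψ†(z) :exp(φ'_0(k|z)):` with `Ψ† = Ψ⁺`. -/
def currentF (q : ℂ) (k r : ℕ) (u : ℂ) : Op :=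
  let X : BosonField := phiZero' q k r 1 1 k u 0 + phi q 2 1 1 k u (k / 2)
  twoTerm q k r (-1 / (q - q⁻¹))
    (X + (-phiPlus q 2 1 2 u (-((k + 2) / 2)) + phiPlus q 1 1 2 u (-(k / 2))))
    (X + (phiMinus q 2 1 2 u (-((k + 2) / 2)) - phiMinus q 1 1 2 u (-(k / 2))))

/-- `S(z)`. -/
def currentS (q : ℂ) (k r : ℕ) (u : ℂ) : Op :=
  let X : BosonField := phi q 1 1 1 (k + 2) u (-((k + 2) / 2))
  twoTerm q k r (-1 / (q - q⁻¹))
    (X + (phiPlus q 2 1 2 u ((k + 2) / 2) + phiPlus q 1 1 2 u (k / 2)))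
    (X + (-phiMinus q 2 1 2 u ((k + 2) / 2) - phiMinus q 1 1 2 u (k / 2)))

/-- `η(z)`. -/
def currentEta (q : ℂ) (k r : ℕ) (u : ℂ) : Op :=
  normalExp q k r (-phi q 1 1 1 2 u (k / 2) - phi q 2 1 1 2 u ((k + 2) / 2))

/-! ## Screening operators -/

/-- The value of `u` at the point `z = exp(i θ)` of the unit circle. -/
def circlePoint (q : ℂ) (θ : ℝ) : ℂ := I * θ / (2 * log q)

/-- The operator `∮_{|z|=1} dz/(2πi z) A(z) w(P, z)`, with the function `w` of the zero modes
to the right of the current `A`. -/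
def contourOp (q : ℂ) (A : ℂ → Op) (w : Momentum → ℂ → ℂ) : Op where
  shift := (A 0).shift
  entry p e f := ((2 * Real.pi : ℝ) : ℂ)⁻¹ * ∫ θ in (0 : ℝ)..(2 * Real.pi),
    (A (circlePoint q θ)).entry p e f * w p (circlePoint q θ)

/-- `Π̂ = √(2r(r-k)/k) P_0 - (r-k)/k P_2`. -/
def hatPi (k r : ℕ) (p : Momentum) : ℂ :=
  (Real.sqrt (2 * r * ((r : ℝ) - k) / k) : ℝ) * p 0 - ((r : ℂ) - k) / k * p 2

/-- `Π̂' = √(2r(r-k)/k) P_0 - r/k P_2`. -/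
def hatPi' (k r : ℕ) (p : Momentum) : ℂ :=
  (Real.sqrt (2 * r * ((r : ℝ) - k) / k) : ℝ) * p 0 - (r : ℂ) / k * p 2

/-- The theta function factor of `Q_+`. -/
def weightPlus (q : ℂ) (k r : ℕ) (p : Momentum) (u : ℂ) : ℂ :=
  bracket q ((r : ℂ) - k) (u - 1 / 2 + hatPi k r p) / bracket q ((r : ℂ) - k) (u - 1 / 2)

/-- The theta function factor of `Q_-`. -/
def weightMinus (q : ℂ) (k r : ℕ) (p : Momentum) (u : ℂ) : ℂ :=
  bracket q r (u + 1 / 2 - hatPi' k r p) / bracket q r (u + 1 / 2)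

/-- The theta function factor of `Q`. -/
def weightS (q : ℂ) (k : ℕ) (p : Momentum) (u : ℂ) : ℂ :=
  bracket q ((k : ℂ) + 2) (u - 1 / 2 + p 1) / bracket q ((k : ℂ) + 2) (u - 1 / 2)

/-- `Q_+`. -/
def screenPlus (q : ℂ) (k r : ℕ) : Op := contourOp q (currentE q k r) (weightPlus q k r)

/-- `Q`. -/
def screenS (q : ℂ) (k r : ℕ) : Op := contourOp q (currentS q k r) (weightS q k)

/-- `η_0 = ∮ dz/(2πi) η(z)`; relative to `dz/(2πi z)` there is a factor `z = q ^ (2 u)`. -/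
def screenEta (q : ℂ) (k r : ℕ) : Op := contourOp q (currentEta q k r) fun _ u => q ^ (2 * u)

/-! ## Products of screening operators as multiple contour integrals

The product `A(z_1) ⋯ A(z_N)` of currents converges for `|z_1| ≫ ⋯ ≫ |z_N|` and is continued
analytically from there; in a product of screening operators all the `z_i` run over the
unit circle. -/

/-- The domain of the continuation: the zeros of the theta functions `[u_i - u_j ± 1]_x`
in the exchange relations of the current are removed. -/
def exchangeDomain (q x : ℂ) (N : ℕ) : Set (Fin N → ℂ) :=
  {u | ∀ i j, i ≠ j → bracket q x (u i - u j + 1) ≠ 0}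

/-- `G` is the analytic continuation of the matrix entry `(e, f)` of `A(z_1) ⋯ A(z_N)` on the
module of momentum `p`, from a region `|z_1| ≫ ⋯ ≫ |z_N|` in which the product converges. -/
def IsContinuedProduct (q : ℂ) (A : ℂ → Op) (x : ℂ) (N : ℕ) (p : Momentum) (e f : Basis)
    (G : (Fin N → ℂ) → ℂ) : Prop :=
  AnalyticOnNhd ℂ G (exchangeDomain q x N) ∧
  ∃ ε : ℝ, 0 < ε ∧ ∀ u ∈ exchangeDomain q x N,
    (∀ i j, i < j → ‖q ^ (2 * u j)‖ ≤ ε * ‖q ^ (2 * u i)‖) →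
      Op.ProdComposable (List.ofFn fun i => A (u i)) p ∧
        (Op.prod (List.ofFn fun i => A (u i))).entry p e f = G u

/-- `∮ ∏ dz_j/(2πi z_j)` over `|z_1| = ⋯ = |z_N| = 1`, with `z_j = exp(i θ_j)`. -/
def torusIntegral (N : ℕ) (g : (Fin N → ℝ) → ℂ) : ℂ :=
  (((2 * Real.pi) ^ N : ℝ) : ℂ)⁻¹ *
    ∫ θ in Set.Icc (0 : Fin N → ℝ) (fun _ => 2 * Real.pi), g θ

/-- The points `u_j` at the points `exp(i θ_j)` of the unit circle. -/
def torusPoint (q : ℂ) {N : ℕ} (θ : Fin N → ℝ) : Fin N → ℂ := fun j => circlePoint q (θ j)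

/-- The theta function factors of `N` successive screening operators, after all of them are moved
to the right of the currents: the `j`-th one is evaluated at the momentum reached after the
action of the `N - 1 - j` currents to its right. -/
def weightProduct (s : Momentum) (w : Momentum → ℂ → ℂ) (N : ℕ) (p : Momentum)
    (u : Fin N → ℂ) : ℂ :=
  ∏ j : Fin N, w (p + (N - 1 - (j : ℕ)) • s) (u j)

/-- The `N`-th power of the screening operator with current `A` and factor `w` has the matrix
entry `c` at `(e, f)` on the module of momentum `p`. -/
def HasContourPower (q : ℂ) (A : ℂ → Op) (w : Momentum → ℂ → ℂ) (x : ℂ) (N : ℕ)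
    (p : Momentum) (e f : Basis) (c : ℂ) : Prop :=
  ∃ G, IsContinuedProduct q A x N p e f G ∧
    c = torusIntegral N fun θ =>
      G (torusPoint q θ) * weightProduct (A 0).shift w N p (torusPoint q θ)

/-- The product of the `a`-th and the `b`-th power of the screening operator with current `A` and
factor `w` has the matrix entry `c` at `(e, f)` on the module of momentum `p`. -/
def HasContourProduct (q : ℂ) (A : ℂ → Op) (w : Momentum → ℂ → ℂ) (x : ℂ) (a b : ℕ)
    (p : Momentum) (e f : Basis) (c : ℂ) : Prop :=
  ∃ G, IsContinuedProduct q A x (a + b) p e f G ∧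
    c = torusIntegral a fun α => torusIntegral b fun β =>
      G (Fin.append (torusPoint q α) (torusPoint q β)) *
        (weightProduct (A 0).shift w a (p + b • (A 0).shift) (torusPoint q α) *
          weightProduct (A 0).shift w b p (torusPoint q β))

/-- As multiple contour integrals, the `N`-th power of the screening operator with current `A` and
factor `w`, and all products of its `a`-th and `b`-th powers with `a + b = N`, exist and are zero
on the module of momentum `p`: each matrix entry has exactly one value, namely `0`. -/
def ContourNilpotentOn (q : ℂ) (A : ℂ → Op) (w : Momentum → ℂ → ℂ) (x : ℂ) (N : ℕ)
    (p : Momentum) : Prop :=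
  (∀ e f c, HasContourPower q A w x N p e f c ↔ c = 0) ∧
  ∀ a b : ℕ, a + b = N → ∀ e f c, HasContourProduct q A w x a b p e f c ↔ c = 0

/-! ## The Fock modules of the theorem -/

/-- `α_{n',n} = (1-n')/2 α_- + (1-n)/2 α_+` with `α_+ = √(r/(k(r-k)))`,
`α_- = -√((r-k)/(kr))`. -/
def alpha (k r : ℕ) (n' n : ℤ) : ℝ :=
  (1 - n') / 2 * (-Real.sqrt (((r : ℝ) - k) / (k * r))) +
    (1 - n) / 2 * Real.sqrt (r / (k * ((r : ℝ) - k)))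

/-- The momentum of the Fock module `F_{J,M;n',n}`, which is built on
`exp(J/(2(k+2)) Q_1 + M/(2k) Q_2 - i √2 α_{n',n} Q_0) |0⟩`, where `P_j |0⟩ = 0`. -/
def fockMomentum (k r : ℕ) (J M n' n : ℤ) : Momentum := fun j =>
  zeroComm k j *
    ![-(I * (Real.sqrt 2 * alpha k r n' n : ℝ)), (J : ℂ) / (2 * ((k : ℂ) + 2)),
      (M : ℂ) / (2 * k)] j

end ThetaScreening

end

/-! All the vanishing statements come from symmetrising a multiple integral. A product of `N`
currents is a sum of products of pair contractions with a normal ordered exponential, and the latter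
does not depend on the order of its factors. For `E`, `F`, `S` the contraction at `u, v` is `[u - v
+ δ]_x` (with `δ = 1, -1, 1` and `x = r - k, r, k + 2`), up to a constant, times a function that
changes sign when the two factors are exchanged together with their variables
(`IsThetaType.pairFactor_eq`, `thetaQuotient_neg`). The box of integration is invariant under
permutations, so `N!` times the integral is the integral of a common factor times `∑_σ sgn σ ∏_{i<j}
[u_{σ i} - u_{σ j} + δ] ∏_j W_j(u_{σ j})`, where `W_j` is the numerator of the `j`-th weight. Each
current moves the zero mode in the weight by `-2δ`, so the zeros of the `W_j` form an arithmetic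
progression.

The heart is `antisymSum_eq_zero`: for `N = x` variables this alternating sum is identically zero.
The progression is exactly what gives all `N!` terms the same quasi-periods in each variable
(`isTheta_permTerm`). As a function of one variable the sum is therefore a theta function of order
`N`. By antisymmetry it vanishes at the `N - 1` other variables, and one further zero is supplied by
induction; these `N` zeros do not have the sum that a nonzero theta function requires. The induction
starts at the points `t₀ - δ i`, where every single term has a vanishing factor because the period
is `N`. For `η` the contraction `q^{2u} - q^{2v}` is itself antisymmetric and the weights are equal,
so two variables suffice.

The analytic part identifies compositions of operators with integrals. Intermediate states of degree
`d` are weighted by `x^d`. For small `x` the sum over states factorises over the oscillators and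
equals the exponential of the contraction times a polynomial (`hasSum_osc_comp`). Since the
contractions extend holomorphically to a disc of radius `R₀`, so does the generating function, and
its Taylor series can be evaluated at `x = 1` with Cauchy bounds (`hasSum_one_of_differentiableOn`,
`compTerm_normalExp`). On the unit circle the relevant argument has modulus one. If `R₀ > 1`, the
terms decay geometrically in `d`, uniformly on the torus, and literal powers are multiple integrals
(`Represents.pow_contourOp`). This covers `E` and `S` (`R₀ = |q|⁻²`) and `η`. For `F` the radius is
`|q|² < 1`, and the product is continued from `|z_1| ≫ ⋯ ≫ |z_N|`; the continuation is unique
because its domain is connected (`isPreconnected_exchangeDomain`). -/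

noncomputable section

namespace ThetaScreening

open Complex

/-! ## The infinite product `(a; p)_∞` -/

/-- `∏ n, (1 - a p ^ n)`. -/
def poch (p a : ℂ) : ℂ := ∏' n : ℕ, (1 - a * p ^ n)

theorem summable_norm_mul_pow {p : ℂ} (hp : ‖p‖ < 1) (a : ℂ) :
    Summable fun n : ℕ => ‖-(a * p ^ n)‖ := by
  simpa [norm_mul, norm_pow] using
    (summable_geometric_of_lt_one (norm_nonneg p) hp).mul_left ‖a‖

theorem multipliable_poch {p : ℂ} (hp : ‖p‖ < 1) (a : ℂ) :
    Multipliable fun n : ℕ => 1 - a * p ^ n := by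
  simpa [sub_eq_add_neg] using multipliable_one_add_of_summable (summable_norm_mul_pow hp a)

theorem poch_eq_mul {p : ℂ} (hp : ‖p‖ < 1) (a : ℂ) :
    poch p a = (1 - a) * poch p (p * a) := by
  unfold poch
  have h : Multipliable fun n : ℕ => 1 - a * p ^ (n + 1) := by
    simpa [pow_succ, mul_assoc, mul_comm, mul_left_comm] using multipliable_poch hp (p * a)
  rw [tprod_eq_zero_mul' (f := fun n : ℕ => 1 - a * p ^ n) h]
  simp [pow_succ, mul_assoc, mul_comm, mul_left_comm]

theorem poch_ne_zero {p : ℂ} (hp : ‖p‖ < 1) {a : ℂ} (h : ∀ n : ℕ, a * p ^ n ≠ 1) :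
    poch p a ≠ 0 := by
  have := tprod_one_add_ne_zero_of_summable (f := fun n : ℕ => -(a * p ^ n))
    (fun n => by rw [← sub_eq_add_neg, sub_ne_zero]; exact (h n).symm)
    (summable_norm_mul_pow hp a)
  simpa [poch, sub_eq_add_neg] using this

theorem poch_ne_zero_of_norm_lt {p : ℂ} (hp : ‖p‖ < 1) {a : ℂ} (ha : ‖a‖ < 1) :
    poch p a ≠ 0 := by
  refine poch_ne_zero hp fun n h => ?_
  have h1 : ‖a * p ^ n‖ < 1 := by
    rw [norm_mul, norm_pow]
    calc ‖a‖ * ‖p‖ ^ n ≤ ‖a‖ * 1 := by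
          gcongr; exact pow_le_one₀ (norm_nonneg _) hp.le
      _ < 1 := by simpa using ha
  rw [h] at h1
  simp at h1

theorem differentiable_poch {p : ℂ} (hp : ‖p‖ < 1) : Differentiable ℂ (poch p) := by
  have key : HasProdLocallyUniformlyOn (fun (n : ℕ) (a : ℂ) => 1 - a * p ^ n) (poch p)
      Set.univ := by
    simp_rw [sub_eq_add_neg]
    unfold poch
    simp_rw [sub_eq_add_neg]
    apply hasProdLocallyUniformlyOn_of_forall_compact isOpen_univ
    intro K _ hcK
    obtain ⟨B, hB⟩ := hcK.isBounded.exists_norm_le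
    refine ((summable_geometric_of_lt_one (norm_nonneg p) hp).mul_left B).hasProdUniformlyOn_nat_one_add
      hcK (.of_forall fun n x hx ↦ ?_) (fun _ ↦ by fun_prop)
    rw [norm_neg, norm_mul, norm_pow]
    gcongr
    exact hB x hx
  have := key.differentiableOn (.of_forall fun _ ↦ by
    simpa [Finset.prod_fn] using DifferentiableOn.finsetProd (fun _ _ ↦ by fun_prop)) isOpen_univ
  exact differentiableOn_univ.mp this

/-- Each `log (1 - a p^n)` is expanded and the absolutely convergent double series is summed over
`n` first, which gives geometric series. Sums of oscillator commutators appear in this form, so the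
lemma turns contractions into infinite products. -/
theorem exists_hasSum_exp_eq_poch {p : ℂ} (hp : ‖p‖ < 1) {a : ℂ} (ha : ‖a‖ < 1) :
    ∃ L, HasSum (fun m : ℕ => -(a ^ (m + 1) / (1 - p ^ (m + 1)) / ((m : ℂ) + 1))) L ∧
      exp L = poch p a := by
  have hlt : ∀ n : ℕ, ‖a * p ^ n‖ < 1 := fun n => by
    rw [norm_mul, norm_pow]
    calc ‖a‖ * ‖p‖ ^ n ≤ ‖a‖ * 1 := by
          gcongr; exact pow_le_one₀ (norm_nonneg _) hp.le
      _ < 1 := by simpa using ha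
  let f : ℕ × ℕ → ℂ := fun x => -((a * p ^ x.1) ^ (x.2 + 1) / ((x.2 : ℂ) + 1))
  have hrow : ∀ n, HasSum (fun m => f (n, m)) (log (1 - a * p ^ n)) := fun n => by
    have h := (hasSum_taylorSeries_neg_log (hlt n)).neg
    rw [neg_neg] at h
    rw [← hasSum_nat_add_iff' 1] at h
    simpa [f] using h
  have hsum : Summable f := by
    have hg : Summable fun x : ℕ × ℕ => ‖p‖ ^ x.1 * ‖a‖ ^ x.2 :=
      (summable_geometric_of_lt_one (norm_nonneg p) hp).mul_of_nonneg
        (summable_geometric_of_lt_one (norm_nonneg a) ha) (fun _ => by positivity)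
        (fun _ => by positivity)
    refine hg.of_norm_bounded (fun x => ?_)
    obtain ⟨n, m⟩ := x
    simp only [f, norm_neg, norm_div, norm_pow, norm_mul]
    have h1 : (1 : ℝ) ≤ ‖(m : ℂ) + 1‖ := by
      have : ‖(m : ℂ) + 1‖ = (m : ℝ) + 1 := by
        rw [← Nat.cast_succ, Complex.norm_natCast]; push_cast; ring
      rw [this]; linarith [Nat.cast_nonneg (α := ℝ) m]
    calc (‖a‖ * ‖p‖ ^ n) ^ (m + 1) / ‖(m : ℂ) + 1‖ ≤ (‖a‖ * ‖p‖ ^ n) ^ (m + 1) :=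
          div_le_self (by positivity) h1
      _ = ((‖a‖ * ‖p‖ ^ n) ^ m * ‖a‖) * ‖p‖ ^ n := by ring
      _ ≤ (‖a‖ ^ m * 1) * ‖p‖ ^ n := by
          gcongr
          exact mul_le_of_le_one_right (norm_nonneg _) (pow_le_one₀ (norm_nonneg _) hp.le)
      _ = ‖p‖ ^ n * ‖a‖ ^ m := by ring
  have hcol : ∀ m, HasSum (fun n => f (n, m))
      (-(a ^ (m + 1) / (1 - p ^ (m + 1)) / ((m : ℂ) + 1))) := fun m => by
    have hp' : ‖p ^ (m + 1)‖ < 1 := by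
      rw [norm_pow]; exact pow_lt_one₀ (norm_nonneg _) hp (by simp)
    have h := ((hasSum_geometric_of_norm_lt_one hp').mul_left
      (a ^ (m + 1) / ((m : ℂ) + 1))).neg
    have e1 : (fun n => f (n, m)) =
        fun n => -(a ^ (m + 1) / ((m : ℂ) + 1) * (p ^ (m + 1)) ^ n) := by
      funext n
      simp only [f]
      rw [mul_pow, ← pow_mul, ← pow_mul, mul_comm n (m + 1)]
      ring
    have e2 : -(a ^ (m + 1) / (1 - p ^ (m + 1)) / ((m : ℂ) + 1)) =
        -(a ^ (m + 1) / ((m : ℂ) + 1) * (1 - p ^ (m + 1))⁻¹) := by ring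
    rw [e1, e2]
    exact h
  have h1 := hsum.hasSum.prod_fiberwise hrow
  have h2 := ((Equiv.prodComm ℕ ℕ).hasSum_iff.mpr hsum.hasSum).prod_fiberwise hcol
  refine ⟨_, h2, ?_⟩
  rw [← h1.tsum_eq, poch]
  refine cexp_tsum_eq_tprod (fun n => ?_) h1.summable
  rw [sub_ne_zero]
  intro h
  have := hlt n
  rw [← h] at this
  simp at this

end ThetaScreening

namespace ThetaScreening

open Complex

/-! ## Powers of `q` -/

/-- `q ^ s = exp (s log q)`. -/
def qpow (q s : ℂ) : ℂ := exp (s * log q)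

theorem cpow_eq_qpow {q : ℂ} (hq : q ≠ 0) (s : ℂ) : q ^ s = qpow q s := by
  rw [cpow_def_of_ne_zero hq, qpow, mul_comm]

theorem qpow_add (q s t : ℂ) : qpow q (s + t) = qpow q s * qpow q t := by
  simp [qpow, add_mul, exp_add]

theorem qpow_sub (q s t : ℂ) : qpow q (s - t) = qpow q s / qpow q t := by
  simp [qpow, sub_mul, exp_sub]

theorem qpow_neg (q s : ℂ) : qpow q (-s) = (qpow q s)⁻¹ := by
  simp [qpow, exp_neg]

@[simp] theorem qpow_zero (q : ℂ) : qpow q 0 = 1 := by simp [qpow]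

@[simp] theorem qpow_ne_zero (q s : ℂ) : qpow q s ≠ 0 := exp_ne_zero _

theorem qpow_one {q : ℂ} (hq : q ≠ 0) : qpow q 1 = q := by simp [qpow, exp_log hq]

theorem qpow_mul_nat (q s : ℂ) (n : ℕ) : qpow q (s * n) = qpow q s ^ n := by
  rw [qpow, qpow, ← exp_nat_mul]; ring_nf

theorem norm_qpow_real {q : ℂ} (hq : q ≠ 0) (s : ℝ) : ‖qpow q s‖ = ‖q‖ ^ s := by
  rw [← cpow_eq_qpow hq]; exact norm_cpow_real q s

theorem norm_qpow_lt_one {q : ℂ} (hq : q ≠ 0) (hq1 : ‖q‖ < 1) {s : ℝ} (hs : 0 < s) :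
    ‖qpow q s‖ < 1 := by
  rw [norm_qpow_real hq]
  exact Real.rpow_lt_one (norm_nonneg _) hq1 hs

@[fun_prop]
theorem differentiable_qpow (q : ℂ) : Differentiable ℂ (qpow q) := by
  unfold qpow; fun_prop

end ThetaScreening

namespace ThetaScreening

open Complex

/-! ## Entire functions with the quasi-periods of theta functions -/

/-- The quasi-period `x τ_x = -π i / log q`. -/
def omega (q : ℂ) : ℂ := -(Real.pi * I) / log q

theorem re_log_neg {q : ℂ} (hq0 : q ≠ 0) (hq1 : ‖q‖ < 1) : (log q).re < 0 := by
  rw [log_re]; exact Real.log_neg (norm_pos_iff.mpr hq0) hq1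

theorem log_ne_zero_of_norm_lt {q : ℂ} (hq0 : q ≠ 0) (hq1 : ‖q‖ < 1) : log q ≠ 0 := fun h => by
  have := re_log_neg hq0 hq1
  simp [h] at this

theorem omega_mul_log {q : ℂ} (hq0 : q ≠ 0) (hq1 : ‖q‖ < 1) :
    omega q * log q = -(Real.pi * I) := by
  rw [omega, div_mul_cancel₀ _ (log_ne_zero_of_norm_lt hq0 hq1)]

theorem im_omega_pos {q : ℂ} (hq0 : q ≠ 0) (hq1 : ‖q‖ < 1) : 0 < (omega q).im := by
  have h := re_log_neg hq0 hq1
  have h2 : 0 < normSq (log q) := normSq_pos.mpr (log_ne_zero_of_norm_lt hq0 hq1)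
  rw [omega, neg_div, mul_div_assoc, neg_im, im_ofReal_mul, div_im]
  have h3 : (log q).re / normSq (log q) < 0 := div_neg_of_neg_of_pos h h2
  simp only [I_im, I_re, one_mul, zero_mul, zero_div, sub_zero]
  nlinarith [Real.pi_pos]

/-- Entire functions `f` with `f (v + x) = (-1)^n f v` and
`f (v + x τ) = (-1)^n exp (-π i n τ - 2 π i (n v + s) / x) f v`. -/
structure IsTheta (q x : ℂ) (n : ℕ) (s : ℂ) (f : ℂ → ℂ) : Prop where
  diff : Differentiable ℂ f
  add_x : ∀ v, f (v + x) = (-1) ^ n * f v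
  add_omega : ∀ v, f (v + omega q) =
    (-1) ^ n * exp (-(Real.pi * I * (n * omega q + 2 * (n * v + s))) / x) * f v

namespace IsTheta

variable {q x : ℂ} {n m : ℕ} {s t : ℂ} {f g : ℂ → ℂ}

theorem const (q x c : ℂ) : IsTheta q x 0 0 fun _ => c :=
  ⟨by fun_prop, by simp, by simp⟩

theorem mul (hf : IsTheta q x n s f) (hg : IsTheta q x m t g) :
    IsTheta q x (n + m) (s + t) fun v => f v * g v where
  diff := hf.diff.mul hg.diff
  add_x v := by rw [hf.add_x, hg.add_x]; ring
  add_omega v := by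
    have : exp (-(Real.pi * I * ((n + m : ℕ) * omega q + 2 * ((n + m : ℕ) * v + (s + t)))) / x) =
        exp (-(Real.pi * I * (n * omega q + 2 * (n * v + s))) / x) *
        exp (-(Real.pi * I * (m * omega q + 2 * (m * v + t))) / x) := by
      rw [← exp_add]; congr 1; push_cast; ring
    rw [hf.add_omega, hg.add_omega, this]; ring

theorem prod {ι : Type*} (S : Finset ι) {n : ι → ℕ} {s : ι → ℂ} {f : ι → ℂ → ℂ}
    (h : ∀ i ∈ S, IsTheta q x (n i) (s i) (f i)) :
    IsTheta q x (∑ i ∈ S, n i) (∑ i ∈ S, s i) fun v => ∏ i ∈ S, f i v := by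
  classical
  induction S using Finset.induction_on with
  | empty => simpa using const q x 1
  | insert a S ha ih =>
    simp_rw [Finset.prod_insert ha, Finset.sum_insert ha]
    exact (h a (Finset.mem_insert_self _ _)).mul
      (ih fun i hi => h i (Finset.mem_insert_of_mem hi))

theorem sum {ι : Type*} (S : Finset ι) {f : ι → ℂ → ℂ}
    (h : ∀ i ∈ S, IsTheta q x n s (f i)) :
    IsTheta q x n s fun v => ∑ i ∈ S, f i v where
  diff := by
    have := Differentiable.fun_sum (u := S) fun i hi => (h i hi).diff
    exact this
  add_x v := by
    rw [Finset.mul_sum]; exact Finset.sum_congr rfl fun i hi => (h i hi).add_x v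
  add_omega v := by
    rw [Finset.mul_sum]; exact Finset.sum_congr rfl fun i hi => (h i hi).add_omega v

theorem const_mul (hf : IsTheta q x n s f) (c : ℂ) : IsTheta q x n s fun v => c * f v := by
  simpa using (const q x c).mul hf

theorem comp_add (hf : IsTheta q x n s f) (a : ℂ) :
    IsTheta q x n (s + n * a) fun v => f (v + a) where
  diff := hf.diff.comp (by fun_prop)
  add_x v := by rw [add_right_comm, hf.add_x]
  add_omega v := by
    rw [add_right_comm, hf.add_omega]; congr 4; ring

theorem eq_zero_iff (hf : IsTheta q x n s f) (v : ℂ) (i j : ℤ) :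
    f (v + i * x + j * omega q) = 0 ↔ f v = 0 := by
  have h1 : Function.Periodic (fun v => f v = 0) x := fun v => by
    simp [hf.add_x]
  have h2 : Function.Periodic (fun v => f v = 0) (omega q) := fun v => by
    simp [hf.add_omega]
  have := (h2.int_mul j (v + i * x)).trans (h1.int_mul i v)
  exact iff_of_eq this

end IsTheta

theorem exists_eq_lattice_add {q : ℂ} (hq0 : q ≠ 0) (hq1 : ‖q‖ < 1) {x : ℝ} (hx : 0 < x) (v : ℂ) :
    ∃ a b : ℝ, v = a * x + b * omega q := by
  have h := im_omega_pos hq0 hq1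
  refine ⟨(v.re - v.im / (omega q).im * (omega q).re) / x, v.im / (omega q).im, ?_⟩
  apply Complex.ext
  · simp; field_simp; ring
  · simp; field_simp

/-- Liouville's theorem for functions whose absolute value is doubly periodic. -/
theorem IsTheta.exists_eq_const {q : ℂ} (hq0 : q ≠ 0) (hq1 : ‖q‖ < 1) {x : ℝ} (hx : 0 < x)
    {s : ℂ} {f : ℂ → ℂ} (hf : IsTheta q x 0 s f) (hs : s.im = 0) : ∃ c, ∀ v, f v = c := by
  -- For order `0` the multiplier along `omega q` is the constant `exp(-2πi s/x)`, which is
  -- unimodular because `s` is real. Thus `|f|` is doubly periodic even where `f` is not.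
  have hnorm : ‖exp (-(Real.pi * I * (2 * s)) / x)‖ = 1 := by
    rw [norm_exp]
    have : (-(Real.pi * I * (2 * s)) / (x : ℂ)).re = 0 := by
      rw [div_ofReal_re]; simp [hs]
    rw [this, Real.exp_zero]
  have h1 : Function.Periodic (fun v => ‖f v‖) (x : ℂ) := fun v => by
    simp [hf.add_x]
  have h2 : Function.Periodic (fun v => ‖f v‖) (omega q) := fun v => by
    have := hf.add_omega v
    simp only [Nat.cast_zero, zero_mul, zero_add, pow_zero, one_mul] at this
    simp only [this, norm_mul, hnorm, one_mul]
  have hK : IsCompact ((fun ab : ℝ × ℝ => (ab.1 : ℂ) * x + ab.2 * omega q) ''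
      (Set.Icc 0 1 ×ˢ Set.Icc 0 1)) :=
    (isCompact_Icc.prod isCompact_Icc).image (by fun_prop)
  obtain ⟨B, hB⟩ := hK.exists_bound_of_continuousOn hf.diff.continuous.continuousOn
  have hb : Bornology.IsBounded (Set.range f) := by
    rw [isBounded_iff_forall_norm_le]
    refine ⟨B, ?_⟩
    rintro _ ⟨v, rfl⟩
    obtain ⟨a, b, rfl⟩ := exists_eq_lattice_add hq0 hq1 hx v
    -- Reduction to the fundamental parallelogram: only the fractional parts of the lattice
    -- coordinates matter for `|f|`.
    have e : ((a : ℂ) * x + b * omega q) =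
        ((Int.fract a : ℝ) : ℂ) * x + (Int.fract b : ℝ) * omega q + (⌊a⌋ : ℤ) * x
          + (⌊b⌋ : ℤ) * omega q := by
      have ha : (a : ℂ) = (⌊a⌋ : ℤ) + (Int.fract a : ℝ) := by
        exact_mod_cast (Int.floor_add_fract a).symm
      have hb : (b : ℂ) = (⌊b⌋ : ℤ) + (Int.fract b : ℝ) := by
        exact_mod_cast (Int.floor_add_fract b).symm
      linear_combination (x : ℂ) * ha + omega q * hb
    have := (h2.int_mul ⌊b⌋ (((Int.fract a : ℝ) : ℂ) * x + (Int.fract b : ℝ) * omega q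
      + (⌊a⌋ : ℤ) * x)).trans (h1.int_mul ⌊a⌋ (((Int.fract a : ℝ) : ℂ) * x
      + (Int.fract b : ℝ) * omega q))
    rw [e]
    refine this.le.trans (hB _ ⟨(Int.fract a, Int.fract b), ⟨?_, ?_⟩, rfl⟩)
    · exact ⟨Int.fract_nonneg _, (Int.fract_lt_one _).le⟩
    · exact ⟨Int.fract_nonneg _, (Int.fract_lt_one _).le⟩
  exact ⟨f 0, fun v => hf.diff.apply_eq_apply_of_bounded hb v 0⟩

/-! ## The theta function as a product -/

/-- `q ^ (v² / x - v) (q ^ (2 v); p) (p q ^ (-2 v); p)` with `p = q ^ (2 x)`. -/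
def prodTheta (q x v : ℂ) : ℂ :=
  qpow q (v ^ 2 / x - v) * poch (qpow q (2 * x)) (qpow q (2 * v)) *
    poch (qpow q (2 * x)) (qpow q (2 * x - 2 * v))

theorem norm_nome_lt_one {q : ℂ} (hq0 : q ≠ 0) (hq1 : ‖q‖ < 1) {x : ℝ} (hx : 0 < x) :
    ‖qpow q (2 * x)‖ < 1 := by
  have := norm_qpow_lt_one hq0 hq1 (s := 2 * x) (by positivity)
  simpa using this

theorem qpow_add_omega {q : ℂ} (hq0 : q ≠ 0) (hq1 : ‖q‖ < 1) (v : ℂ) :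
    qpow q (v + 2 * omega q) = qpow q v := by
  rw [qpow, qpow, add_mul, mul_assoc, omega_mul_log hq0 hq1,
    show v * log q + 2 * -(Real.pi * I) = v * log q - 2 * Real.pi * I by ring, exp_periodic.sub_eq]

/-- Splitting off the first factor of `(q^{2v}; p)` leaves an even product times `1 - q^{2v}`; the
linear term `-v` in the exponent of the prefactor makes this odd. -/
theorem prodTheta_neg {q : ℂ} (hq0 : q ≠ 0) (hq1 : ‖q‖ < 1) {x : ℝ} (hx : 0 < x) (v : ℂ) :
    prodTheta q x (-v) = -prodTheta q x v := by
  have hp := norm_nome_lt_one hq0 hq1 hx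
  have h1 := poch_eq_mul hp (qpow q (2 * v))
  have h2 := poch_eq_mul hp (qpow q (2 * -v))
  rw [← qpow_add] at h1 h2
  unfold prodTheta
  rw [h1, h2, show 2 * (x : ℂ) + 2 * -v = 2 * x - 2 * v by ring,
    show 2 * (x : ℂ) - 2 * -v = 2 * x + 2 * v by ring,
    show (-v) ^ 2 / (x : ℂ) - -v = v ^ 2 / x - v + 2 * v by ring, qpow_add q _ (2 * v),
    show 2 * -v = -(2 * v) by ring, qpow_neg]
  have := qpow_ne_zero q (2 * v)
  field_simp
  ring

theorem isTheta_prodTheta {q : ℂ} (hq0 : q ≠ 0) (hq1 : ‖q‖ < 1) {x : ℝ} (hx : 0 < x) :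
    IsTheta q x 1 0 (prodTheta q x) where
  diff := by
    have hp := differentiable_poch (norm_nome_lt_one hq0 hq1 hx)
    unfold prodTheta
    have h1 := hp.comp (show Differentiable ℂ fun v => qpow q (2 * v) from
      (differentiable_qpow q).comp (by fun_prop))
    have h2 := hp.comp (show Differentiable ℂ fun v => qpow q (2 * x - 2 * v) from
      (differentiable_qpow q).comp (by fun_prop))
    have h3 : Differentiable ℂ fun v => qpow q (v ^ 2 / x - v) :=
      (differentiable_qpow q).comp (by fun_prop)
    exact (h3.mul h1).mul h2
  add_x v := by
    have hp := norm_nome_lt_one hq0 hq1 hx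
    have hx' : (x : ℂ) ≠ 0 := by exact_mod_cast hx.ne'
    have h1 := poch_eq_mul hp (qpow q (2 * v))
    have h2 := poch_eq_mul hp (qpow q (-(2 * v)))
    rw [← qpow_add] at h1 h2
    unfold prodTheta
    rw [h1, show 2 * (x : ℂ) - 2 * (v + x) = -(2 * v) by ring, h2,
      show 2 * (v + (x : ℂ)) = 2 * x + 2 * v by ring,
      show 2 * (x : ℂ) + -(2 * v) = 2 * x - 2 * v by ring,
      show (v + (x : ℂ)) ^ 2 / x - (v + x) = v ^ 2 / x - v + 2 * v by field_simp; ring,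
      qpow_add q _ (2 * v), qpow_neg]
    have := qpow_ne_zero q (2 * v)
    field_simp
    ring
  add_omega v := by
    have hx' : (x : ℂ) ≠ 0 := by exact_mod_cast hx.ne'
    unfold prodTheta
    rw [show 2 * (v + omega q) = 2 * v + 2 * omega q by ring, qpow_add_omega hq0 hq1,
      ← qpow_add_omega hq0 hq1 (2 * (x : ℂ) - (2 * v + 2 * omega q)),
      show 2 * (x : ℂ) - (2 * v + 2 * omega q) + 2 * omega q = 2 * x - 2 * v by ring]
    have : qpow q ((v + omega q) ^ 2 / x - (v + omega q)) =
        (-1) ^ 1 * exp (-(Real.pi * I * ((1 : ℕ) * omega q + 2 * ((1 : ℕ) * v + 0))) / x) *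
          qpow q (v ^ 2 / x - v) := by
      rw [qpow, qpow, show ((v + omega q) ^ 2 / x - (v + omega q)) * log q =
        (v ^ 2 / x - v) * log q + (omega q * log q) * ((2 * v + omega q) / x) - omega q * log q by
        ring, omega_mul_log hq0 hq1, sub_neg_eq_add, exp_add, exp_pi_mul_I, exp_add]
      push_cast
      ring_nf
    rw [this]; ring

theorem exists_eq_lattice_of_prodTheta_eq_zero {q : ℂ} (hq0 : q ≠ 0) (hq1 : ‖q‖ < 1) {x : ℝ}
    (hx : 0 < x) {v : ℂ} (h : prodTheta q x v = 0) : ∃ i j : ℤ, v = i * x + j * omega q := by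
  have hl := log_ne_zero_of_norm_lt hq0 hq1
  have hp := norm_nome_lt_one hq0 hq1 hx
  have key : ∀ s : ℂ, qpow q (2 * s) = 1 → ∃ j : ℤ, s = j * omega q := fun s hs => by
    rw [qpow, exp_eq_one_iff] at hs
    obtain ⟨n, hn⟩ := hs
    refine ⟨-n, ?_⟩
    have e := omega_mul_log hq0 hq1
    apply mul_right_cancel₀ hl
    push_cast
    linear_combination hn / 2 + n * e
  rw [prodTheta, mul_eq_zero, mul_eq_zero] at h
  rcases h with (h | h) | h
  · exact absurd h (qpow_ne_zero _ _)
  · by_contra hc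
    refine poch_ne_zero hp (fun n hn => hc ?_) h
    rw [← qpow_mul_nat, ← qpow_add] at hn
    obtain ⟨j, hj⟩ := key (v + x * n) (by rw [← hn]; ring_nf)
    exact ⟨-n, j, by push_cast; linear_combination hj⟩
  · by_contra hc
    refine poch_ne_zero hp (fun n hn => hc ?_) h
    rw [← qpow_mul_nat, ← qpow_add] at hn
    obtain ⟨j, hj⟩ := key (x - v + x * n) (by rw [← hn]; ring_nf)
    exact ⟨n + 1, -j, by push_cast; linear_combination -hj⟩

theorem prodTheta_eq_zero_of_lattice {q : ℂ} (hq0 : q ≠ 0) (hq1 : ‖q‖ < 1) {x : ℝ}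
    (hx : 0 < x) (i j : ℤ) : prodTheta q x (i * x + j * omega q) = 0 := by
  have h0 : prodTheta q x 0 = 0 := by
    have := prodTheta_neg hq0 hq1 hx 0
    rw [neg_zero] at this
    exact self_eq_neg.mp this
  have := ((isTheta_prodTheta hq0 hq1 hx).eq_zero_iff 0 i j).mpr h0
  simpa using this

theorem countable_zeros_prodTheta {q : ℂ} (hq0 : q ≠ 0) (hq1 : ‖q‖ < 1) {x : ℝ} (hx : 0 < x) :
    {v | prodTheta q x v = 0}.Countable := by
  refine (Set.countable_range fun ij : ℤ × ℤ => (ij.1 : ℂ) * x + ij.2 * omega q).mono ?_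
  intro v hv
  obtain ⟨i, j, rfl⟩ := exists_eq_lattice_of_prodTheta_eq_zero hq0 hq1 hx hv
  exact ⟨(i, j), rfl⟩

/-- The zeros are simple. At `0` the function is `1 - q^{2v}` times a function with value `(p; p)²`
there; quasi-periodicity with nowhere vanishing multipliers carries simplicity to the whole lattice.
-/
theorem deriv_prodTheta_ne_zero {q : ℂ} (hq0 : q ≠ 0) (hq1 : ‖q‖ < 1) {x : ℝ}
    (hx : 0 < x) {v : ℂ} (h : prodTheta q x v = 0) : deriv (prodTheta q x) v ≠ 0 := by
  have hp := norm_nome_lt_one hq0 hq1 hx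
  have hT := isTheta_prodTheta hq0 hq1 hx
  have hz : prodTheta q x 0 = 0 := by
    simpa using prodTheta_eq_zero_of_lattice hq0 hq1 hx 0 0
  have h0 : deriv (prodTheta q x) 0 ≠ 0 := by
    set g : ℂ → ℂ := fun v => qpow q (v ^ 2 / x - v) *
      poch (qpow q (2 * x)) (qpow q (2 * x + 2 * v)) *
      poch (qpow q (2 * x)) (qpow q (2 * x - 2 * v)) with hg
    have e : prodTheta q x = fun v => (1 - qpow q (2 * v)) * g v := by
      funext v
      rw [prodTheta, poch_eq_mul hp (qpow q (2 * v)), ← qpow_add, hg]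
      ring
    have hd : Differentiable ℂ g := by
      have hpd := differentiable_poch hp
      have h1 := hpd.comp (show Differentiable ℂ fun v => qpow q (2 * x + 2 * v) from
        (differentiable_qpow q).comp (by fun_prop))
      have h2 := hpd.comp (show Differentiable ℂ fun v => qpow q (2 * x - 2 * v) from
        (differentiable_qpow q).comp (by fun_prop))
      have h3 : Differentiable ℂ fun v => qpow q (v ^ 2 / x - v) :=
        (differentiable_qpow q).comp (by fun_prop)
      exact (h3.mul h1).mul h2
    have h1 : HasDerivAt (fun v => 1 - qpow q (2 * v)) (-(2 * log q)) 0 := by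
      have : HasDerivAt (fun v : ℂ => 2 * v * log q) (2 * log q) 0 := by
        simpa using ((hasDerivAt_id (0 : ℂ)).const_mul 2).mul_const (log q)
      simpa [qpow] using this.cexp.const_sub 1
    have h2 := h1.fun_mul (hd 0).hasDerivAt
    rw [e, h2.deriv]
    have hg0 : g 0 ≠ 0 := by
      simp only [hg]
      simpa using poch_ne_zero_of_norm_lt hp hp
    simp [hg0, log_ne_zero_of_norm_lt hq0 hq1]
  -- At a zero, the derivative of `E · prodTheta` loses the term with `E'`, so being a simple zero
  -- is a property periodic in `w`.
  have step : ∀ (w : ℂ) (E : ℂ → ℂ), Differentiable ℂ E → (∀ v, E v ≠ 0) →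
      (∀ v, prodTheta q x (v + w) = E v * prodTheta q x v) →
      Function.Periodic (fun v => prodTheta q x v = 0 ∧ deriv (prodTheta q x) v ≠ 0) w := by
    intro w E hE hE0 hEq v
    have hA : prodTheta q x (v + w) = 0 ↔ prodTheta q x v = 0 := by
      rw [hEq]; simp [hE0]
    by_cases hv : prodTheta q x v = 0
    · have hder : deriv (prodTheta q x) (v + w) = E v * deriv (prodTheta q x) v := by
        rw [← deriv_comp_add_const, show (fun v => prodTheta q x (v + w)) =
          fun v => E v * prodTheta q x v from funext hEq]
        have := ((hE v).hasDerivAt.fun_mul (hT.diff v).hasDerivAt).deriv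
        rw [hv] at this
        simpa using this
      simp [hA, hv, hder, hE0]
    · simp [hA, hv]
  obtain ⟨i, j, rfl⟩ := exists_eq_lattice_of_prodTheta_eq_zero hq0 hq1 hx h
  have p1 := step x (fun _ => -1) (by fun_prop) (by simp) (fun v => by
    simpa using hT.add_x v)
  have p2 := step (omega q) (fun v => (-1) ^ 1 *
    exp (-(Real.pi * I * ((1 : ℕ) * omega q + 2 * ((1 : ℕ) * v + 0))) / x))
    (by fun_prop) (fun v => by simp [exp_ne_zero]) (fun v => hT.add_omega v)
  have := (p2.int_mul j (0 + i * x)).trans (p1.int_mul i 0)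
  have h3 := (iff_of_eq this).mpr ⟨hz, h0⟩
  simpa using h3.2

end ThetaScreening

namespace ThetaScreening

open Complex

/-! ## Division by theta functions -/

/-- The singularities of `f / h` are removable: near a common zero, where `h` has a simple zero, the
quotient equals the quotient of the two divided differences, whose denominator does not vanish. -/
theorem exists_differentiable_eq_mul {f h : ℂ → ℂ} (hf : Differentiable ℂ f)
    (hh : Differentiable ℂ h) (hz : ∀ v, h v = 0 → f v = 0 ∧ deriv h v ≠ 0) :
    ∃ g, Differentiable ℂ g ∧ ∀ v, f v = g v * h v := by
  classical
  refine ⟨fun v => if h v = 0 then deriv f v / deriv h v else f v / h v, fun a => ?_, fun v => ?_⟩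
  · by_cases ha : h a = 0
    · obtain ⟨hfa, hda⟩ := hz a ha
      have df : Differentiable ℂ (dslope f a) := differentiableOn_univ.mp
        ((Complex.differentiableOn_dslope Filter.univ_mem).mpr hf.differentiableOn)
      have dh : Differentiable ℂ (dslope h a) := differentiableOn_univ.mp
        ((Complex.differentiableOn_dslope Filter.univ_mem).mpr hh.differentiableOn)
      have hne : dslope h a a ≠ 0 := by rwa [dslope_same]
      have hd : DifferentiableAt ℂ (fun v => dslope f a v / dslope h a v) a :=
        (df a).div (dh a) hne
      refine hd.congr_of_eventuallyEq ?_
      filter_upwards [dh.continuous.continuousAt.eventually_ne hne] with v hv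
      by_cases hva : v = a
      · subst hva; simp [ha, dslope_same]
      · have e1 : (v - a) * dslope h a v = h v := by
          have := sub_smul_dslope h a v
          simpa [ha] using this
        have e2 : (v - a) * dslope f a v = f v := by
          have := sub_smul_dslope f a v
          simpa [hfa] using this
        have hva' : v - a ≠ 0 := sub_ne_zero.mpr hva
        rw [if_neg (by rw [← e1]; exact mul_ne_zero hva' hv), ← e1, ← e2]
        field_simp
    · have hd : DifferentiableAt ℂ (fun v => f v / h v) a := (hf a).div (hh a) ha
      refine hd.congr_of_eventuallyEq ?_
      filter_upwards [hh.continuous.continuousAt.eventually_ne ha] with v hv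
      rw [if_neg hv]
  · by_cases hv : h v = 0
    · simp [hv, (hz v hv).1]
    · simp [hv]

section

variable {q : ℂ} (hq0 : q ≠ 0) (hq1 : ‖q‖ < 1) {x : ℝ} (hx : 0 < x)
include hq0 hq1 hx

/-- The factor vanishes only on a countable set, so it can be cancelled on a dense set and then
everywhere by continuity. This transfers functional equations to quotients. -/
theorem eq_of_mul_prodTheta_eq {f g : ℂ → ℂ} (hf : Continuous f) (hg : Continuous g) (t : ℂ)
    (h : ∀ v, f v * prodTheta q x (v - t) = g v * prodTheta q x (v - t)) : f = g := by
  have hc : {v | prodTheta q x (v - t) = 0}.Countable :=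
    (countable_zeros_prodTheta hq0 hq1 hx).preimage (sub_left_injective (b := t))
  refine Continuous.ext_on (hc.dense_compl ℝ) hf hg fun v hv => ?_
  exact mul_right_cancel₀ hv (h v)

/-- One zero yields zeros on its whole lattice coset, and the zeros of `prodTheta` are simple.
Division lowers the order by one and adds the zero to the parameter, so `s` keeps account of the sum
of the zeros. -/
theorem IsTheta.exists_eq_mul {n : ℕ} {s t : ℂ} {f : ℂ → ℂ} (hf : IsTheta q x (n + 1) s f)
    (ht : f t = 0) :
    ∃ g, IsTheta q x n (s + t) g ∧ ∀ v, f v = g v * prodTheta q x (v - t) := by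
  have hT := (isTheta_prodTheta hq0 hq1 hx).comp_add (-t)
  simp only [← sub_eq_add_neg] at hT
  obtain ⟨g, hg, hfg⟩ := exists_differentiable_eq_mul hf.diff hT.diff fun v hv => by
    constructor
    · obtain ⟨i, j, hij⟩ := exists_eq_lattice_of_prodTheta_eq_zero hq0 hq1 hx hv
      rw [show v = t + i * x + j * omega q by linear_combination hij, hf.eq_zero_iff, ht]
    · rw [deriv_comp_sub_const]
      exact deriv_prodTheta_ne_zero hq0 hq1 hx hv
  refine ⟨g, ⟨hg, ?_, ?_⟩, hfg⟩
  · have := eq_of_mul_prodTheta_eq hq0 hq1 hx (f := fun v => g (v + x))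
      (g := fun v => (-1) ^ n * g v) (hg.continuous.comp (by fun_prop))
      (hg.continuous.const_mul _) t fun v => by
        have h1 := hf.add_x v
        rw [hfg, hfg, hT.add_x] at h1
        linear_combination -h1
    exact fun v => congrFun this v
  · have := eq_of_mul_prodTheta_eq hq0 hq1 hx (f := fun v => g (v + omega q))
      (g := fun v => (-1) ^ n *
        exp (-(Real.pi * I * (n * omega q + 2 * (n * v + (s + t)))) / x) * g v)
      (hg.continuous.comp (by fun_prop))
      (Continuous.mul (by fun_prop) hg.continuous) t fun v => by
        have h1 := hf.add_omega v
        rw [hfg, hfg, hT.add_omega] at h1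
        have e : exp (-(Real.pi * I * ((n + 1 : ℕ) * omega q + 2 * ((n + 1 : ℕ) * v + s))) / x) =
          exp (-(Real.pi * I * (n * omega q + 2 * (n * v + (s + t)))) / x) *
          exp (-(Real.pi * I * ((1 : ℕ) * omega q + 2 * ((1 : ℕ) * v + (0 + (1 : ℕ) * -t)))) / x) := by
          rw [← exp_add]; congr 1; push_cast; ring
        rw [e] at h1
        have hE := exp_ne_zero
          (-(Real.pi * I * ((1 : ℕ) * omega q + 2 * ((1 : ℕ) * v + (0 + (1 : ℕ) * -t)))) / x)
        apply mul_right_cancel₀ hE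
        linear_combination -h1
    exact fun v => congrFun this v

theorem IsTheta.exists_eq_mul_prod {ι : Type*} (S : Finset ι) (t : ι → ℂ)
    (ht : ∀ i ∈ S, ∀ j ∈ S, i ≠ j → prodTheta q x (t i - t j) ≠ 0) {n : ℕ} {s : ℂ} {f : ℂ → ℂ}
    (hf : IsTheta q x (n + S.card) s f) (h0 : ∀ i ∈ S, f (t i) = 0) :
    ∃ g, IsTheta q x n (s + ∑ i ∈ S, t i) g ∧
      ∀ v, f v = g v * ∏ i ∈ S, prodTheta q x (v - t i) := by
  classical
  induction S using Finset.induction_on generalizing n with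
  | empty => exact ⟨f, by simpa using hf, by simp⟩
  | insert a S ha ih =>
    rw [Finset.card_insert_of_notMem ha, add_comm S.card, ← add_assoc] at hf
    obtain ⟨g, hg, hfg⟩ := ih (fun i hi j hj => ht i (Finset.mem_insert_of_mem hi) j
      (Finset.mem_insert_of_mem hj)) hf (fun i hi => h0 i (Finset.mem_insert_of_mem hi))
    -- The prescribed zeros are pairwise incongruent modulo the lattice, so the factors already
    -- split off do not vanish at the new one.
    have hga : g (t a) = 0 := by
      have h1 := h0 a (Finset.mem_insert_self _ _)
      rw [hfg, mul_eq_zero, Finset.prod_eq_zero_iff] at h1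
      rcases h1 with h1 | ⟨i, hi, h1⟩
      · exact h1
      · exact absurd h1 (ht a (Finset.mem_insert_self _ _) i (Finset.mem_insert_of_mem hi)
          (fun h => ha (h ▸ hi)))
    obtain ⟨g', hg', hgg'⟩ := hg.exists_eq_mul hq0 hq1 hx hga
    refine ⟨g', ?_, fun v => ?_⟩
    · rw [Finset.sum_insert ha]
      convert hg' using 1
      ring
    · rw [hfg, hgg', Finset.prod_insert ha]; ring

/-- A theta function of order `n` with `n` known zeros of generic sum vanishes. -/
theorem IsTheta.eq_zero_of_zeros {ι : Type*} (S : Finset ι) (t : ι → ℂ)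
    (ht : ∀ i ∈ S, ∀ j ∈ S, i ≠ j → prodTheta q x (t i - t j) ≠ 0) {s : ℂ} {f : ℂ → ℂ}
    (hf : IsTheta q x S.card s f) (h0 : ∀ i ∈ S, f (t i) = 0)
    (him : (s + ∑ i ∈ S, t i).im = 0)
    (hne : exp (-(Real.pi * I * (2 * (s + ∑ i ∈ S, t i))) / x) ≠ 1) (v : ℂ) : f v = 0 := by
  rw [← zero_add S.card] at hf
  obtain ⟨g, hg, hfg⟩ := hf.exists_eq_mul_prod hq0 hq1 hx S t ht h0
  obtain ⟨c, hc⟩ := hg.exists_eq_const hq0 hq1 hx him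
  have h1 := hg.add_omega 0
  simp only [hc, Nat.cast_zero, zero_mul, zero_add, pow_zero, one_mul] at h1
  -- The quotient is a constant that must reproduce itself under the multiplier along `omega q`; a
  -- multiplier different from `1` forces it to be zero.
  have hc0 : c = 0 := by
    by_contra hc0
    exact hne (mul_right_cancel₀ hc0 (by rw [one_mul]; exact h1.symm))
  rw [hfg, hc, hc0, zero_mul]

/-! ## The bracket `[u]_x` -/

omit hq0 hq1 hx in
theorem theta1_eq_jacobiTheta₂ (v τ : ℂ) :
    theta1 v τ = I * exp (Real.pi * I * τ / 4 - Real.pi * I * v) *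
      jacobiTheta₂ (v - τ / 2 + 1 / 2) τ := by
  rw [theta1, jacobiTheta₂, mul_assoc I (exp _), ← tsum_mul_left (a := exp _)]
  refine congrArg (I * ·) (tsum_congr fun n => ?_)
  rw [jacobiTheta₂_term, ← exp_pi_mul_I, ← exp_int_mul, ← exp_add, ← exp_add, ← exp_add]
  congr 1
  ring

omit hq0 hq1 hx in
-- Evenness and periodicity identify the values at `(1 - τ)/2` and `(1 + τ)/2`, while the
-- quasi-period `τ` relates them by the factor `-1`.
theorem jacobiTheta₂_half_period (τ : ℂ) : jacobiTheta₂ (-τ / 2 + 1 / 2) τ = 0 := by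
  have h1 : jacobiTheta₂ (-τ / 2 + 1 / 2) τ = jacobiTheta₂ (-τ / 2 + 1 / 2 + τ) τ := by
    rw [← jacobiTheta₂_neg_left, ← jacobiTheta₂_add_left]
    congr 1; ring
  rw [jacobiTheta₂_add_left', show -Real.pi * I * (τ + 2 * (-τ / 2 + 1 / 2)) = -(Real.pi * I) by
    ring, exp_neg, exp_pi_mul_I] at h1
  norm_num at h1
  exact self_eq_neg.mp h1

omit hq0 hq1 hx in
-- The constant Fourier coefficient of the theta series is `1`: integration over a real period kills
-- every other term. This excludes the trivial constant when the bracket is compared with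
-- `prodTheta`.
theorem exists_jacobiTheta₂_ne_zero {τ : ℂ} (hτ : 0 < τ.im) : ∃ z, jacobiTheta₂ z τ ≠ 0 := by
  by_contra! h
  have hn : ∀ (n : ℤ) (y : ℝ), ‖jacobiTheta₂_term n y τ‖ = Real.exp (-Real.pi * n ^ 2 * τ.im) :=
    fun n y => by rw [norm_jacobiTheta₂_term]; simp
  have hcont : ∀ n : ℤ, Continuous fun y : ℝ => jacobiTheta₂_term n y τ := fun n => by
    unfold jacobiTheta₂_term; fun_prop
  have hs := MeasureTheory.hasSum_integral_of_summable_integral_norm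
    (F := fun (n : ℤ) (y : ℝ) => jacobiTheta₂_term n y τ)
    (μ := MeasureTheory.volume.restrict (Set.Ioc 0 1))
    (fun n => ((hcont n).integrableOn_Icc (a := 0) (b := 1)).mono_set Set.Ioc_subset_Icc_self) (by
      simp_rw [hn]
      simp only [MeasureTheory.integral_const, MeasurableSet.univ, MeasureTheory.measureReal_restrict_apply,
        Set.univ_inter, Real.volume_real_Ioc, sub_zero, zero_le_one, sup_of_le_left, one_smul]
      simpa [mul_assoc, mul_comm, mul_left_comm] using
        summable_pow_mul_jacobiTheta₂_term_bound 0 hτ 0)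
  have e : ∀ y : ℝ, ∑' n : ℤ, jacobiTheta₂_term n y τ = 0 := fun y => h y
  simp_rw [e, MeasureTheory.integral_zero] at hs
  have hterm : ∀ n : ℤ, n ≠ 0 → ∫ y in Set.Ioc (0 : ℝ) 1, jacobiTheta₂_term n y τ = 0 := by
    intro n hn0
    rw [← intervalIntegral.integral_of_le zero_le_one]
    have hc : 2 * Real.pi * I * n ≠ 0 := by
      simp [Real.pi_ne_zero, hn0]
    have e2 : ∀ y : ℝ, jacobiTheta₂_term n y τ =
        exp (2 * Real.pi * I * n * y) * exp (Real.pi * I * n ^ 2 * τ) := fun y => by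
      rw [jacobiTheta₂_term, exp_add]
    simp_rw [e2]
    rw [intervalIntegral.integral_mul_const, integral_exp_mul_complex hc]
    have : exp (2 * Real.pi * I * n) = 1 := by
      rw [exp_eq_one_iff]; exact ⟨n, by ring⟩
    simp [this]
  have h1 := hs.unique (hasSum_single 0 hterm)
  simp [jacobiTheta₂_term] at h1

theorem isTheta_bracket : IsTheta q x 1 0 (bracket q x) where
  diff := by
    have hx' : (x : ℂ) ≠ 0 := by exact_mod_cast hx.ne'
    have hτ : 0 < (-(Real.pi * I) / (x * log q)).im := by
      rw [show -(Real.pi * I) / (x * log q) = omega q / x by rw [omega, div_div, mul_comm (log q)],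
        div_ofReal_im]
      exact div_pos (im_omega_pos hq0 hq1) hx
    unfold bracket
    simp_rw [theta1_eq_jacobiTheta₂]
    intro v
    have h1 := differentiableAt_jacobiTheta₂_fst
      (v / x - (-(Real.pi * I) / (x * log q)) / 2 + 1 / 2) hτ
    have h2 : DifferentiableAt ℂ (fun v : ℂ => v / x - (-(Real.pi * I) / (x * log q)) / 2 + 1 / 2) v := by
      fun_prop
    exact DifferentiableAt.mul (by fun_prop) (DifferentiableAt.fun_comp' v h1 h2)
  add_x v := by
    have hx' : (x : ℂ) ≠ 0 := by exact_mod_cast hx.ne'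
    unfold bracket
    simp_rw [theta1_eq_jacobiTheta₂]
    rw [show (v + x) / (x : ℂ) = v / x + 1 by field_simp, add_sub_right_comm, add_right_comm,
      jacobiTheta₂_add_left, mul_add, mul_one, ← sub_sub, exp_sub _ (Real.pi * I), exp_pi_mul_I]
    ring
  add_omega v := by
    have hx' : (x : ℂ) ≠ 0 := by exact_mod_cast hx.ne'
    unfold bracket
    simp_rw [theta1_eq_jacobiTheta₂]
    have e : -(Real.pi * I) / (x * log q) = omega q / x := by
      rw [omega, div_div, mul_comm (log q)]
    rw [e, add_div, add_sub_right_comm, add_right_comm, jacobiTheta₂_add_left']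
    have : exp (Real.pi * I * (omega q / x) / 4 - Real.pi * I * (v / x + omega q / x)) *
        exp (-Real.pi * I * (omega q / x + 2 * (v / x - omega q / x / 2 + 1 / 2))) =
        (-1) ^ 1 * exp (-(Real.pi * I * ((1 : ℕ) * omega q + 2 * ((1 : ℕ) * v + 0))) / x) *
        exp (Real.pi * I * (omega q / x) / 4 - Real.pi * I * (v / x)) := by
      have h1 : (-1 : ℂ) ^ 1 = exp (-(Real.pi * I)) := by
        rw [exp_neg, exp_pi_mul_I]; norm_num
      rw [h1, ← exp_add, ← exp_add, ← exp_add]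
      congr 1
      push_cast
      field_simp
      ring
    linear_combination (I * jacobiTheta₂ (v / x - omega q / x / 2 + 1 / 2) (omega q / x)) * this

/-- The part of the Jacobi triple product that is needed: both functions have order one, parameter
`0` and a zero at the origin, so their quotient has order `0` and is constant. The value of the
constant plays no role. -/
theorem exists_bracket_eq_mul_prodTheta :
    ∃ c, c ≠ 0 ∧ ∀ v, bracket q x v = c * prodTheta q x v := by
  have hb := isTheta_bracket hq0 hq1 hx
  have h0 : bracket q x 0 = 0 := by
    rw [bracket, theta1_eq_jacobiTheta₂, zero_div, zero_sub, ← neg_div, jacobiTheta₂_half_period,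
      mul_zero]
  obtain ⟨g, hg, hbg⟩ := IsTheta.exists_eq_mul hq0 hq1 hx (n := 0) hb h0
  obtain ⟨c, hc⟩ := hg.exists_eq_const hq0 hq1 hx (by simp)
  refine ⟨c, fun hc0 => ?_, fun v => by rw [hbg, hc, sub_zero]⟩
  have hτ : 0 < (-(Real.pi * I) / (x * log q)).im := by
    rw [show -(Real.pi * I) / (x * log q) = omega q / x by rw [omega, div_div, mul_comm (log q)],
        div_ofReal_im]
    exact div_pos (im_omega_pos hq0 hq1) hx
  obtain ⟨z, hz⟩ := exists_jacobiTheta₂_ne_zero hτ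
  have hx' : (x : ℂ) ≠ 0 := by exact_mod_cast hx.ne'
  have h1 := hbg (x * (z + (-(Real.pi * I) / (x * log q)) / 2 - 1 / 2))
  rw [hc, hc0, zero_mul, bracket, theta1_eq_jacobiTheta₂, mul_div_cancel_left₀ _ hx',
    show z + (-(Real.pi * I) / (x * log q)) / 2 - 1 / 2 - (-(Real.pi * I) / (x * log q)) / 2 + 1 / 2
      = z by ring] at h1
  simp [exp_ne_zero, hz] at h1

end

end ThetaScreening

namespace ThetaScreening

open Complex

/-! ## The antisymmetrisation identity -/

/-- `∏_{i<j} T(u_{σ i} - u_{σ j}) ∏_j W_j(u_{σ j})`. -/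
def permTerm {N : ℕ} (T : ℂ → ℂ) (W : Fin N → ℂ → ℂ) (u : Fin N → ℂ)
    (σ : Equiv.Perm (Fin N)) : ℂ :=
  (∏ i, ∏ j ∈ Finset.Ioi i, T (u (σ i) - u (σ j))) * ∏ j, W j (u (σ j))

/-- The antisymmetrisation of `∏_{i<j} T(u_i - u_j) ∏_j W_j(u_j)`. -/
def antisymSum {N : ℕ} (T : ℂ → ℂ) (W : Fin N → ℂ → ℂ) (u : Fin N → ℂ) : ℂ :=
  ∑ σ : Equiv.Perm (Fin N), ((Equiv.Perm.sign σ : ℤ) : ℂ) * permTerm T W u σ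

theorem antisymSum_comp {N : ℕ} (T : ℂ → ℂ) (W : Fin N → ℂ → ℂ) (u : Fin N → ℂ)
    (ρ : Equiv.Perm (Fin N)) :
    antisymSum T W (u ∘ ρ) = ((Equiv.Perm.sign ρ : ℤ) : ℂ) * antisymSum T W u := by
  unfold antisymSum
  rw [Finset.mul_sum]
  refine Fintype.sum_equiv (Equiv.mulLeft ρ) _ _ fun σ => ?_
  have hs : ((Equiv.Perm.sign ρ : ℤ) : ℂ) * ((Equiv.Perm.sign ρ : ℤ) : ℂ) = 1 := by
    rcases Int.units_eq_one_or (Equiv.Perm.sign ρ) with h | h <;> simp [h]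
  have e : permTerm T W (u ∘ ρ) σ = permTerm T W u (Equiv.mulLeft ρ σ) := by
    simp [permTerm, Equiv.Perm.mul_apply]
  rw [e, Equiv.coe_mulLeft, Equiv.Perm.sign_mul]
  push_cast
  linear_combination (-((Equiv.Perm.sign σ : ℤ) : ℂ) * permTerm T W u (ρ * σ)) * hs

theorem antisymSum_eq_zero_of_eq {N : ℕ} (T : ℂ → ℂ) (W : Fin N → ℂ → ℂ) (u : Fin N → ℂ)
    {a b : Fin N} (hab : a ≠ b) (h : u a = u b) : antisymSum T W u = 0 := by
  have h1 := antisymSum_comp T W u (Equiv.swap a b)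
  have h2 : u ∘ Equiv.swap a b = u := by
    funext i
    simp only [Function.comp_apply, Equiv.swap_apply_def]
    split_ifs with h3 h4
    · rw [h3, h]
    · rw [h4, h]
    · rfl
  rw [h2, Equiv.Perm.sign_swap hab] at h1
  have : antisymSum T W u = -antisymSum T W u := by simpa using h1
  exact self_eq_neg.mp this

section

variable {q : ℂ} (hq0 : q ≠ 0) (hq1 : ‖q‖ < 1) {N : ℕ} (hN : 2 ≤ N)

include hq0 hq1 in
-- The point is that the parameter does not depend on `σ`. If the variable `u_m` stands at position
-- `j = σ⁻¹ m`, it is on the left in `N - 1 - j` theta factors, contributing `+δ` each, and on the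
-- right in `j` factors, contributing `-δ` each by oddness. The weight adds `c + 2δ j`, and the
-- total `c + δ (N - 1)` is free of `j`. This is why the `W_j` must be shifted in steps of `2δ`.
theorem isTheta_permTerm {x : ℝ} (hx : 0 < x) {δ c : ℂ} {W : Fin N → ℂ → ℂ}
    (hW : ∀ j : Fin N, IsTheta q x 1 (c + 2 * δ * (j : ℕ)) (W j)) (u : Fin N → ℂ) (m : Fin N)
    (σ : Equiv.Perm (Fin N)) :
    IsTheta q x N (-∑ b ∈ Finset.univ.erase m, u b + (c + δ * (N - 1))) fun v =>
      permTerm (fun w => prodTheta q x (w + δ)) W (Function.update u m v) σ := by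
  classical
  have hT := isTheta_prodTheta hq0 hq1 hx
  set π := σ.symm with hπ
  -- Reindexing by the variables instead of the positions puts the permutation into the order
  -- condition only, so the factors containing `u_m` can be isolated.
  have e1 : ∀ U : Fin N → ℂ, (∏ i, ∏ j ∈ Finset.Ioi i, prodTheta q x (U (σ i) - U (σ j) + δ)) =
      ∏ a, ∏ b, if π a < π b then prodTheta q x (U a - U b + δ) else 1 := by
    intro U
    refine Fintype.prod_equiv σ _ _ fun i => ?_
    rw [← Finset.filter_lt_eq_Ioi, Finset.prod_filter]
    exact Fintype.prod_equiv σ _ _ fun j => by simp [hπ]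
  have hpair : ∀ a b : Fin N, IsTheta q x
      ((if a = m then (if π m < π b then 1 else 0) else 0) +
        (if b = m then (if π a < π m then 1 else 0) else 0))
      ((if a = m then (if π m < π b then -u b + δ else 0) else 0) +
        (if b = m then (if π a < π m then -u a - δ else 0) else 0))
      (fun v => if π a < π b then prodTheta q x (Function.update u m v a -
        Function.update u m v b + δ) else 1) := by
    intro a b
    by_cases ha : a = m
    · subst ha
      by_cases hb : b = a
      · subst hb
        simpa using IsTheta.const q x 1
      · by_cases hlt : π a < π b
        · simp only [hlt, hb, if_true, if_false, Function.update_self, add_zero,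
            Function.update_of_ne hb]
          have := hT.comp_add (-u b + δ)
          simpa [sub_eq_add_neg, add_assoc] using this
        · simp only [hlt, hb, if_true, if_false, add_zero]
          exact IsTheta.const q x 1
    · by_cases hb : b = m
      · subst hb
        by_cases hlt : π a < π b
        · simp only [hlt, ha, if_true, if_false, Function.update_self, zero_add,
            Function.update_of_ne ha]
          have := (hT.comp_add (-u a - δ)).const_mul (-1)
          have e : ∀ v, prodTheta q x (u a - v + δ) = -1 * prodTheta q x (v + (-u a - δ)) :=
            fun v => by
              rw [neg_one_mul, ← prodTheta_neg hq0 hq1 hx]; congr 1; ring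
          simp_rw [e]
          simpa using this
        · simp only [hlt, ha, if_true, if_false, add_zero]
          exact IsTheta.const q x 1
      · simp only [ha, hb, if_false, add_zero, Function.update_of_ne ha, Function.update_of_ne hb]
        exact IsTheta.const q x _
  have hweight : ∀ j : Fin N, IsTheta q x (if j = π m then 1 else 0)
      (if j = π m then c + 2 * δ * (j : ℕ) else 0)
      (fun v => W j (Function.update u m v (σ j))) := by
    intro j
    by_cases hj : j = π m
    · have : σ j = m := by rw [hj]; simp [hπ]
      simp only [hj, if_true]
      rw [← hj, this]
      simpa using hW j
    · have : σ j ≠ m := fun h => hj (by rw [← h]; simp [hπ])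
      simp only [hj, if_false, Function.update_of_ne this]
      exact IsTheta.const q x _
  have h1 := (IsTheta.prod Finset.univ fun a _ =>
    IsTheta.prod Finset.univ fun b _ => hpair a b).mul
    (IsTheta.prod Finset.univ fun j _ => hweight j)
  simp_rw [permTerm, e1]
  have hcard : ∀ b, (if π m < π b then 1 else 0) + (if π b < π m then 1 else 0) =
      if b = m then 0 else 1 := by
    intro b
    rcases lt_trichotomy (π m) (π b) with h | h | h
    · have : b ≠ m := fun hb => by simp [hb] at h
      simp [h, h.not_gt, this]
    · have : b = m := (π.injective h).symm
      simp [this]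
    · have : b ≠ m := fun hb => by simp [hb] at h
      simp [h, h.not_gt, this]
  convert h1 using 1
  · simp only [Finset.sum_add_distrib, Finset.sum_ite_eq', Finset.mem_univ, if_true]
    simp only [Finset.sum_ite_irrel, Finset.sum_const_zero, Finset.sum_ite_eq', Finset.mem_univ,
      if_true]
    rw [← Finset.sum_add_distrib, Finset.sum_congr rfl fun b _ => hcard b]
    rw [Finset.sum_ite, Finset.sum_const_zero, zero_add, Finset.sum_const, smul_eq_mul, mul_one,
      Finset.filter_ne' Finset.univ m, Finset.card_erase_of_mem (Finset.mem_univ _)]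
    simp
    have := m.pos
    omega
  · simp only [Finset.sum_add_distrib, Finset.sum_ite_eq', Finset.mem_univ, if_true]
    simp only [Finset.sum_ite_irrel, Finset.sum_const_zero, Finset.sum_ite_eq', Finset.mem_univ,
      if_true]
    rw [← Finset.sum_add_distrib]
    have hb : ∀ b, (if π m < π b then -u b + δ else 0) + (if π b < π m then -u b - δ else 0) =
        (if b = m then 0 else -u b) + ((if π m < π b then δ else 0) - if π b < π m then δ else 0) := by
      intro b
      rcases lt_trichotomy (π m) (π b) with h | h | h
      · have : b ≠ m := fun hb => by simp [hb] at h
        simp [h, h.not_gt, this]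
      · have : b = m := (π.injective h).symm
        simp [this]
      · have : b ≠ m := fun hb => by simp [hb] at h
        simp [h, h.not_gt, this, sub_eq_add_neg]
    rw [Finset.sum_congr rfl fun b _ => hb b, Finset.sum_add_distrib, Finset.sum_sub_distrib,
      Equiv.sum_comp π fun i => if π m < i then δ else 0,
      Equiv.sum_comp π fun i => if i < π m then δ else 0]
    simp only [← Finset.sum_filter, Finset.filter_lt_eq_Ioi, Finset.filter_gt_eq_Iio,
      Finset.sum_const, Fin.card_Ioi, Fin.card_Iio, nsmul_eq_mul]
    have e2 : ∑ b, (if b = m then 0 else -u b) = -∑ b ∈ Finset.univ.erase m, u b := by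
      rw [← Finset.sum_neg_distrib, Finset.sum_ite, Finset.sum_const_zero, zero_add,
        Finset.filter_ne' Finset.univ m]
    rw [e2, Nat.sub_sub, Nat.cast_sub (by omega)]
    push_cast
    ring

include hq0 hq1 in
theorem isTheta_antisymSum {x : ℝ} (hx : 0 < x) {δ c : ℂ} {W : Fin N → ℂ → ℂ}
    (hW : ∀ j : Fin N, IsTheta q x 1 (c + 2 * δ * (j : ℕ)) (W j)) (u : Fin N → ℂ) (m : Fin N) :
    IsTheta q x N (-∑ b ∈ Finset.univ.erase m, u b + (c + δ * (N - 1))) fun v =>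
      antisymSum (fun w => prodTheta q x (w + δ)) W (Function.update u m v) :=
  IsTheta.sum _ fun σ _ => (isTheta_permTerm hq0 hq1 hx hW u m σ).const_mul _

include hq0 hq1 hN in
-- Base of the induction; every summand vanishes separately. A factor is zero as soon as `σ i ≡ σ j
-- + 1` modulo the period `N` for some `i < j`, and every permutation has such a pair.
theorem antisymSum_arithmetic {δ : ℤ} {W : Fin N → ℂ → ℂ} (t₀ : ℂ) :
    antisymSum (fun w => prodTheta q (N : ℝ) (w + δ)) W (fun i => t₀ - δ * (i : ℕ)) = 0 := by
  refine Finset.sum_eq_zero fun σ _ => ?_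
  have hx : (0 : ℝ) < N := by exact_mod_cast (by omega : 0 < N)
  obtain ⟨n, rfl⟩ : ∃ n, N = n + 1 := ⟨N - 1, by omega⟩
  have : ∃ i j : Fin (n + 1), i < j ∧
      (((σ j : ℕ) : ℤ) - (σ i : ℕ) + 1 = 0 ∨ ((σ j : ℕ) : ℤ) - (σ i : ℕ) + 1 = (n + 1 : ℕ)) := by
    -- For `j` the last position is taken, so that any other position precedes it. Addition in `Fin
    -- (n + 1)` is cyclic; the wrap-around produces the case in which the difference is the full
    -- period.
    refine ⟨σ.symm (σ (Fin.last n) + 1), Fin.last n, ?_, ?_⟩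
    · refine lt_of_le_of_ne (Fin.le_last _) fun h => ?_
      have h1 : σ (Fin.last n) + 1 = σ (Fin.last n) := by
        rw [Equiv.symm_apply_eq] at h; exact h
      have h2 : (1 : Fin (n + 1)) = 0 := by simpa using h1
      have : n = 0 := by simpa using h2
      omega
    · rw [Equiv.apply_symm_apply, Fin.val_add_one]
      split_ifs with h
      · right; rw [h]; simp
      · left; push_cast; ring
  obtain ⟨i, j, hij, h⟩ := this
  rw [permTerm, mul_eq_zero]
  right
  rw [mul_eq_zero]
  left
  refine Finset.prod_eq_zero (Finset.mem_univ i) (Finset.prod_eq_zero (Finset.mem_Ioi.mpr hij) ?_)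
  have e : t₀ - δ * ((σ i : ℕ) : ℂ) - (t₀ - δ * ((σ j : ℕ) : ℂ)) + δ =
      δ * ((((σ j : ℕ) : ℤ) - (σ i : ℕ) + 1 : ℤ) : ℂ) := by push_cast; ring
  rw [e]
  rcases h with h | h
  · rw [h]
    simpa using prodTheta_eq_zero_of_lattice hq0 hq1 hx 0 0
  · rw [h]
    simpa using prodTheta_eq_zero_of_lattice hq0 hq1 hx δ 0

include hq0 hq1 in
theorem prodTheta_intCast_ne_zero {k : ℤ} (hk : ¬ (N : ℤ) ∣ k) (hN : 0 < N) :
    prodTheta q (N : ℝ) k ≠ 0 := fun h => by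
  have hx : (0 : ℝ) < N := by exact_mod_cast hN
  obtain ⟨i, j, hij⟩ := exists_eq_lattice_of_prodTheta_eq_zero hq0 hq1 hx h
  have him := congrArg Complex.im hij
  have hj : j = 0 := by
    have := (im_omega_pos hq0 hq1).ne'
    simpa [this] using him
  subst hj
  apply hk
  refine ⟨i, ?_⟩
  have : (k : ℂ) = ((N * i : ℤ) : ℂ) := by
    rw [hij]; push_cast; ring
  exact_mod_cast this

include hq0 hq1 hN in
-- Induction on the number `k` of free variables, the others being frozen on an arithmetic
-- progression. When `u_k` is released, the sum is a theta function of order `N` in it, vanishing at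
-- the other `N - 1` variables by antisymmetry and at its frozen position by the previous step. The
-- offset `1/2` of the progression makes the sum of these zeros incompatible with a nonzero
-- function. The genericity assumptions keep the zeros distinct modulo the lattice.
theorem antisymSum_eq_zero_of_generic {δ : ℤ} (hδ : IsUnit δ) {c : ℂ} {W : Fin N → ℂ → ℂ}
    (hW : ∀ j : Fin N, IsTheta q (N : ℝ) 1 (c + 2 * δ * (j : ℕ)) (W j)) (k : ℕ) (hk : k ≤ N)
    (u : Fin N → ℂ)
    (h1 : ∀ i : Fin N, k ≤ (i : ℕ) → u i = 1 / 2 - (c + δ * (N - 1)) - δ * (i : ℕ))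
    (h2 : ∀ i j, i ≠ j → prodTheta q (N : ℝ) (u i - u j) ≠ 0)
    (h3 : ∀ i j : Fin N, (i : ℕ) < k →
      prodTheta q (N : ℝ) (u i - (1 / 2 - (c + δ * (N - 1)) - δ * (j : ℕ))) ≠ 0) :
    antisymSum (fun w => prodTheta q (N : ℝ) (w + δ)) W u = 0 := by
  classical
  have hx : (0 : ℝ) < N := by exact_mod_cast (by omega : 0 < N)
  have hδ' : δ = 1 ∨ δ = -1 := Int.isUnit_iff.mp hδ
  induction k generalizing u with
  | zero =>
    rw [show u = fun i : Fin N => 1 / 2 - (c + δ * (N - 1)) - δ * ((i : ℕ) : ℂ) from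
      funext fun i => h1 i (Nat.zero_le _)]
    exact antisymSum_arithmetic hq0 hq1 hN _
  | succ k ih =>
    set m : Fin N := ⟨k, hk⟩ with hm
    set t : ℂ := 1 / 2 - (c + δ * (N - 1)) - δ * ((m : ℕ) : ℂ) with ht
    have hut : ∀ b : Fin N, b ≠ m → prodTheta q (N : ℝ) (u b - t) ≠ 0 := by
      intro b hb
      rcases lt_or_ge (b : ℕ) (k + 1) with hlt | hge
      · exact h3 b m hlt
      · rw [h1 b hge, ht, show (1 : ℂ) / 2 - (c + δ * (N - 1)) - δ * ((b : ℕ) : ℂ) -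
          (1 / 2 - (c + δ * (N - 1)) - δ * ((m : ℕ) : ℂ)) =
          ((δ * ((m : ℕ) - (b : ℕ) : ℤ) : ℤ) : ℂ) by push_cast; ring]
        refine prodTheta_intCast_ne_zero hq0 hq1 (fun hd => ?_) (by omega)
        rw [hδ.dvd_mul_left] at hd
        have hb2 := b.isLt
        have h4 := Int.eq_zero_of_abs_lt_dvd hd (by rw [abs_lt]; constructor <;> omega)
        have : (m : ℕ) = k := rfl
        omega
    have hut' : ∀ b : Fin N, b ≠ m → prodTheta q (N : ℝ) (t - u b) ≠ 0 := by
      intro b hb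
      rw [← neg_sub, prodTheta_neg hq0 hq1 hx]
      exact neg_ne_zero.mpr (hut b hb)
    have hT := isTheta_antisymSum hq0 hq1 hx hW u m
    have hU : ∀ i, Function.update u m t i = if i = m then t else u i := fun i => by
      simp [Function.update_apply]
    have hcard : (Finset.univ : Finset (Fin N)).card = N := by simp
    have key := IsTheta.eq_zero_of_zeros hq0 hq1 hx Finset.univ (Function.update u m t)
      (f := fun v => antisymSum (fun w => prodTheta q (N : ℝ) (w + δ)) W (Function.update u m v))
      (fun i _ j _ hij => ?_) (by rw [hcard]; exact hT) (fun i _ => ?_) ?_ ?_ (u m)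
    · simpa using key
    · rw [hU, hU]
      split_ifs with hi hj hj
      · exact absurd (hi.trans hj.symm) hij
      · exact hut' j hj
      · exact hut i hi
      · exact h2 i j hij
    · rw [hU]
      split_ifs with hi
      · refine ih (by omega) _ (fun i hi => ?_) (fun i j hij => ?_) (fun i j hi => ?_)
        · rw [hU]
          split_ifs with him
          · rw [ht, him]
          · exact h1 i (lt_of_le_of_ne hi fun h => him (Fin.ext h.symm))
        · rw [hU, hU]
          split_ifs with hi hj hj
          · exact absurd (hi.trans hj.symm) hij
          · exact hut' j hj
          · exact hut i hi
          · exact h2 i j hij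
        · rw [hU, if_neg (fun h => by rw [h] at hi; exact lt_irrefl _ hi)]
          exact h3 i j (by omega)
      · refine antisymSum_eq_zero_of_eq _ _ _ hi ?_
        simp [Function.update_of_ne hi]
    all_goals
      rw [← Finset.add_sum_erase _ _ (Finset.mem_univ m), Function.update_self,
        Finset.sum_congr rfl fun b hb => Function.update_of_ne (Finset.ne_of_mem_erase hb) t u,
        show -∑ b ∈ Finset.univ.erase m, u b + (c + δ * (N - 1)) +
          (t + ∑ b ∈ Finset.univ.erase m, u b) = 1 / 2 - ((δ * m : ℤ) : ℂ) by
          rw [ht]; push_cast; ring]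
    · simp
    -- The multiplier is `exp(-2πi (1/2 - δ k)/N)`. If it were `1`, then `2 δ k - 1` would be an
    -- even integer.
    · intro h
      rw [exp_eq_one_iff] at h
      obtain ⟨n, hn⟩ := h
      have hN0 : (N : ℂ) ≠ 0 := by exact_mod_cast hx.ne'
      have hpi : (Real.pi : ℂ) ≠ 0 := by exact_mod_cast Real.pi_ne_zero
      have h5 : (2 * (δ * m) - 1 : ℂ) = 2 * (n * N) := by
        push_cast at hn
        field_simp at hn
        linear_combination hn
      have h6 : (2 * (δ * m) - 1 : ℤ) = 2 * (n * N) := by exact_mod_cast h5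
      omega

include hq0 hq1 hN in
/-- The antisymmetrisation of `∏_{i<j} [u_i - u_j + δ] ∏_j W_j(u_j)` vanishes, if there are as many
variables as the period and the zeros of the `W_j` are in arithmetic progression. -/
theorem antisymSum_eq_zero {δ : ℤ} (hδ : IsUnit δ) {c : ℂ} {W : Fin N → ℂ → ℂ}
    (hW : ∀ j : Fin N, IsTheta q (N : ℝ) 1 (c + 2 * δ * (j : ℕ)) (W j)) (u : Fin N → ℂ) :
    antisymSum (fun w => prodTheta q (N : ℝ) (w + δ)) W u = 0 := by
  have hx : (0 : ℝ) < N := by exact_mod_cast (by omega : 0 < N)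
  have hT := (isTheta_prodTheta hq0 hq1 hx).diff.continuous
  have hWc : ∀ j, Continuous (W j) := fun j => (hW j).diff.continuous
  -- Different variables move with different nonzero speeds `i + 1`, so all genericity conditions
  -- hold except for countably many `y`; continuity then gives the value at `y = 0`.
  let U : ℝ → Fin N → ℂ := fun y i => u i + y * ((i : ℕ) + 1 : ℂ)
  have hc : ∀ (a b : ℂ), b ≠ 0 → {y : ℝ | prodTheta q (N : ℝ) (a + y * b) = 0}.Countable :=
    fun a b hb => (countable_zeros_prodTheta hq0 hq1 hx).preimage
      (f := fun y : ℝ => a + (y : ℂ) * b) fun y y' h => by simpa [hb] using h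
  have hcount : ((⋃ ij : {ij : Fin N × Fin N // ij.1 ≠ ij.2},
      {y : ℝ | prodTheta q (N : ℝ) (U y ij.1.1 - U y ij.1.2) = 0}) ∪
      ⋃ ij : Fin N × Fin N, {y : ℝ | prodTheta q (N : ℝ)
        (U y ij.1 - (1 / 2 - (c + δ * (N - 1)) - δ * ((ij.2 : ℕ) : ℂ))) = 0}).Countable := by
    refine (Set.countable_iUnion fun ij => ?_).union (Set.countable_iUnion fun ij => ?_)
    · convert hc (u ij.1.1 - u ij.1.2) (((ij.1.1 : ℕ) : ℂ) - ((ij.1.2 : ℕ) : ℂ)) ?_ using 6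
      · simp only [U]; ring
      · rw [sub_ne_zero]
        exact fun h => ij.2 (Fin.ext (by exact_mod_cast h))
    · convert hc (u ij.1 - (1 / 2 - (c + δ * (N - 1)) - δ * ((ij.2 : ℕ) : ℂ)))
        ((ij.1 : ℕ) + 1 : ℂ) (Nat.cast_add_one_ne_zero _) using 6
      simp only [U]; ring
  have hcont : Continuous fun y => antisymSum (fun w => prodTheta q (N : ℝ) (w + δ)) W (U y) := by
    unfold antisymSum permTerm
    have hU : ∀ i, Continuous fun y => U y i := fun i => by simp only [U]; fun_prop
    refine continuous_finsetSum _ fun σ _ => continuous_const.mul (Continuous.mul ?_ ?_)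
    · exact continuous_finsetProd _ fun i _ => continuous_finsetProd _ fun j _ =>
        hT.comp (((hU _).sub (hU _)).add continuous_const)
    · exact continuous_finsetProd _ fun j _ => (hWc j).comp (hU _)
  have hzero := Continuous.ext_on (hcount.dense_compl ℝ) hcont continuous_const
    (g := fun _ => (0 : ℂ)) fun y hy => by
      simp only [Set.mem_compl_iff, Set.mem_union, Set.mem_iUnion, not_or, not_exists] at hy
      exact antisymSum_eq_zero_of_generic hq0 hq1 hN hδ hW N le_rfl (U y)
        (fun i hi => absurd i.isLt (by omega)) (fun i j hij => hy.1 ⟨(i, j), hij⟩)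
        (fun i j _ => hy.2 (i, j))
  simpa [U] using congrFun hzero 0

end

end ThetaScreening

namespace ThetaScreening

open Complex

theorem hasSum_of_eq {ι R : Type*} [AddCommMonoid R] [TopologicalSpace R] {f g : ι → R} {a b : R}
    (h : HasSum f a) (hfg : ∀ i, g i = f i) (hab : b = a) : HasSum g b := by
  rw [hab, funext hfg]; exact h

/-! ## Matrix entries of normal ordered exponentials -/

/-- The coefficient of `X ^ m` in `exp (c X) (α X + β) ^ n`. -/
def oscEntry (c α β : ℂ) : ℕ → ℕ → ℂ
  | m, 0 => c ^ m / m.factorial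
  | 0, n + 1 => β * oscEntry c α β 0 n
  | m + 1, n + 1 => α * oscEntry c α β m n + β * oscEntry c α β (m + 1) n

theorem oscEntry_zero_left (c α β : ℂ) (n : ℕ) : oscEntry c α β 0 n = β ^ n := by
  induction n with
  | zero => simp [oscEntry]
  | succ n ih => rw [oscEntry, ih, pow_succ']

theorem oscEntry_zero_right (c α β : ℂ) (m : ℕ) : oscEntry c α β m 0 = c ^ m / m.factorial := by
  cases m <;> simp [oscEntry]

theorem oscEntry_succ_right (c α β : ℂ) (m n : ℕ) : oscEntry c α β m (n + 1) =
    (if m = 0 then 0 else α * oscEntry c α β (m - 1) n) + β * oscEntry c α β m n := by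
  cases m <;> simp [oscEntry]

/-- This compares coefficients in the derivative of `exp(c X) (X + β)^n`. -/
theorem succ_mul_oscEntry (c β : ℂ) (m n : ℕ) : ((m : ℂ) + 1) * oscEntry c 1 β (m + 1) n =
    c * oscEntry c 1 β m n + n * oscEntry c 1 β m (n - 1) := by
  induction n generalizing m with
  | zero =>
    simp only [oscEntry_zero_right, Nat.factorial_succ, Nat.cast_zero, zero_mul, add_zero]
    push_cast
    have h1 : (m : ℂ) + 1 ≠ 0 := Nat.cast_add_one_ne_zero m
    field_simp
    ring
  | succ n ih =>
    have hn : ∀ m, (n : ℂ) * oscEntry c 1 β m n =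
        n * ((if m = 0 then 0 else oscEntry c 1 β (m - 1) (n - 1)) +
          β * oscEntry c 1 β m (n - 1)) := by
      intro m
      cases n with
      | zero => simp
      | succ n => rw [oscEntry_succ_right]; simp
    rw [oscEntry_succ_right, oscEntry_succ_right c 1 β m n, if_neg (Nat.succ_ne_zero m),
      mul_add, mul_left_comm _ β]
    simp only [Nat.add_sub_cancel]
    rw [ih]
    push_cast
    cases m with
    | zero =>
      have h := hn 0
      simp only [if_true, zero_add] at h
      simp only [Nat.cast_zero, if_true]
      linear_combination (-1 : ℂ) * h
    | succ m =>
      have h := hn (m + 1)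
      have h2 := ih m
      simp only [Nat.add_sub_cancel, if_neg (Nat.succ_ne_zero m)] at h ⊢
      push_cast at h h2 ⊢
      linear_combination (-1 : ℂ) * h + h2

theorem hasSum_shift {f : ℕ → ℂ} {s : ℂ} (h : HasSum f s) {g : ℕ → ℂ} (h0 : g 0 = 0)
    (hg : ∀ n, g (n + 1) = f n) : HasSum g s := by
  have := (hasSum_nat_add_iff (f := g) 1).mp (by simpa [hg] using h)
  simpa [h0] using this

/-- As generating functions in `X`: the sum over `g` of `exp(c X) (X + β)^g w^g / g!` is `exp(β w)
exp((c + w) X)`. -/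
theorem hasSum_oscEntry_zero (c β w : ℂ) (m : ℕ) :
    HasSum (fun g => oscEntry c 1 β m g * (w ^ g / g.factorial))
      (exp (β * w) * ((c + w) ^ m / m.factorial)) := by
  induction m with
  | zero =>
    have := NormedSpace.expSeries_div_hasSum_exp (𝔸 := ℂ) (β * w)
    rw [← Complex.exp_eq_exp_ℂ] at this
    refine hasSum_of_eq this (fun g => ?_) (by simp)
    rw [oscEntry_zero_left, mul_pow]; ring
  | succ m ih =>
    have h1 : HasSum (fun g : ℕ => (g : ℂ) * oscEntry c 1 β m (g - 1) * (w ^ g / g.factorial))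
        (w * (exp (β * w) * ((c + w) ^ m / m.factorial))) := by
      refine hasSum_shift (ih.mul_left w) (by simp) fun g => ?_
      have h2 : (g : ℂ) + 1 ≠ 0 := Nat.cast_add_one_ne_zero g
      have h3 : (g.factorial : ℂ) ≠ 0 := by exact_mod_cast g.factorial_ne_zero
      rw [Nat.factorial_succ, Nat.add_sub_cancel]
      push_cast
      field_simp
      ring
    have h2 := ((ih.mul_left c).add h1).div_const ((m : ℂ) + 1)
    have h3 : (m : ℂ) + 1 ≠ 0 := Nat.cast_add_one_ne_zero m
    have h4 : (m.factorial : ℂ) ≠ 0 := by exact_mod_cast m.factorial_ne_zero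
    refine hasSum_of_eq h2 (fun g => ?_) ?_
    · rw [eq_div_iff h3]
      linear_combination (w ^ g / g.factorial) * succ_mul_oscEntry c β m g
    · rw [Nat.factorial_succ]
      push_cast
      field_simp
      ring

/-- Composition for a single oscillator, with `g` quanta in the intermediate state weighted by
`y^g`. It amounts to substituting `y (X + β)` for the variable in `exp(c' X) (X + β')^n` and
multiplying by `exp(c X)`; the scalar `exp(β c' y)` is the contraction. -/
theorem hasSum_oscEntry_mul (c β c' β' y : ℂ) (m n : ℕ) :
    HasSum (fun g => oscEntry c 1 β m g * oscEntry c' 1 β' g n * y ^ g)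
      (exp (β * c' * y) * oscEntry (c + c' * y) y (y * β + β') m n) := by
  induction n generalizing m with
  | zero =>
    have := hasSum_oscEntry_zero c β (c' * y) m
    simp only [oscEntry_zero_right]
    refine hasSum_of_eq this (fun g => ?_) ?_
    · rw [mul_pow]; ring
    · rw [mul_assoc]
  | succ n ih =>
    have h1 : HasSum (fun g : ℕ => if g = 0 then 0 else
        oscEntry c 1 β m g * oscEntry c' 1 β' (g - 1) n * y ^ g)
        (y * ((if m = 0 then 0 else
            exp (β * c' * y) * oscEntry (c + c' * y) y (y * β + β') (m - 1) n) +
          β * (exp (β * c' * y) * oscEntry (c + c' * y) y (y * β + β') m n))) := by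
      have h2 : HasSum (fun g => if m = 0 then 0 else
          oscEntry c 1 β (m - 1) g * oscEntry c' 1 β' g n * y ^ g)
          (if m = 0 then 0 else
            exp (β * c' * y) * oscEntry (c + c' * y) y (y * β + β') (m - 1) n) := by
        split_ifs
        · exact hasSum_zero
        · exact ih (m - 1)
      refine hasSum_shift ((h2.add ((ih m).mul_left β)).mul_left y) (by simp) fun g => ?_
      rw [if_neg (Nat.succ_ne_zero g), Nat.add_sub_cancel, oscEntry_succ_right]
      split_ifs <;> ring
    have h3 := h1.add ((ih m).mul_left β')
    refine hasSum_of_eq h3 (fun g => ?_) ?_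
    · rw [oscEntry_succ_right]
      split_ifs <;> ring
    · rw [oscEntry_succ_right]
      split_ifs <;> ring

/-! ## Sums over the basis of products over the oscillators -/

theorem hasSum_pi_fin {R : Type*} [NormedCommRing R] [CompleteSpace R] {n : ℕ}
    {a : Fin n → ℕ → R} (ha : ∀ i, Summable fun m => ‖a i m‖) :
    (Summable fun g : Fin n → ℕ => ‖∏ i, a i (g i)‖) ∧
      HasSum (fun g : Fin n → ℕ => ∏ i, a i (g i)) (∏ i, ∑' m, a i m) := by
  induction n with
  | zero => exact ⟨(hasSum_unique _).summable, by simp⟩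
  | succ n ih =>
    obtain ⟨h1, h2⟩ := ih (fun i => ha i.succ)
    have e : (fun g : Fin (n + 1) → ℕ => ∏ i, a i (g i)) ∘ (Fin.consEquiv fun _ => ℕ) =
        fun x : ℕ × (Fin n → ℕ) => a 0 x.1 * ∏ i : Fin n, a i.succ (x.2 i) := by
      funext x
      simp [Fin.prod_univ_succ]
    constructor
    · rw [← (Fin.consEquiv fun _ => ℕ).summable_iff]
      have h3 : (fun g : Fin (n + 1) → ℕ => ‖∏ i, a i (g i)‖) ∘ (Fin.consEquiv fun _ => ℕ) =
          fun x : ℕ × (Fin n → ℕ) => ‖a 0 x.1 * ∏ i : Fin n, a i.succ (x.2 i)‖ :=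
        funext fun x => congrArg norm (congrFun e x)
      rw [h3]
      exact Summable.mul_norm (g := fun g : Fin n → ℕ => ∏ i : Fin n, a i.succ (g i)) (ha 0) h1
    · have h3 : Summable fun x : ℕ × (Fin n → ℕ) => a 0 x.1 * ∏ i : Fin n, a i.succ (x.2 i) :=
        summable_mul_of_summable_norm (g := fun g : Fin n → ℕ => ∏ i : Fin n, a i.succ (g i))
          (ha 0) h1
      rw [← (Fin.consEquiv fun _ => ℕ).hasSum_iff, e, Fin.prod_univ_succ]
      exact HasSum.mul (f := a 0) (g := fun g : Fin n → ℕ => ∏ i : Fin n, a i.succ (g i))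
        (ha 0).of_norm.hasSum h2 h3

/-- The finite case: exponents supported in `T` are tuples indexed by `T`, and the sum of products
is the product of sums. A general `R` allows the same statement for the series of norms, with `R =
ℝ`. -/
theorem hasSum_finsupp_of_support_subset {R ι : Type*} [NormedCommRing R] [CompleteSpace R]
    (T : Finset ι) {a : ι → ℕ → R} (ha : ∀ i, Summable fun m => ‖a i m‖) :
    HasSum (fun g : ι →₀ ℕ => Set.indicator {g : ι →₀ ℕ | g.support ⊆ T}
      (fun g => ∏ i ∈ T, a i (g i)) g) (∏ i ∈ T, ∑' m, a i m) := by
  classical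
  set φ := T.equivFin.symm with hφ
  have h := (hasSum_pi_fin (a := fun i => a (φ i)) fun i => ha _).2
  let ψ : (Fin T.card → ℕ) → (ι →₀ ℕ) := fun g => Finsupp.onFinset T
    (fun i => if h : i ∈ T then g (φ.symm ⟨i, h⟩) else 0) (fun i hi => by
      by_contra hT; simp [hT] at hi)
  have hψ : ∀ g i, ψ g (φ i) = g i := fun g i => by
    simp [ψ, Finsupp.onFinset_apply]
  have hinj : Function.Injective ψ := fun g g' hgg' => by
    funext i
    rw [← hψ g i, hgg', hψ]
  have hprod : ∀ b : ι → R, ∏ i ∈ T, b i = ∏ i : Fin T.card, b (φ i) := fun b => by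
    rw [← Finset.prod_coe_sort]
    exact (Equiv.prod_comp φ fun i : T => b i).symm
  rw [← hinj.hasSum_iff]
  · rw [hprod]
    refine hasSum_of_eq h (fun g => ?_) rfl
    rw [Function.comp_apply, Set.indicator_of_mem, hprod]
    · simp_rw [hψ]
    · exact Finsupp.support_onFinset_subset
  · intro g hg
    refine Set.indicator_of_notMem (fun hgT => hg ⟨fun i => g (φ i), ?_⟩) _
    ext i
    by_cases hi : i ∈ T
    · have := hψ (fun i => g (φ i)) (φ.symm ⟨i, hi⟩)
      simpa using this
    · have h1 : g i = 0 := Finsupp.notMem_support_iff.mp fun h => hi (hgT h)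
      simp [ψ, Finsupp.onFinset_apply, hi, h1]

end ThetaScreening

/-! ### Sums over the exponents of infinitely many oscillators, and factorised matrix entries -/

namespace ThetaScreening

open Complex

theorem prod_union_support_eq {ι R : Type*} [DecidableEq ι] [CommMonoid R] {a : ι → ℕ → R}
    {S T : Finset ι} (hS : ∀ i ∉ S, a i 0 = 1) (hST : S ⊆ T) {g : ι →₀ ℕ} (hg : g.support ⊆ T) :
    ∏ i ∈ S ∪ g.support, a i (g i) = ∏ i ∈ T, a i (g i) := by
  refine Finset.prod_subset (Finset.union_subset hST hg) fun i _ hi => ?_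
  rw [Finset.mem_union, not_or] at hi
  rw [Finsupp.notMem_support_iff.mp hi.2, hS i hi.1]

/-- A sum over all exponents of a product over infinitely many variables, where all but finitely
many factors are those of an exponential series. -/
theorem hasSum_finsupp_prod {ι : Type*} [DecidableEq ι] {a : ι → ℕ → ℂ} (S : Finset ι) {y : ι → ℂ}
    (hS : ∀ i ∉ S, ∀ n, a i n = y i ^ n / n.factorial)
    (ha : ∀ i ∈ S, Summable fun n => ‖a i n‖) (hy : Summable y) :
    HasSum (fun g : ι →₀ ℕ => ∏ i ∈ S ∪ g.support, a i (g i))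
      ((∏ i ∈ S, ∑' n, a i n) * exp (∑' i, if i ∈ S then 0 else y i)) := by
  have hexp : ∀ z : ℂ, HasSum (fun n : ℕ => z ^ n / n.factorial) (exp z) := fun z => by
    rw [Complex.exp_eq_exp_ℂ]; exact NormedSpace.expSeries_div_hasSum_exp z
  have hexpn : ∀ z : ℂ, HasSum (fun n : ℕ => ‖z ^ n / n.factorial‖) (Real.exp ‖z‖) := fun z => by
    rw [Real.exp_eq_exp_ℝ]
    refine hasSum_of_eq (NormedSpace.expSeries_div_hasSum_exp ‖z‖) (fun n => ?_) rfl
    simp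
  have h0 : ∀ i ∉ S, a i 0 = 1 := fun i hi => by simp [hS i hi]
  have hsum : ∀ i, Summable fun n => ‖a i n‖ := fun i => by
    by_cases hi : i ∈ S
    · exact ha i hi
    · simp_rw [hS i hi]; exact (hexpn _).summable
  have hcut : ∀ T : Finset ι, S ⊆ T → ∀ g : ι →₀ ℕ, g.support ⊆ T →
      ∏ i ∈ S ∪ g.support, a i (g i) = ∏ i ∈ T, a i (g i) :=
    fun T hST g hg => prod_union_support_eq h0 hST hg
  set y' : ι → ℂ := fun i => if i ∈ S then 0 else y i with hy'
  have hy's : Summable fun i => ‖y' i‖ := by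
    refine Summable.of_nonneg_of_le (fun _ => norm_nonneg _) (fun i => ?_) hy.norm
    by_cases hi : i ∈ S <;> simp [hy', hi]
  -- A finite set of exponents involves only a finite set `T` of variables; the product of the
  -- absolute sums over `T` is bounded uniformly in `T`, because `∑ |y_i|` converges.
  have hnorm : Summable fun g : ι →₀ ℕ => ‖∏ i ∈ S ∪ g.support, a i (g i)‖ := by
    refine summable_of_sum_le (c := (∏ i ∈ S, ∑' n, ‖a i n‖) * Real.exp (∑' i, ‖y' i‖))
      (fun _ => norm_nonneg _) fun G => ?_
    set T := S ∪ G.biUnion Finsupp.support with hT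
    have hST : S ⊆ T := Finset.subset_union_left
    have hG : ∀ g ∈ G, g.support ⊆ T := fun g hg =>
      (Finset.subset_biUnion_of_mem Finsupp.support hg).trans Finset.subset_union_right
    have h1 := hasSum_finsupp_of_support_subset T (a := fun i n => ‖a i n‖)
      (fun i => by simpa using hsum i)
    calc ∑ g ∈ G, ‖∏ i ∈ S ∪ g.support, a i (g i)‖
        = ∑ g ∈ G, Set.indicator {g : ι →₀ ℕ | g.support ⊆ T}
            (fun g => ∏ i ∈ T, ‖a i (g i)‖) g := by
          refine Finset.sum_congr rfl fun g hg => ?_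
          rw [Set.indicator_of_mem (hG g hg), hcut T hST g (hG g hg), norm_prod]
      _ ≤ ∏ i ∈ T, ∑' n, ‖a i n‖ := sum_le_hasSum _ (fun g _ =>
          Set.indicator_nonneg (fun g _ => Finset.prod_nonneg fun _ _ => norm_nonneg _) g) h1
      _ = (∏ i ∈ S, ∑' n, ‖a i n‖) * ∏ i ∈ T \ S, ∑' n, ‖a i n‖ := by
          rw [mul_comm, Finset.prod_sdiff hST]
      _ = (∏ i ∈ S, ∑' n, ‖a i n‖) * Real.exp (∑ i ∈ T \ S, ‖y' i‖) := by
          rw [Real.exp_sum]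
          congr 1
          refine Finset.prod_congr rfl fun i hi => ?_
          have hi' := (Finset.mem_sdiff.mp hi).2
          simp_rw [hS i hi', (hexpn _).tsum_eq]
          simp [hy', hi']
      _ ≤ _ := by
          have := hy's.sum_le_tsum (T \ S) (fun _ _ => norm_nonneg _)
          gcongr
  -- The value is found by exhausting the variables by finite sets `T`: the truncated sums are known
  -- in closed form and converge, dominated by the full absolute series.
  have hlim1 : Filter.Tendsto (fun T : Finset ι => ∑' g : ι →₀ ℕ,
      Set.indicator {g : ι →₀ ℕ | g.support ⊆ T} (fun g => ∏ i ∈ S ∪ g.support, a i (g i)) g)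
      Filter.atTop (nhds (∑' g : ι →₀ ℕ, ∏ i ∈ S ∪ g.support, a i (g i))) := by
    refine tendsto_tsum_of_dominated_convergence hnorm (fun g => ?_) (.of_forall fun T g => ?_)
    · refine tendsto_const_nhds.congr' ?_
      filter_upwards [Filter.eventually_ge_atTop g.support] with T hT
      rw [Set.indicator_of_mem]; exact hT
    · exact norm_indicator_le_norm_self _ _
  have hlim2 : Filter.Tendsto (fun T : Finset ι => (∏ i ∈ S, ∑' n, a i n) * exp (∑ i ∈ T, y' i))
      Filter.atTop (nhds ((∏ i ∈ S, ∑' n, a i n) * exp (∑' i, y' i))) :=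
    ((Complex.continuous_exp.tendsto _).comp
      (by simpa [HasSum] using hy's.of_norm.hasSum)).const_mul _
  have heq : ∀ᶠ T : Finset ι in Filter.atTop, (∏ i ∈ S, ∑' n, a i n) * exp (∑ i ∈ T, y' i) =
      ∑' g : ι →₀ ℕ, Set.indicator {g : ι →₀ ℕ | g.support ⊆ T}
        (fun g => ∏ i ∈ S ∪ g.support, a i (g i)) g := by
    filter_upwards [Filter.eventually_ge_atTop S] with T hST
    have h1 := hasSum_finsupp_of_support_subset T hsum
    have h2 : (fun g : ι →₀ ℕ => Set.indicator {g : ι →₀ ℕ | g.support ⊆ T}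
        (fun g => ∏ i ∈ S ∪ g.support, a i (g i)) g) =
        fun g => Set.indicator {g : ι →₀ ℕ | g.support ⊆ T} (fun g => ∏ i ∈ T, a i (g i)) g := by
      funext g
      by_cases hg : g.support ⊆ T
      · rw [Set.indicator_of_mem hg, Set.indicator_of_mem hg, hcut T hST g hg]
      · rw [Set.indicator_of_notMem hg, Set.indicator_of_notMem hg]
    rw [h2, h1.tsum_eq, ← Finset.prod_sdiff hST, mul_comm, exp_sum, ← Finset.prod_sdiff hST]
    congr 1
    rw [Finset.prod_eq_one (s := S) fun i hi => by simp [hy', hi], mul_one]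
    refine Finset.prod_congr rfl fun i hi => ?_
    have hi' := (Finset.mem_sdiff.mp hi).2
    simp_rw [hS i hi', (hexp _).tsum_eq]
    simp [hy', hi']
  have := tendsto_nhds_unique (hlim2.congr' heq) hlim1
  rw [this]
  exact hnorm.of_norm.hasSum

/-! ## The matrix entries as products over the oscillators -/

theorem coeff_X_mul (i : Osc) (φ : MvPowerSeries Osc ℂ) (e : Basis) :
    MvPowerSeries.coeff e (MvPowerSeries.X i * φ) =
      if e i = 0 then 0 else MvPowerSeries.coeff (e - Finsupp.single i 1) φ := by
  rw [MvPowerSeries.X, MvPowerSeries.coeff_monomial_mul, one_mul]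
  have : Finsupp.single i 1 ≤ e ↔ e i ≠ 0 := by
    rw [Finsupp.single_le_iff, Nat.one_le_iff_ne_zero]
  by_cases h : e i = 0
  · rw [if_neg (by simp [h]), if_pos h]
  · rw [if_pos (this.mpr h), if_neg h]

/-- Creation and annihilation parts are products over the oscillators, hence so is each matrix
entry. Adding one quantum to `f` multiplies by the shifted variable `X_i + β_i`, which is the
recursion defining `oscEntry`. -/
theorem coeff_expCreation_mul (q : ℂ) (k r : ℕ) (c b : Osc → ℂ) (e f : Basis) (S : Finset Osc)
    (he : e.support ⊆ S) (hf : f.support ⊆ S) :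
    MvPowerSeries.coeff e (expCreation c *
      ((expAnnihilation q k r b (MvPolynomial.monomial f 1) : MvPolynomial Osc ℂ) :
        MvPowerSeries Osc ℂ)) =
      ∏ i ∈ S, oscEntry (c i) 1 (b i * oscComm q k r i.1 ((i.2 : ℂ) + 1)) (e i) (f i) := by
  have step : ∀ (i : Osc) (f : Basis), (∀ (e : Basis) (S : Finset Osc), e.support ⊆ S →
      f.support ⊆ S → MvPowerSeries.coeff e (expCreation c *
      ((expAnnihilation q k r b (MvPolynomial.monomial f 1) : MvPolynomial Osc ℂ) :
        MvPowerSeries Osc ℂ)) =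
      ∏ i ∈ S, oscEntry (c i) 1 (b i * oscComm q k r i.1 ((i.2 : ℂ) + 1)) (e i) (f i)) →
      ∀ (e : Basis) (S : Finset Osc), e.support ⊆ S →
      (Finsupp.single i 1 + f).support ⊆ S → MvPowerSeries.coeff e (expCreation c *
      ((expAnnihilation q k r b (MvPolynomial.monomial (Finsupp.single i 1 + f) 1) :
        MvPolynomial Osc ℂ) : MvPowerSeries Osc ℂ)) =
      ∏ j ∈ S, oscEntry (c j) 1 (b j * oscComm q k r j.1 ((j.2 : ℂ) + 1)) (e j)
        ((Finsupp.single i 1 + f : Basis) j) := by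
    intro i f ih e S he hf
    have hiS : i ∈ S := hf (by simp)
    have hfS : f.support ⊆ S := fun j hj => hf (by
      simp only [Finsupp.mem_support_iff, Finsupp.add_apply] at hj ⊢; omega)
    have e1 : MvPolynomial.monomial (Finsupp.single i 1 + f) (1 : ℂ) =
        MvPolynomial.X i * MvPolynomial.monomial f 1 := by
      rw [MvPolynomial.X, MvPolynomial.monomial_mul, one_mul]
    have e2 : expAnnihilation q k r b (MvPolynomial.X i) = MvPolynomial.X i +
        MvPolynomial.C (b i * oscComm q k r i.1 ((i.2 : ℂ) + 1)) := by
      simp [expAnnihilation]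
    rw [e1, map_mul (expAnnihilation q k r b), e2, MvPolynomial.coe_mul, MvPolynomial.coe_add, MvPolynomial.coe_X,
      MvPolynomial.coe_C, mul_left_comm, add_mul, map_add, coeff_X_mul, MvPowerSeries.coeff_C_mul,
      ih e S he hfS, ← Finset.mul_prod_erase S _ hiS, ← Finset.mul_prod_erase S _ hiS]
    have e3 : ∏ j ∈ S.erase i, oscEntry (c j) 1 (b j * oscComm q k r j.1 ((j.2 : ℂ) + 1)) (e j)
        ((Finsupp.single i 1 + f : Basis) j) =
        ∏ j ∈ S.erase i, oscEntry (c j) 1 (b j * oscComm q k r j.1 ((j.2 : ℂ) + 1)) (e j) (f j) := by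
      refine Finset.prod_congr rfl fun j hj => ?_
      rw [Finsupp.add_apply, Finsupp.single_eq_of_ne (Finset.ne_of_mem_erase hj), zero_add]
    rw [e3, Finsupp.add_apply, Finsupp.single_eq_same, add_comm 1, oscEntry_succ_right]
    split_ifs with h
    · ring
    · rw [ih (e - Finsupp.single i 1) S ((Finsupp.support_tsub).trans he) hfS,
        ← Finset.mul_prod_erase S _ hiS]
      have e4 : ∏ j ∈ S.erase i, oscEntry (c j) 1 (b j * oscComm q k r j.1 ((j.2 : ℂ) + 1))
          ((e - Finsupp.single i 1 : Basis) j) (f j) = ∏ j ∈ S.erase i, oscEntry (c j) 1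
            (b j * oscComm q k r j.1 ((j.2 : ℂ) + 1)) (e j) (f j) := by
        refine Finset.prod_congr rfl fun j hj => ?_
        rw [Finsupp.tsub_apply, Finsupp.single_eq_of_ne (Finset.ne_of_mem_erase hj), tsub_zero]
      rw [e4, Finsupp.tsub_apply, Finsupp.single_eq_same]
      ring
  induction f using Finsupp.induction generalizing e S with
  | zero =>
    have h1 : expAnnihilation q k r b (MvPolynomial.monomial 0 1) = 1 := by
      rw [show MvPolynomial.monomial (0 : Basis) (1 : ℂ) = 1 from rfl, map_one]
    rw [h1, MvPolynomial.coe_one, mul_one]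
    change e.prod (fun i n => c i ^ n / (n.factorial : ℂ)) = _
    rw [Finsupp.prod_of_support_subset e he _ (by simp)]
    exact Finset.prod_congr rfl fun i _ => by rw [Finsupp.zero_apply, oscEntry_zero_right]
  | single_add i n f _ _ ih =>
    clear * - ih step he hf
    have : ∀ (n : ℕ) (e : Basis) (S : Finset Osc), e.support ⊆ S →
        (Finsupp.single i n + f).support ⊆ S → MvPowerSeries.coeff e (expCreation c *
        ((expAnnihilation q k r b (MvPolynomial.monomial (Finsupp.single i n + f) 1) :
          MvPolynomial Osc ℂ) : MvPowerSeries Osc ℂ)) =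
        ∏ j ∈ S, oscEntry (c j) 1 (b j * oscComm q k r j.1 ((j.2 : ℂ) + 1)) (e j)
          ((Finsupp.single i n + f : Basis) j) := by
      intro n
      induction n with
      | zero =>
        rw [Finsupp.single_zero, zero_add]
        exact ih
      | succ n ihn =>
        rw [add_comm n 1, Finsupp.single_add, add_assoc]
        exact step i _ ihn
    exact this n e S he hf

/-- The coefficients of the creation operators in a boson field. -/
def creation (X : BosonField) (i : Osc) : ℂ := (X i.1).2.2 (-((i.2 : ℤ) + 1))

/-- The shifts of the creation operators by the annihilation part of a boson field. -/
def annihilation (q : ℂ) (k r : ℕ) (X : BosonField) (i : Osc) : ℂ :=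
  (X i.1).2.2 ((i.2 : ℤ) + 1) * oscComm q k r i.1 ((i.2 : ℂ) + 1)

theorem normalExp_entry (q : ℂ) (k r : ℕ) (X : BosonField) (p : Momentum) (e f : Basis)
    (S : Finset Osc) (he : e.support ⊆ S) (hf : f.support ⊆ S) :
    (normalExp q k r X).entry p e f = exp (∑ j, (X j).2.1 * p j) *
      ∏ i ∈ S, oscEntry (creation X i) 1 (annihilation q k r X i) (e i) (f i) := by
  simp only [normalExp]
  rw [coeff_expCreation_mul q k r _ _ e f S he hf]
  rfl

end ThetaScreening

namespace ThetaScreening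

open Complex

/-! ## Analytic continuation of a power series to a larger disc -/

/-- A power series with a known sum near `0` coincides with the Taylor series of any holomorphic
extension, hence converges throughout the larger disc. With `C d` the contribution of degree `d`,
evaluation at `1` gives the composite, and Cauchy's estimates give geometric decay. -/
theorem hasSum_one_of_differentiableOn {C : ℕ → ℂ} {h : ℂ → ℂ} {R ρ : ℝ} (hR : 1 < R)
    (hh : DifferentiableOn ℂ h (Metric.ball 0 R)) (hρ : 0 < ρ)
    (hC : ∀ x, ‖x‖ < ρ → HasSum (fun d => C d * x ^ d) (h x)) :
    HasSum C (h 1) ∧ ∀ R' B : ℝ, 0 < R' → R' < R → (∀ x, ‖x‖ = R' → ‖h x‖ ≤ B) →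
      ∀ d, ‖C d‖ ≤ B / R' ^ d := by
  have h1 : HasFPowerSeriesAt h (FormalMultilinearSeries.ofScalars ℂ C) 0 := by
    rw [hasFPowerSeriesAt_iff]
    filter_upwards [Metric.ball_mem_nhds (0 : ℂ) hρ] with x hx
    rw [zero_add]
    refine hasSum_of_eq (hC x (by simpa using hx)) (fun n => ?_) rfl
    rw [FormalMultilinearSeries.coeff_ofScalars, smul_eq_mul, mul_comm]
  have htaylor : ∀ x ∈ Metric.ball (0 : ℂ) R,
      HasSum (fun n : ℕ => ((n.factorial : ℂ)⁻¹ * iteratedDeriv n h 0) * x ^ n) (h x) := by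
    intro x hx
    refine hasSum_of_eq (Complex.hasSum_taylorSeries_on_ball hh hx) (fun n => ?_) rfl
    simp only [sub_zero, smul_eq_mul]
    ring
  have h2 : HasFPowerSeriesAt h (FormalMultilinearSeries.ofScalars ℂ
      fun n : ℕ => (n.factorial : ℂ)⁻¹ * iteratedDeriv n h 0) 0 := by
    rw [hasFPowerSeriesAt_iff]
    filter_upwards [Metric.ball_mem_nhds (0 : ℂ) (by linarith : 0 < R)] with x hx
    rw [zero_add]
    refine hasSum_of_eq (htaylor x hx) (fun n => ?_) rfl
    rw [FormalMultilinearSeries.coeff_ofScalars, smul_eq_mul, mul_comm]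
  have hCd : ∀ n, C n = (n.factorial : ℂ)⁻¹ * iteratedDeriv n h 0 := fun n => by
    have := congrArg (fun p => FormalMultilinearSeries.coeff p n)
      (h1.eq_formalMultilinearSeries h2)
    simpa using this
  refine ⟨?_, fun R' B hR'0 hR' hB d => ?_⟩
  · have := htaylor 1 (by simpa using hR)
    simpa [← hCd] using this
  · have hd : DiffContOnCl ℂ h (Metric.ball 0 R') := by
      refine DifferentiableOn.diffContOnCl ?_
      rw [closure_ball _ hR'0.ne']
      exact hh.mono (Metric.closedBall_subset_ball hR')
    have := Complex.norm_iteratedDeriv_le_of_forall_mem_sphere_norm_le d hR'0 hd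
      (fun z hz => hB z (by simpa using hz))
    have hf : (0 : ℝ) < d.factorial := by exact_mod_cast d.factorial_pos
    rw [hCd, norm_mul, norm_inv, Complex.norm_natCast, inv_mul_le_iff₀ hf]
    calc _ ≤ _ := this
      _ = _ := by ring

/-! ## Composition of normal ordered exponentials -/

theorem mem_level {g : Basis} {d : ℕ} : g ∈ level d ↔ degree g = d := by
  simp [level]

theorem hasSum_level {F : Basis → ℂ} {s : ℂ} (h : HasSum F s) :
    HasSum (fun d => ∑ g ∈ level d, F g) s := by
  refine hasSum_of_eq (h.tsum_fiberwise degree) (fun d => ?_) rfl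
  have : degree ⁻¹' {d} = (level d : Set Basis) := by ext g; simp [mem_level]
  rw [this, Finset.tsum_subtype']

/-- The finite part of the generating function of the composites. -/
def pairPoly (q : ℂ) (k r : ℕ) (X Y : BosonField) (e f : Basis) (x : ℂ) : ℂ :=
  ∏ i ∈ e.support ∪ f.support,
    oscEntry (creation X i + creation Y i * x ^ (i.2 + 1)) (x ^ (i.2 + 1))
      (x ^ (i.2 + 1) * annihilation q k r X i + annihilation q k r Y i) (e i) (f i)

theorem pow_degree_eq (g : Basis) (T : Finset Osc) (hT : g.support ⊆ T) (x : ℂ) :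
    x ^ degree g = ∏ i ∈ T, (x ^ (i.2 + 1)) ^ g i := by
  rw [degree, Finsupp.sum_of_support_subset g hT _ (by simp), ← Finset.prod_pow_eq_pow_sum]
  exact Finset.prod_congr rfl fun i _ => by rw [← pow_mul, mul_comm]

/-- The sum over intermediate states factorises over oscillators, since `x^{deg g}` is
multiplicative. Oscillators absent from `e` and `f` contribute pure exponential series; all
exponentials combine to `exp L`, and only the finitely many oscillators of `e` and `f` leave a
polynomial. -/
theorem hasSum_osc_comp (q : ℂ) (k r : ℕ) (X Y : BosonField) (e f : Basis) {x L : ℂ}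
    (hL : HasSum (fun i : Osc => annihilation q k r X i * creation Y i * x ^ (i.2 + 1)) L) :
    HasSum (fun g : Basis =>
      (∏ i ∈ (e.support ∪ f.support) ∪ g.support,
        oscEntry (creation X i) 1 (annihilation q k r X i) (e i) (g i)) *
      (∏ i ∈ (e.support ∪ f.support) ∪ g.support,
        oscEntry (creation Y i) 1 (annihilation q k r Y i) (g i) (f i)) * x ^ degree g)
      (exp L * pairPoly q k r X Y e f x) := by
  set S := e.support ∪ f.support with hS
  set a : Osc → ℕ → ℂ := fun i n => oscEntry (creation X i) 1 (annihilation q k r X i) (e i) n *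
    oscEntry (creation Y i) 1 (annihilation q k r Y i) n (f i) * (x ^ (i.2 + 1)) ^ n with ha
  have hsum : ∀ i, HasSum (a i) (exp (annihilation q k r X i * creation Y i * x ^ (i.2 + 1)) *
      oscEntry (creation X i + creation Y i * x ^ (i.2 + 1)) (x ^ (i.2 + 1))
      (x ^ (i.2 + 1) * annihilation q k r X i + annihilation q k r Y i) (e i) (f i)) :=
    fun i => hasSum_oscEntry_mul _ _ _ _ _ _ _
  have hout : ∀ i ∉ S, ∀ n, a i n =
      (annihilation q k r X i * creation Y i * x ^ (i.2 + 1)) ^ n / n.factorial := by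
    intro i hi n
    rw [hS, Finset.mem_union, not_or] at hi
    simp only [ha, Finsupp.notMem_support_iff.mp hi.1, Finsupp.notMem_support_iff.mp hi.2,
      oscEntry_zero_left, oscEntry_zero_right]
    ring
  have key := hasSum_finsupp_prod S hout (fun i _ => (hsum i).summable.norm) hL.summable
  refine hasSum_of_eq key (fun g => ?_) ?_
  · rw [pow_degree_eq g (S ∪ g.support) Finset.subset_union_right, ← Finset.prod_mul_distrib,
      ← Finset.prod_mul_distrib]
  · rw [Finset.prod_congr rfl fun i _ => (hsum i).tsum_eq, Finset.prod_mul_distrib, ← exp_sum,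
      mul_right_comm, ← exp_add, pairPoly]
    congr 2
    rw [← hL.tsum_eq, ← Summable.sum_add_tsum_compl (s := S) hL.summable,
      tsum_subtype ((S : Set Osc)ᶜ)
        (fun i : Osc => annihilation q k r X i * creation Y i * x ^ (i.2 + 1))]
    congr 1
    refine tsum_congr fun i => ?_
    by_cases hi : i ∈ S <;> simp [hi]

/-- The generating function of the terms of the composite of two normal ordered exponentials. -/
def compGen (q : ℂ) (k r : ℕ) (X Y : BosonField) (p : Momentum) (e f : Basis) (κ : ℂ → ℂ)
    (x : ℂ) : ℂ :=
  exp (∑ j, (X j).2.1 * (zeroComm k j * (Y j).1)) * κ x *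
    (exp (∑ j, ((X + Y) j).2.1 * p j) * pairPoly q k r X Y e f x)

theorem creation_add (X Y : BosonField) (i : Osc) :
    creation (X + Y) i = creation X i + creation Y i := rfl

theorem annihilation_add (q : ℂ) (k r : ℕ) (X Y : BosonField) (i : Osc) :
    annihilation q k r (X + Y) i = annihilation q k r X i + annihilation q k r Y i :=
  add_mul _ _ _

theorem pairPoly_one (q : ℂ) (k r : ℕ) (X Y : BosonField) (p : Momentum) (e f : Basis) :
    exp (∑ j, ((X + Y) j).2.1 * p j) * pairPoly q k r X Y e f 1 =
      (normalExp q k r (X + Y)).entry p e f := by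
  rw [normalExp_entry q k r _ p e f (e.support ∪ f.support) Finset.subset_union_left
    Finset.subset_union_right, pairPoly]
  simp only [one_pow, mul_one, one_mul, creation_add, annihilation_add]

theorem differentiable_oscEntry {c α β : ℂ → ℂ} (hc : Differentiable ℂ c) (hα : Differentiable ℂ α)
    (hβ : Differentiable ℂ β) (m n : ℕ) :
    Differentiable ℂ fun x => oscEntry (c x) (α x) (β x) m n := by
  induction n generalizing m with
  | zero => simp only [oscEntry_zero_right]; fun_prop
  | succ n ih =>
    simp only [oscEntry_succ_right]
    by_cases hm : m = 0
    · simp only [hm, if_true, zero_add]; exact hβ.mul (ih 0)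
    · simp only [hm, if_false]; exact (hα.mul (ih _)).add (hβ.mul (ih _))

/-- Wick's theorem for two exponentials, outside the disc where the contraction series is known to
converge: it is enough that the exponentiated contraction `κ` extends holomorphically past the unit
disc. -/
theorem compTerm_normalExp (q : ℂ) (k r : ℕ) (X Y : BosonField) (p : Momentum) (e f : Basis)
    {κ : ℂ → ℂ} {R ρ : ℝ} (hR : 1 < R) (hκ : DifferentiableOn ℂ κ (Metric.ball 0 R)) (hρ : 0 < ρ)
    (hsmall : ∀ x : ℂ, ‖x‖ < ρ → ∃ L, HasSum (fun i : Osc =>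
      annihilation q k r X i * creation Y i * x ^ (i.2 + 1)) L ∧ exp L = κ x) :
    HasSum (Op.compTerm (normalExp q k r X) (normalExp q k r Y) p e f)
      (exp (∑ j, (X j).2.1 * (zeroComm k j * (Y j).1)) * κ 1 *
        (normalExp q k r (X + Y)).entry p e f) ∧
    ∀ R' B : ℝ, 0 < R' → R' < R → (∀ x, ‖x‖ = R' → ‖compGen q k r X Y p e f κ x‖ ≤ B) →
      ∀ d, ‖Op.compTerm (normalExp q k r X) (normalExp q k r Y) p e f d‖ ≤ B / R' ^ d := by
  have hdiff : DifferentiableOn ℂ (compGen q k r X Y p e f κ) (Metric.ball 0 R) := by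
    have : Differentiable ℂ (pairPoly q k r X Y e f) := by
      unfold pairPoly
      exact Differentiable.fun_finsetProd fun i _ =>
        differentiable_oscEntry (by fun_prop) (by fun_prop) (by fun_prop) _ _
    unfold compGen
    exact (hκ.const_mul _).mul (this.differentiableOn.const_mul _)
  have h := hasSum_one_of_differentiableOn (C := Op.compTerm (normalExp q k r X)
    (normalExp q k r Y) p e f) hR hdiff hρ fun x hx => by
      obtain ⟨L, hL, hLk⟩ := hsmall x hx
      have h1 := hasSum_level ((hasSum_osc_comp q k r X Y e f hL).mul_left
        (exp (∑ j, (X j).2.1 * (zeroComm k j * (Y j).1)) *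
          exp (∑ j, ((X + Y) j).2.1 * p j)))
      refine hasSum_of_eq h1 (fun d => ?_) ?_
      · rw [Op.compTerm, Finset.sum_mul]
        refine Finset.sum_congr rfl fun g hg => ?_
        rw [normalExp_entry q k r X _ e g ((e.support ∪ f.support) ∪ g.support)
          (Finset.subset_union_left.trans Finset.subset_union_left) Finset.subset_union_right,
          normalExp_entry q k r Y p g f ((e.support ∪ f.support) ∪ g.support)
          Finset.subset_union_right (Finset.subset_union_right.trans Finset.subset_union_left),
          mem_level.mp hg]
        -- The left factor sees the momentum already shifted by the right one; the surplus is the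
        -- zero mode contraction.
        have e1 : exp (∑ j, (X j).2.1 * (p + (normalExp q k r Y).shift) j) *
            exp (∑ j, (Y j).2.1 * p j) =
            exp (∑ j, (X j).2.1 * (zeroComm k j * (Y j).1)) *
              exp (∑ j, ((X + Y) j).2.1 * p j) := by
          rw [← exp_add, ← exp_add, ← Finset.sum_add_distrib, ← Finset.sum_add_distrib]
          congr 1
          refine Finset.sum_congr rfl fun j _ => ?_
          simp only [Pi.add_apply, Prod.snd_add, Prod.fst_add, normalExp]
          ring
        rw [← e1]
        ring
      · rw [compGen, hLk]; ring
  refine ⟨?_, h.2⟩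
  have h1 := h.1
  rwa [compGen, pairPoly_one] at h1

end ThetaScreening

namespace ThetaScreening

open Complex

/-! ## Currents that are sums of normal ordered exponentials -/

/-- The data of a current `A(u) = ∑ ε, coef ε :exp X_ε(u):` whose summands have the same charge. -/
structure CurrentData (ι : Type) where
  /-- The coefficients of the exponentials. -/
  coef : ι → ℂ
  /-- The coefficients of the `Q_j`. -/
  charge : Fin 3 → ℂ
  /-- The constant terms of the coefficients of the `P_j`. -/
  momConst : ι → Fin 3 → ℂ
  /-- The slopes of the coefficients of the `P_j`. -/
  momSlope : Fin 3 → ℂ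
  /-- The coefficients of the `a_{j,m}`. -/
  osc : ι → Fin 3 → ℤ → ℂ
  /-- The constant factors in the contractions of the zero modes. -/
  zero : ι → ℂ
  /-- The exponent in the contractions of the zero modes. -/
  lam : ℂ
  /-- The common factor of the contractions. -/
  fac : ℂ → ℂ

namespace CurrentData

variable {ι : Type} (D : CurrentData ι) (q : ℂ) (k r : ℕ)

/-- The boson field `X_ε(u)`. -/
def field (ε : ι) (u : ℂ) : BosonField := fun j =>
  (D.charge j, D.momConst ε j + D.momSlope j * u, fun n => D.osc ε j n * qpow q (-(2 * u * n)))

/-- The field in the normal ordered product of several currents. -/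
def fieldSum {N : ℕ} (ε : Fin N → ι) (u : Fin N → ℂ) : BosonField :=
  ∑ i, D.field q (ε i) (u i)

/-- The momentum carried by the current. -/
def shift : Momentum := fun j => zeroComm k j * D.charge j

/-- The continued contraction of two exponentials. -/
def pairFactor (ε ε' : ι) (u v : ℂ) : ℂ :=
  (D.zero ε - D.zero ε' * qpow q (2 * (v - u))) * exp (D.lam * u) * D.fac (qpow q (2 * (v - u)))

/-- The coefficient of the normal ordered product of exponentials. -/
def tupleCoef {N : ℕ} (ε : Fin N → ι) (u : Fin N → ℂ) : ℂ :=
  (∏ i, D.coef (ε i)) * ∏ i, ∏ j ∈ Finset.Ioi i, D.pairFactor q (ε i) (ε j) (u i) (u j)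

/-- The continued matrix entry of a product of currents. -/
def productEntry [Fintype ι] (N : ℕ) (p : Momentum) (e f : Basis) (u : Fin N → ℂ) : ℂ :=
  ∑ ε : Fin N → ι, D.tupleCoef q ε u * (normalExp q k r (D.fieldSum q ε u)).entry p e f

/-- The oscillator contraction of `X_ε(u)` and `X_ε'(v)` at a point `y = x q ^ (2 (v - u))`,
divided by the common factor. -/
def contraction (ε ε' : ι) (y : ℂ) : ℂ := (1 - D.zero ε' / D.zero ε * y) * D.fac y

/-- The current `A` is given by the data `D`; the contractions are holomorphic for `|y| < R₀`. -/
structure Represents [Fintype ι] (A : ℂ → Op) (R₀ : ℝ) : Prop where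
  shift_eq : ∀ u, (A u).shift = D.shift k
  entry_eq : ∀ u p e f, (A u).entry p e f =
    ∑ ε, D.coef ε * (normalExp q k r (D.field q ε u)).entry p e f
  zero_ne : ∀ ε, D.zero ε ≠ 0
  zero_eq : ∀ ε u, exp (∑ j, (D.momConst ε j + D.momSlope j * u) * D.shift k j) =
    D.zero ε * exp (D.lam * u)
  fac_diff : DifferentiableOn ℂ D.fac (Metric.ball 0 R₀)
  small : ∃ ρ : ℝ, 0 < ρ ∧ ∀ ε ε' (y : ℂ), ‖y‖ < ρ → ∃ L, HasSum (fun i : Osc =>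
    D.osc ε i.1 ((i.2 : ℤ) + 1) * oscComm q k r i.1 ((i.2 : ℂ) + 1) *
      D.osc ε' i.1 (-((i.2 : ℤ) + 1)) * y ^ (i.2 + 1)) L ∧ exp L = D.contraction ε ε' y

/-! ### Composition of two families -/

theorem prod_Ioi_append {a b : ℕ} {M : Type*} [CommMonoid M] (F : Fin (a + b) → Fin (a + b) → M) :
    ∏ i, ∏ j ∈ Finset.Ioi i, F i j =
      (∏ i, ∏ j ∈ Finset.Ioi i, F (Fin.castAdd b i) (Fin.castAdd b j)) *
      (∏ i, ∏ j ∈ Finset.Ioi i, F (Fin.natAdd a i) (Fin.natAdd a j)) *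
      ∏ i, ∏ j, F (Fin.castAdd b i) (Fin.natAdd a j) := by
  have e : ∀ {N : ℕ} (H : Fin N → Fin N → M), ∏ i, ∏ j ∈ Finset.Ioi i, H i j =
      ∏ i, ∏ j, if i < j then H i j else 1 := fun H => by
    refine Finset.prod_congr rfl fun i _ => ?_
    rw [← Finset.filter_lt_eq_Ioi, Finset.prod_filter]
  simp only [e]
  rw [Fin.prod_univ_add]
  simp only [Fin.prod_univ_add]
  have h1 : ∀ (i : Fin a) (j : Fin b), Fin.castAdd b i < Fin.natAdd a j := fun i j => by
    rw [Fin.lt_def, Fin.val_castAdd, Fin.val_natAdd]; omega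
  have h2 : ∀ (i : Fin b) (j : Fin a), ¬ Fin.natAdd a i < Fin.castAdd b j := fun i j =>
    (h1 j i).not_gt
  have h3 : ∀ i j : Fin a, Fin.castAdd b i < Fin.castAdd b j ↔ i < j := fun i j => by
    rw [Fin.lt_def, Fin.lt_def, Fin.val_castAdd, Fin.val_castAdd]
  have h4 : ∀ i j : Fin b, Fin.natAdd a i < Fin.natAdd a j ↔ i < j := fun i j => by
    rw [Fin.lt_def, Fin.lt_def, Fin.val_natAdd, Fin.val_natAdd]; omega
  simp only [h1, h2, h3, h4, if_true, if_false, Finset.prod_mul_distrib, Finset.prod_const_one,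
    one_mul]
  exact mul_right_comm _ _ _

theorem tupleCoef_append {a b : ℕ} (ε : Fin a → ι) (ε' : Fin b → ι) (u : Fin a → ℂ)
    (v : Fin b → ℂ) : D.tupleCoef q (Fin.append ε ε') (Fin.append u v) =
      D.tupleCoef q ε u * D.tupleCoef q ε' v *
        ∏ i, ∏ j, D.pairFactor q (ε i) (ε' j) (u i) (v j) := by
  unfold tupleCoef
  rw [prod_Ioi_append, Fin.prod_univ_add]
  simp only [Fin.append_left, Fin.append_right]
  ring

theorem fieldSum_append {a b : ℕ} (ε : Fin a → ι) (ε' : Fin b → ι) (u : Fin a → ℂ)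
    (v : Fin b → ℂ) : D.fieldSum q (Fin.append ε ε') (Fin.append u v) =
      D.fieldSum q ε u + D.fieldSum q ε' v := by
  unfold fieldSum
  rw [Fin.sum_univ_add]
  simp only [Fin.append_left, Fin.append_right]

theorem fieldSum_charge {N : ℕ} (ε : Fin N → ι) (u : Fin N → ℂ) (j : Fin 3) :
    (D.fieldSum q ε u j).1 = N * D.charge j := by
  simp [fieldSum, Finset.sum_apply, Prod.fst_sum, field]

theorem fieldSum_mom {N : ℕ} (ε : Fin N → ι) (u : Fin N → ℂ) (j : Fin 3) :
    (D.fieldSum q ε u j).2.1 = ∑ i, (D.momConst (ε i) j + D.momSlope j * u i) := by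
  simp [fieldSum, Finset.sum_apply, Prod.fst_sum, Prod.snd_sum, field]

theorem creation_fieldSum {N : ℕ} (ε : Fin N → ι) (u : Fin N → ℂ) (i : Osc) :
    creation (D.fieldSum q ε u) i =
      ∑ a, D.osc (ε a) i.1 (-((i.2 : ℤ) + 1)) * qpow q (2 * u a) ^ (i.2 + 1) := by
  simp only [creation, fieldSum, Finset.sum_apply, Prod.snd_sum, field]
  refine Finset.sum_congr rfl fun a _ => ?_
  rw [← qpow_mul_nat]
  push_cast
  ring_nf

theorem annihilation_fieldSum {N : ℕ} (ε : Fin N → ι) (u : Fin N → ℂ) (i : Osc) :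
    annihilation q k r (D.fieldSum q ε u) i =
      ∑ a, D.osc (ε a) i.1 ((i.2 : ℤ) + 1) * qpow q (-(2 * u a)) ^ (i.2 + 1) *
        oscComm q k r i.1 ((i.2 : ℂ) + 1) := by
  simp only [annihilation, fieldSum, Finset.sum_apply, Prod.snd_sum, field]
  rw [Finset.sum_mul]
  refine Finset.sum_congr rfl fun a _ => ?_
  rw [← qpow_mul_nat]
  push_cast
  ring_nf

theorem shift_normalExp_fieldSum {N : ℕ} (ε : Fin N → ι) (u : Fin N → ℂ) :
    (normalExp q k r (D.fieldSum q ε u)).shift = N • D.shift k := by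
  funext j
  simp only [normalExp, fieldSum_charge, shift, Pi.smul_apply, nsmul_eq_mul]
  ring

/-- The product of the continued contractions between two families of exponentials. -/
def crossContraction {a b : ℕ} (ε : Fin a → ι) (ε' : Fin b → ι) (u : Fin a → ℂ) (v : Fin b → ℂ)
    (x : ℂ) : ℂ :=
  ∏ i, ∏ j, D.contraction (ε i) (ε' j) (qpow q (2 * (v j - u i)) * x)

variable {D q k r}

section

variable [Fintype ι] {A : ℂ → Op} {R₀ : ℝ} (h : D.Represents q k r A R₀)
include h

/-- The oscillator contraction is normalised to be `1 - (z'/z) y` times the common factor; the zero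
modes restore the leading constant `z` and the exponential in `u`. -/
theorem Represents.zeroMode {a b : ℕ} (ε : Fin a → ι) (ε' : Fin b → ι) (u : Fin a → ℂ)
    (v : Fin b → ℂ) :
    exp (∑ j, (D.fieldSum q ε u j).2.1 * (zeroComm k j * (D.fieldSum q ε' v j).1)) *
      D.crossContraction q ε ε' u v 1 = ∏ i, ∏ j, D.pairFactor q (ε i) (ε' j) (u i) (v j) := by
  have e1 : ∑ j, (D.fieldSum q ε u j).2.1 * (zeroComm k j * (D.fieldSum q ε' v j).1) =
      ∑ i, ∑ _m : Fin b, ∑ j, (D.momConst (ε i) j + D.momSlope j * u i) * D.shift k j := by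
    simp only [fieldSum_mom, fieldSum_charge, shift, Finset.sum_const, Finset.card_univ,
      Fintype.card_fin, nsmul_eq_mul, Finset.sum_mul, Finset.mul_sum]
    rw [Finset.sum_comm]
    refine Finset.sum_congr rfl fun i _ => Finset.sum_congr rfl fun j _ => ?_
    ring
  rw [e1, exp_sum, crossContraction, ← Finset.prod_mul_distrib]
  refine Finset.prod_congr rfl fun i _ => ?_
  rw [exp_sum, ← Finset.prod_mul_distrib]
  refine Finset.prod_congr rfl fun j _ => ?_
  rw [h.zero_eq, pairFactor, contraction, mul_one]
  have := h.zero_ne (ε i)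
  field_simp

/-- The contraction is bilinear in the fields, so its exponential is a product over pairs. The
radius is shrunk by a common bound `B` for the numbers `|q^{2(v_j - u_i)}|`. -/
theorem Represents.crossContraction_small {a b : ℕ} (ε : Fin a → ι) (ε' : Fin b → ι)
    (u : Fin a → ℂ) (v : Fin b → ℂ) : ∃ ρ : ℝ, 0 < ρ ∧ ∀ x : ℂ, ‖x‖ < ρ → ∃ L,
      HasSum (fun i : Osc => annihilation q k r (D.fieldSum q ε u) i *
        creation (D.fieldSum q ε' v) i * x ^ (i.2 + 1)) L ∧
        exp L = D.crossContraction q ε ε' u v x := by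
  obtain ⟨ρ, hρ, hs⟩ := h.small
  set B : ℝ := 1 + ∑ i, ∑ j, ‖qpow q (2 * (v j - u i))‖ with hB
  have hBpos : 0 < B := by positivity
  have hle : ∀ i j, ‖qpow q (2 * (v j - u i))‖ ≤ B := fun i j => by
    have h1 := Finset.single_le_sum (f := fun j => ‖qpow q (2 * (v j - u i))‖)
      (fun _ _ => norm_nonneg _) (Finset.mem_univ j)
    have h2 := Finset.single_le_sum (f := fun i => ∑ j, ‖qpow q (2 * (v j - u i))‖)
      (fun _ _ => by positivity) (Finset.mem_univ i)
    linarith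
  refine ⟨ρ / B, by positivity, fun x hx => ?_⟩
  have hy : ∀ i j, ‖qpow q (2 * (v j - u i)) * x‖ < ρ := fun i j => by
    rw [norm_mul]
    calc _ ≤ B * ‖x‖ := by gcongr; exact hle i j
      _ < ρ := by rwa [lt_div_iff₀' hBpos] at hx
  choose L hL hexp using fun i j => hs (ε i) (ε' j) _ (hy i j)
  refine ⟨∑ i, ∑ j, L i j, ?_, ?_⟩
  · refine hasSum_of_eq (hasSum_sum fun i _ => hasSum_sum fun j _ => hL i j) (fun o => ?_) rfl
    rw [annihilation_fieldSum, creation_fieldSum, Finset.sum_mul_sum, Finset.sum_mul]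
    refine Finset.sum_congr rfl fun i _ => ?_
    rw [Finset.sum_mul]
    refine Finset.sum_congr rfl fun j _ => ?_
    rw [show 2 * (v j - u i) = 2 * v j + -(2 * u i) by ring, qpow_add, mul_pow, mul_pow]
    ring
  · rw [exp_sum, crossContraction]
    refine Finset.prod_congr rfl fun i _ => ?_
    rw [exp_sum]
    exact Finset.prod_congr rfl fun j _ => hexp i j

theorem Represents.differentiableOn_crossContraction {a b : ℕ} (ε : Fin a → ι) (ε' : Fin b → ι)
    (u : Fin a → ℂ) (v : Fin b → ℂ) {R : ℝ} (hR : ∀ i j, ‖qpow q (2 * (v j - u i))‖ * R ≤ R₀) :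
    DifferentiableOn ℂ (D.crossContraction q ε ε' u v) (Metric.ball 0 R) := by
  unfold crossContraction contraction
  refine DifferentiableOn.fun_finsetProd fun i _ => DifferentiableOn.fun_finsetProd fun j _ => ?_
  refine DifferentiableOn.mul (by fun_prop) ?_
  refine h.fac_diff.comp (by fun_prop) fun x hx => ?_
  rw [mem_ball_zero_iff] at hx ⊢
  rw [norm_mul]
  refine lt_of_lt_of_le ?_ (hR i j)
  exact mul_lt_mul_of_pos_left hx (norm_pos_iff.mpr (qpow_ne_zero _ _))

/-- The terms of the composite of the continued products. -/
theorem Represents.hasSum_productEntry {a b : ℕ} (u : Fin a → ℂ) (v : Fin b → ℂ) {R : ℝ}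
    (hR1 : 1 < R) (hR : ∀ i j, ‖qpow q (2 * (v j - u i))‖ * R ≤ R₀) (p : Momentum)
    (e f : Basis) :
    HasSum (fun d => ∑ g ∈ level d, D.productEntry q k r a (p + b • D.shift k) e g u *
        D.productEntry q k r b p g f v)
      (D.productEntry q k r (a + b) p e f (Fin.append u v)) ∧
    ∀ R' B : ℝ, 0 < R' → R' < R → (∀ x, ‖x‖ = R' →
      ∑ ε, ∑ ε', ‖D.tupleCoef q ε u * D.tupleCoef q ε' v * compGen q k r (D.fieldSum q ε u)
        (D.fieldSum q ε' v) p e f (D.crossContraction q ε ε' u v) x‖ ≤ B) →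
      ∀ d, ‖∑ g ∈ level d, D.productEntry q k r a (p + b • D.shift k) e g u *
        D.productEntry q k r b p g f v‖ ≤
          Fintype.card (Fin a → ι) * Fintype.card (Fin b → ι) * B / R' ^ d := by
  have hterm : ∀ d, ∑ g ∈ level d, D.productEntry q k r a (p + b • D.shift k) e g u *
        D.productEntry q k r b p g f v = ∑ ε : Fin a → ι, ∑ ε' : Fin b → ι,
          D.tupleCoef q ε u * D.tupleCoef q ε' v *
          Op.compTerm (normalExp q k r (D.fieldSum q ε u)) (normalExp q k r (D.fieldSum q ε' v))
            p e f d := by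
    intro d
    have h1 : ∀ g, D.productEntry q k r a (p + b • D.shift k) e g u *
        D.productEntry q k r b p g f v = ∑ ε : Fin a → ι, ∑ ε' : Fin b → ι,
          D.tupleCoef q ε u * D.tupleCoef q ε' v *
            ((normalExp q k r (D.fieldSum q ε u)).entry (p + b • D.shift k) e g *
              (normalExp q k r (D.fieldSum q ε' v)).entry p g f) := fun g => by
      rw [productEntry, productEntry, Finset.sum_mul_sum]
      refine Finset.sum_congr rfl fun ε _ => Finset.sum_congr rfl fun ε' _ => ?_
      ring
    simp_rw [h1]
    rw [Finset.sum_comm]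
    refine Finset.sum_congr rfl fun ε _ => ?_
    rw [Finset.sum_comm]
    refine Finset.sum_congr rfl fun ε' _ => ?_
    rw [Op.compTerm, shift_normalExp_fieldSum, Finset.mul_sum]
  have key : ∀ (ε : Fin a → ι) (ε' : Fin b → ι), HasSum
        (Op.compTerm (normalExp q k r (D.fieldSum q ε u)) (normalExp q k r (D.fieldSum q ε' v)) p e f)
        (exp (∑ j, (D.fieldSum q ε u j).2.1 * (zeroComm k j * (D.fieldSum q ε' v j).1)) *
          D.crossContraction q ε ε' u v 1 *
          (normalExp q k r (D.fieldSum q ε u + D.fieldSum q ε' v)).entry p e f) ∧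
      ∀ R' B : ℝ, 0 < R' → R' < R → (∀ x, ‖x‖ = R' → ‖compGen q k r (D.fieldSum q ε u)
          (D.fieldSum q ε' v) p e f (D.crossContraction q ε ε' u v) x‖ ≤ B) →
        ∀ d, ‖Op.compTerm (normalExp q k r (D.fieldSum q ε u))
          (normalExp q k r (D.fieldSum q ε' v)) p e f d‖ ≤ B / R' ^ d := by
    intro ε ε'
    obtain ⟨ρ, hρ, hs⟩ := h.crossContraction_small ε ε' u v
    exact compTerm_normalExp q k r (D.fieldSum q ε u) (D.fieldSum q ε' v) p e f hR1
      (h.differentiableOn_crossContraction ε ε' u v hR) hρ hs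
  constructor
  · simp_rw [hterm]
    refine hasSum_of_eq (hasSum_sum fun ε _ => hasSum_sum fun ε' _ =>
      (key ε ε').1.mul_left (D.tupleCoef q ε u * D.tupleCoef q ε' v)) (fun d => rfl) ?_
    rw [productEntry, ← (Fin.appendEquiv a b).sum_comp, Fintype.sum_prod_type]
    refine Finset.sum_congr rfl fun ε _ => Finset.sum_congr rfl fun ε' _ => ?_
    change D.tupleCoef q (Fin.append ε ε') (Fin.append u v) *
      (normalExp q k r (D.fieldSum q (Fin.append ε ε') (Fin.append u v))).entry p e f = _
    rw [tupleCoef_append, fieldSum_append, h.zeroMode]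
    ring
  · intro R' B hR'0 hR' hB d
    rw [hterm]
    refine (norm_sum_le _ _).trans ((Finset.sum_le_sum fun ε _ => (norm_sum_le _ _).trans
      (Finset.sum_le_sum (g := fun _ => B / R' ^ d) fun ε' _ => ?_)).trans_eq ?_)
    -- The bound is divided by the norm of this coefficient below; if it is zero, only `0 ≤ B` is
    -- needed, and this follows from the hypothesis at one point of the circle.
    · by_cases hc : D.tupleCoef q ε u * D.tupleCoef q ε' v = 0
      · rw [hc, zero_mul, norm_zero]
        have hB0 : 0 ≤ B := le_trans (by positivity) (hB R' (by simp [abs_of_pos hR'0]))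
        positivity
      · have hc' : 0 < ‖D.tupleCoef q ε u * D.tupleCoef q ε' v‖ := norm_pos_iff.mpr hc
        have := (key ε ε').2 R' (B / ‖D.tupleCoef q ε u * D.tupleCoef q ε' v‖) hR'0 hR'
          (fun x hx => by
            rw [le_div_iff₀' hc', ← norm_mul]
            refine le_trans ?_ (hB x hx)
            refine le_trans ?_ (Finset.single_le_sum (f := fun ε => ∑ ε', ‖D.tupleCoef q ε u *
              D.tupleCoef q ε' v * compGen q k r (D.fieldSum q ε u) (D.fieldSum q ε' v) p e f
              (D.crossContraction q ε ε' u v) x‖) (fun _ _ => by positivity) (Finset.mem_univ ε))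
            exact Finset.single_le_sum (f := fun ε' => ‖D.tupleCoef q ε u *
              D.tupleCoef q ε' v * compGen q k r (D.fieldSum q ε u) (D.fieldSum q ε' v) p e f
              (D.crossContraction q ε ε' u v) x‖) (fun _ _ => by positivity) (Finset.mem_univ ε'))
            d
        rw [norm_mul]
        calc _ ≤ _ := mul_le_mul_of_nonneg_left this hc'.le
          _ = _ := by field_simp
    · simp only [Finset.sum_const, Finset.card_univ, nsmul_eq_mul]
      ring

end

end CurrentData

end ThetaScreening

namespace ThetaScreening

open Complex

/-! ## Analyticity of the continued matrix entries -/

section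

variable {E : Type*} [NormedAddCommGroup E] [NormedSpace ℂ E] {t : E}

theorem analyticAt_oscEntry {c α β : E → ℂ} (hc : AnalyticAt ℂ c t) (hα : AnalyticAt ℂ α t)
    (hβ : AnalyticAt ℂ β t) (m n : ℕ) :
    AnalyticAt ℂ (fun x => oscEntry (c x) (α x) (β x) m n) t := by
  induction n generalizing m with
  | zero =>
    simp only [oscEntry_zero_right, div_eq_mul_inv]
    exact (hc.fun_pow m).mul analyticAt_const
  | succ n ih =>
    simp only [oscEntry_succ_right]
    by_cases hm : m = 0
    · simp only [hm, if_true, zero_add]; exact hβ.mul (ih 0)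
    · simp only [hm, if_false]; exact (hα.mul (ih _)).add (hβ.mul (ih _))

theorem analyticAt_qpow (q : ℂ) {s : E → ℂ} (hs : AnalyticAt ℂ s t) :
    AnalyticAt ℂ (fun x => qpow q (s x)) t := by
  unfold qpow
  exact (hs.mul analyticAt_const).cexp

namespace CurrentData

variable {ι : Type} (D : CurrentData ι) (q : ℂ) (k r : ℕ)

theorem analyticAt_creation {N : ℕ} (ε : Fin N → ι) {u : E → Fin N → ℂ}
    (hu : ∀ i, AnalyticAt ℂ (fun x => u x i) t) (i : Osc) :
    AnalyticAt ℂ (fun x => creation (D.fieldSum q ε (u x)) i) t := by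
  simp only [creation_fieldSum]
  exact Finset.analyticAt_fun_sum _ fun a _ => analyticAt_const.mul
    ((analyticAt_qpow q (analyticAt_const.mul (hu a))).fun_pow _)

theorem analyticAt_annihilation {N : ℕ} (ε : Fin N → ι) {u : E → Fin N → ℂ}
    (hu : ∀ i, AnalyticAt ℂ (fun x => u x i) t) (i : Osc) :
    AnalyticAt ℂ (fun x => annihilation q k r (D.fieldSum q ε (u x)) i) t := by
  simp only [annihilation_fieldSum]
  exact Finset.analyticAt_fun_sum _ fun a _ => (analyticAt_const.mul
    ((analyticAt_qpow q (analyticAt_const.mul (hu a)).neg).fun_pow _)).mul analyticAt_const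

theorem analyticAt_momentum {N : ℕ} (ε : Fin N → ι) {u : E → Fin N → ℂ}
    (hu : ∀ i, AnalyticAt ℂ (fun x => u x i) t) (c : Fin 3 → ℂ) :
    AnalyticAt ℂ (fun x => exp (∑ j, (D.fieldSum q ε (u x) j).2.1 * c j)) t := by
  simp only [fieldSum_mom]
  exact (Finset.analyticAt_fun_sum _ fun j _ => (Finset.analyticAt_fun_sum _ fun i _ =>
    analyticAt_const.add (analyticAt_const.mul (hu i))).mul analyticAt_const).cexp

theorem analyticAt_entry {N : ℕ} (ε : Fin N → ι) {u : E → Fin N → ℂ}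
    (hu : ∀ i, AnalyticAt ℂ (fun x => u x i) t) (p : Momentum) (e f : Basis) :
    AnalyticAt ℂ (fun x => (normalExp q k r (D.fieldSum q ε (u x))).entry p e f) t := by
  have h := fun X => normalExp_entry q k r X p e f (e.support ∪ f.support)
    Finset.subset_union_left Finset.subset_union_right
  simp only [h]
  exact (D.analyticAt_momentum q ε hu p).mul (Finset.analyticAt_fun_prod _ fun i _ =>
    analyticAt_oscEntry (D.analyticAt_creation q ε hu i) analyticAt_const
      (D.analyticAt_annihilation q k r ε hu i) _ _)

variable {D}

theorem analyticAt_pairFactor (ε ε' : ι) {u v : E → ℂ} (hu : AnalyticAt ℂ u t)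
    (hv : AnalyticAt ℂ v t) (hf : AnalyticAt ℂ D.fac (qpow q (2 * (v t - u t)))) :
    AnalyticAt ℂ (fun x => D.pairFactor q ε ε' (u x) (v x)) t := by
  unfold pairFactor
  have h1 : AnalyticAt ℂ (fun x => qpow q (2 * (v x - u x))) t :=
    analyticAt_qpow q (analyticAt_const.mul (hv.sub hu))
  exact ((analyticAt_const.sub (analyticAt_const.mul h1)).mul
    (analyticAt_const.mul hu).cexp).mul (AnalyticAt.fun_comp (f := fun x => qpow q (2 * (v x - u x))) hf h1)

theorem analyticAt_tupleCoef {N : ℕ} (ε : Fin N → ι) {u : E → Fin N → ℂ}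
    (hu : ∀ i, AnalyticAt ℂ (fun x => u x i) t)
    (hf : ∀ i j, i ≠ j → AnalyticAt ℂ D.fac (qpow q (2 * (u t j - u t i)))) :
    AnalyticAt ℂ (fun x => D.tupleCoef q ε (u x)) t := by
  unfold tupleCoef
  exact analyticAt_const.mul (Finset.analyticAt_fun_prod _ fun i _ =>
    Finset.analyticAt_fun_prod _ fun j hj => analyticAt_pairFactor q _ _ (hu i) (hu j)
      (hf i j (Finset.mem_Ioi.mp hj).ne))

theorem analyticAt_productEntry [Fintype ι] {N : ℕ} {u : E → Fin N → ℂ}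
    (hu : ∀ i, AnalyticAt ℂ (fun x => u x i) t)
    (hf : ∀ i j, i ≠ j → AnalyticAt ℂ D.fac (qpow q (2 * (u t j - u t i)))) (p : Momentum)
    (e f : Basis) : AnalyticAt ℂ (fun x => D.productEntry q k r N p e f (u x)) t := by
  unfold productEntry
  exact Finset.analyticAt_fun_sum _ fun ε _ =>
    (analyticAt_tupleCoef q ε hu hf).mul (D.analyticAt_entry q k r ε hu p e f)

theorem analyticAt_compGen {a b : ℕ} (ε : Fin a → ι) (ε' : Fin b → ι) {u : E → Fin a → ℂ}
    {v : E → Fin b → ℂ} {x : E → ℂ} (hu : ∀ i, AnalyticAt ℂ (fun t => u t i) t)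
    (hv : ∀ i, AnalyticAt ℂ (fun t => v t i) t) (hx : AnalyticAt ℂ x t)
    (hf : ∀ i j, AnalyticAt ℂ D.fac (qpow q (2 * (v t j - u t i)) * x t)) (p : Momentum)
    (e f : Basis) :
    AnalyticAt ℂ (fun t => compGen q k r (D.fieldSum q ε (u t)) (D.fieldSum q ε' (v t)) p e f
      (D.crossContraction q ε ε' (u t) (v t)) (x t)) t := by
  have huv : ∀ i, AnalyticAt ℂ (fun t => Fin.append (u t) (v t) i) t := fun i => by
    refine Fin.addCases (fun i => ?_) (fun i => ?_) i
    · simpa only [Fin.append_left] using hu i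
    · simpa only [Fin.append_right] using hv i
  unfold compGen pairPoly crossContraction contraction
  simp only [← fieldSum_append, fieldSum_charge D q ε']
  refine ((D.analyticAt_momentum q ε hu _).mul (Finset.analyticAt_fun_prod _ fun i _ =>
    Finset.analyticAt_fun_prod _ fun j _ => ?_)).mul
    ((D.analyticAt_momentum q _ huv p).mul (Finset.analyticAt_fun_prod _ fun i _ =>
      analyticAt_oscEntry ((D.analyticAt_creation q ε hu i).add
        ((D.analyticAt_creation q ε' hv i).mul (hx.fun_pow _))) (hx.fun_pow _)
        (((hx.fun_pow _).mul (D.analyticAt_annihilation q k r ε hu i)).add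
          (D.analyticAt_annihilation q k r ε' hv i)) _ _))
  have h1 : AnalyticAt ℂ (fun t => qpow q (2 * (v t j - u t i)) * x t) t :=
    (analyticAt_qpow q (analyticAt_const.mul ((hv j).sub (hu i)))).mul hx
  exact (analyticAt_const.sub (analyticAt_const.mul h1)).mul (AnalyticAt.fun_comp
    (f := fun t => qpow q (2 * (v t j - u t i)) * x t) (hf i j) h1)

end CurrentData

end

end ThetaScreening

namespace ThetaScreening

open Complex MeasureTheory

/-! ## Integrals over tori -/

/-- The box over which the torus integrals are taken. -/
abbrev torusBox (N : ℕ) : Set (Fin N → ℝ) := Set.Icc 0 fun _ => 2 * Real.pi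

theorem torusIntegral_congr {N : ℕ} {F H : (Fin N → ℝ) → ℂ} (h : ∀ θ, F θ = H θ) :
    torusIntegral N F = torusIntegral N H := by
  rw [funext h]

theorem torusIntegral_zero (F : (Fin 0 → ℝ) → ℂ) : torusIntegral 0 F = F 0 := by
  have hbox : (Set.Icc 0 fun _ => 2 * Real.pi : Set (Fin 0 → ℝ)) = Set.univ :=
    Set.eq_univ_of_forall fun θ => ⟨fun i => i.elim0, fun i => i.elim0⟩
  rw [torusIntegral, hbox, Measure.restrict_univ, volume_pi, Measure.pi_of_empty _ 0,
    integral_dirac]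
  simp

theorem torusIntegral_one (F : ℝ → ℂ) : torusIntegral 1 (fun θ => F (θ 0)) =
    ((2 * Real.pi : ℝ) : ℂ)⁻¹ * ∫ θ in (0 : ℝ)..(2 * Real.pi), F θ := by
  rw [torusIntegral, pow_one, intervalIntegral.integral_of_le Real.two_pi_pos.le,
    ← integral_Icc_eq_integral_Ioc]
  have hpre : MeasurableEquiv.funUnique (Fin 1) ℝ ⁻¹' Set.Icc 0 (2 * Real.pi) = torusBox 1 := by
    ext θ
    simp [Pi.le_def]
  rw [← (volume_preserving_funUnique (Fin 1) ℝ).setIntegral_preimage_emb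
    (MeasurableEquiv.measurableEmbedding _), hpre]
  rfl

/-- Concatenation of tuples as a measurable equivalence. -/
def appendMeasurableEquiv (a b : ℕ) : (Fin a → ℝ) × (Fin b → ℝ) ≃ᵐ (Fin (a + b) → ℝ) :=
  (MeasurableEquiv.sumPiEquivProdPi fun _ : Fin a ⊕ Fin b => ℝ).symm.trans
    (MeasurableEquiv.piCongrLeft (fun _ : Fin (a + b) => ℝ) finSumFinEquiv)

theorem appendMeasurableEquiv_apply {a b : ℕ} (x : (Fin a → ℝ) × (Fin b → ℝ)) :
    appendMeasurableEquiv a b x = Fin.append x.1 x.2 := by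
  funext i
  refine Fin.addCases (fun i => ?_) (fun i => ?_) i
  · rw [Fin.append_left, ← finSumFinEquiv_apply_left]
    exact Equiv.piCongrLeft_apply_apply (fun _ : Fin (a + b) => ℝ) finSumFinEquiv _ (Sum.inl i)
  · rw [Fin.append_right, ← finSumFinEquiv_apply_right]
    exact Equiv.piCongrLeft_apply_apply (fun _ : Fin (a + b) => ℝ) finSumFinEquiv _ (Sum.inr i)

theorem measurePreserving_append (a b : ℕ) : MeasurePreserving (appendMeasurableEquiv a b) :=
  (volume_measurePreserving_sumPiEquivProdPi_symm fun _ : Fin a ⊕ Fin b => ℝ).trans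
    (volume_measurePreserving_piCongrLeft (fun _ : Fin (a + b) => ℝ) finSumFinEquiv)

theorem append_preimage_torusBox (a b : ℕ) :
    appendMeasurableEquiv a b ⁻¹' torusBox (a + b) = torusBox a ×ˢ torusBox b := by
  ext x
  simp only [Set.mem_preimage, appendMeasurableEquiv_apply, Set.mem_Icc, Set.mem_prod, Pi.le_def,
    Fin.forall_fin_add, Fin.append_left, Fin.append_right, Pi.zero_apply]
  tauto

theorem continuous_append (a b : ℕ) :
    Continuous fun x : (Fin a → ℝ) × (Fin b → ℝ) => Fin.append x.1 x.2 := by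
  refine continuous_pi fun i => ?_
  refine Fin.addCases (fun i => ?_) (fun i => ?_) i
  · simp only [Fin.append_left]; fun_prop
  · simp only [Fin.append_right]; fun_prop

theorem torusIntegral_append {a b : ℕ} {F : (Fin (a + b) → ℝ) → ℂ} (hF : Continuous F) :
    torusIntegral a (fun α => torusIntegral b fun β => F (Fin.append α β)) =
      torusIntegral (a + b) F := by
  simp only [torusIntegral]
  rw [← (measurePreserving_append a b).setIntegral_preimage_emb
    (MeasurableEquiv.measurableEmbedding _), append_preimage_torusBox]
  simp only [appendMeasurableEquiv_apply]
  rw [Measure.volume_eq_prod, setIntegral_prod, integral_const_mul]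
  · rw [pow_add]
    push_cast
    rw [mul_inv]
    ring
  · exact ((hF.comp (continuous_append a b)).continuousOn).integrableOn_compact
      (isCompact_Icc.prod isCompact_Icc)

theorem torusIntegral_mul_left {N : ℕ} (c : ℂ) (F : (Fin N → ℝ) → ℂ) :
    torusIntegral N (fun θ => c * F θ) = c * torusIntegral N F := by
  simp only [torusIntegral, integral_const_mul]
  ring

theorem torusIntegral_mul_right {N : ℕ} (c : ℂ) (F : (Fin N → ℝ) → ℂ) :
    torusIntegral N (fun θ => F θ * c) = torusIntegral N F * c := by
  simp only [torusIntegral, integral_mul_const]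
  ring

theorem torusIntegral_sum {N : ℕ} {κ : Type*} (s : Finset κ) {F : κ → (Fin N → ℝ) → ℂ}
    (hF : ∀ g ∈ s, Continuous (F g)) :
    torusIntegral N (fun θ => ∑ g ∈ s, F g θ) = ∑ g ∈ s, torusIntegral N (F g) := by
  simp only [torusIntegral]
  rw [integral_finsetSum _ fun g hg => (hF g hg).continuousOn.integrableOn_compact isCompact_Icc,
    Finset.mul_sum]

theorem torusIntegral_mul {a b : ℕ} {F : (Fin a → ℝ) → ℂ} {H : (Fin b → ℝ) → ℂ}
    (hF : Continuous F) (hH : Continuous H) :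
    torusIntegral a F * torusIntegral b H = torusIntegral (a + b) fun θ =>
      F (fun i => θ (Fin.castAdd b i)) * H (fun j => θ (Fin.natAdd a j)) := by
  rw [← torusIntegral_append (by fun_prop)]
  simp only [Fin.append_left, Fin.append_right, torusIntegral_mul_left, torusIntegral_mul_right]

/-- Permuting coordinates preserves Lebesgue measure and the box `[0, 2π]^N`; no periodicity of the
integrand in the angles enters. -/
theorem torusIntegral_comp_perm {N : ℕ} (σ : Equiv.Perm (Fin N)) (F : (Fin N → ℝ) → ℂ) :
    torusIntegral N (fun θ => F (θ ∘ σ)) = torusIntegral N F := by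
  simp only [torusIntegral]
  congr 1
  have hm := volume_measurePreserving_piCongrLeft (fun _ : Fin N => ℝ) σ.symm
  have happ : ∀ θ : Fin N → ℝ,
      MeasurableEquiv.piCongrLeft (fun _ : Fin N => ℝ) σ.symm θ = θ ∘ σ := fun θ => by
    funext i
    have := Equiv.piCongrLeft_apply_apply (fun _ : Fin N => ℝ) σ.symm θ (σ i)
    rw [Equiv.symm_apply_apply] at this
    exact this
  rw [← hm.setIntegral_preimage_emb (MeasurableEquiv.measurableEmbedding _) F]
  have hpre : MeasurableEquiv.piCongrLeft (fun _ : Fin N => ℝ) σ.symm ⁻¹' torusBox N =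
      torusBox N := by
    ext θ
    simp only [Set.mem_preimage, happ, Set.mem_Icc, Pi.le_def, Function.comp]
    exact and_congr ⟨fun h i => by simpa using h (σ.symm i), fun h i => h (σ i)⟩
      ⟨fun h i => by simpa using h (σ.symm i), fun h i => h (σ i)⟩
  rw [hpre]
  simp only [happ]

theorem hasSum_torusIntegral {N : ℕ} {F : ℕ → (Fin N → ℝ) → ℂ} {G : (Fin N → ℝ) → ℂ}
    {B ρ : ℝ} (hF : ∀ d, Continuous (F d)) (hρ0 : 0 ≤ ρ) (hρ1 : ρ < 1)
    (hB : ∀ θ ∈ torusBox N, ∀ d, ‖F d θ‖ ≤ B * ρ ^ d) (hG : ∀ θ, HasSum (fun d => F d θ) (G θ)) :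
    HasSum (fun d => torusIntegral N (F d)) (torusIntegral N G) := by
  simp only [torusIntegral]
  refine HasSum.mul_left _ ?_
  refine hasSum_integral_of_dominated_convergence (fun d _ => B * ρ ^ d)
    (fun d => ((hF d).aestronglyMeasurable)) (fun d => ?_) (ae_of_all _ fun θ => ?_) ?_
    (ae_of_all _ hG)
  · exact (ae_restrict_iff' measurableSet_Icc).mpr (ae_of_all _ fun θ hθ => hB θ hθ d)
  · exact (summable_geometric_of_lt_one hρ0 hρ1).mul_left B
  · exact continuousOn_const.integrableOn_compact isCompact_Icc

end ThetaScreening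

namespace ThetaScreening

open Complex

/-! ## Literal powers of the screening operators -/

theorem norm_qpow_circlePoint_sub (q : ℂ) (α β : ℝ) :
    ‖qpow q (2 * (circlePoint q α - circlePoint q β))‖ = 1 := by
  by_cases hl : log q = 0
  · simp [qpow, hl]
  · have : 2 * (circlePoint q α - circlePoint q β) * log q = ((α - β : ℝ) : ℂ) * I := by
      unfold circlePoint
      field_simp
      push_cast
      ring
    rw [qpow, this, norm_exp_ofReal_mul_I]

theorem norm_qpow_torusPoint_sub (q : ℂ) {a b : ℕ} (α : Fin a → ℝ) (β : Fin b → ℝ) (i : Fin a)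
    (j : Fin b) : ‖qpow q (2 * (torusPoint q β j - torusPoint q α i))‖ = 1 :=
  norm_qpow_circlePoint_sub q _ _

theorem continuous_circlePoint (q : ℂ) : Continuous (circlePoint q) := by
  unfold circlePoint
  fun_prop

theorem continuous_torusPoint (q : ℂ) (N : ℕ) : Continuous (torusPoint q (N := N)) :=
  continuous_pi fun i => (continuous_circlePoint q).comp (continuous_apply i)

theorem torusPoint_append (q : ℂ) {a b : ℕ} (α : Fin a → ℝ) (β : Fin b → ℝ) :
    torusPoint q (Fin.append α β) = Fin.append (torusPoint q α) (torusPoint q β) := by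
  funext i
  refine Fin.addCases (fun i => ?_) (fun i => ?_) i <;> simp [torusPoint]

theorem weightProduct_append (s : Momentum) (w : Momentum → ℂ → ℂ) {a b : ℕ} (p : Momentum)
    (u : Fin a → ℂ) (v : Fin b → ℂ) : weightProduct s w (a + b) p (Fin.append u v) =
      weightProduct s w a (p + b • s) u * weightProduct s w b p v := by
  unfold weightProduct
  rw [Fin.prod_univ_add]
  congr 1
  · refine Finset.prod_congr rfl fun i _ => ?_
    -- The weights of the left block also see the `b` currents to their right, which accounts for
    -- the momentum `p + b • s`.
    have hi : a + b - 1 - (i : ℕ) = b + (a - 1 - i) := by omega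
    rw [Fin.append_left, add_assoc, ← add_smul, Fin.val_castAdd, hi]
  · refine Finset.prod_congr rfl fun i _ => ?_
    have hi : a + b - 1 - (a + i) = b - 1 - (i : ℕ) := by omega
    rw [Fin.append_right, Fin.val_natAdd, hi]

theorem continuous_weightProduct {q : ℂ} {w : Momentum → ℂ → ℂ}
    (hw : ∀ p, Continuous fun θ => w p (circlePoint q θ)) (s : Momentum) (N : ℕ) (p : Momentum) :
    Continuous fun θ : Fin N → ℝ => weightProduct s w N p (torusPoint q θ) :=
  continuous_finsetProd _ fun i _ => (hw _).comp (continuous_apply i)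

theorem analyticAt_apply {ι : Type*} [Fintype ι] (i : ι) (t : ι → ℂ) :
    AnalyticAt ℂ (fun x : ι → ℂ => x i) t :=
  (ContinuousLinearMap.proj (R := ℂ) (φ := fun _ : ι => ℂ) i).analyticAt t

theorem prod_replicate_shift (A : Op) (n : ℕ) :
    (Op.prod (List.replicate n A)).shift = n • A.shift := by
  induction n with
  | zero => simp [Op.prod, Op.id]
  | succ n ih =>
    rw [List.replicate_succ, Op.prod, Op.comp, ih, succ_nsmul']

theorem oscEntry_zero_one_zero (m n : ℕ) : oscEntry 0 1 0 m n = if m = n then 1 else 0 := by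
  induction n generalizing m with
  | zero => cases m <;> simp [oscEntry_zero_right]
  | succ n ih => cases m <;> simp [oscEntry_succ_right, ih]

namespace CurrentData

variable {ι : Type} [Fintype ι] (D : CurrentData ι) (q : ℂ) (k r : ℕ)

/-- The integrand of a matrix entry of a power of a screening operator. -/
def torusEntry (w : Momentum → ℂ → ℂ) (N : ℕ) (p : Momentum) (e f : Basis) (θ : Fin N → ℝ) : ℂ :=
  D.productEntry q k r N p e f (torusPoint q θ) *
    weightProduct (D.shift k) w N p (torusPoint q θ)

/-- The integrand of the part of a composite with intermediate states of degree `d`. -/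
def torusTerm (w : Momentum → ℂ → ℂ) (a b : ℕ) (p : Momentum) (e f : Basis) (d : ℕ)
    (θ : Fin (a + b) → ℝ) : ℂ :=
  ∑ g ∈ level d, D.torusEntry q k r w a (p + b • D.shift k) e g (fun i => θ (Fin.castAdd b i)) *
    D.torusEntry q k r w b p g f (fun j => θ (Fin.natAdd a j))

variable {D q k r}

theorem torusPoint_split {a b : ℕ} (θ : Fin (a + b) → ℝ) : torusPoint q θ =
    Fin.append (torusPoint q fun i => θ (Fin.castAdd b i))
      (torusPoint q fun j => θ (Fin.natAdd a j)) := by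
  rw [← torusPoint_append, Fin.append_castAdd_natAdd]

theorem torusTerm_eq (w : Momentum → ℂ → ℂ) (a b : ℕ) (p : Momentum) (e f : Basis) (d : ℕ)
    (θ : Fin (a + b) → ℝ) : D.torusTerm q k r w a b p e f d θ = (∑ g ∈ level d,
      D.productEntry q k r a (p + b • D.shift k) e g (torusPoint q fun i => θ (Fin.castAdd b i)) *
        D.productEntry q k r b p g f (torusPoint q fun j => θ (Fin.natAdd a j))) *
      weightProduct (D.shift k) w (a + b) p (torusPoint q θ) := by
  rw [torusTerm, torusPoint_split θ, weightProduct_append, Finset.sum_mul]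
  refine Finset.sum_congr rfl fun g _ => ?_
  rw [torusEntry, torusEntry]
  ring

theorem productEntry_zero (p : Momentum) (e f : Basis) (u : Fin 0 → ℂ) :
    D.productEntry q k r 0 p e f u = if e = f then 1 else 0 := by
  rw [productEntry, Fintype.sum_unique, tupleCoef, fieldSum, normalExp_entry q k r _ p e f
    (e.support ∪ f.support) Finset.subset_union_left Finset.subset_union_right]
  simp only [Finset.univ_eq_empty, Finset.sum_empty, Finset.prod_empty, creation, annihilation,
    Pi.zero_apply, Prod.fst_zero, Prod.snd_zero, zero_mul, Finset.sum_const_zero, exp_zero, one_mul,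
    oscEntry_zero_one_zero]
  split_ifs with h
  · simp [h]
  · obtain ⟨i, hi⟩ := Finsupp.ne_iff.mp h
    refine Finset.prod_eq_zero (i := i) ?_ (if_neg hi)
    rw [Finset.mem_union, Finsupp.mem_support_iff, Finsupp.mem_support_iff]
    by_contra hc
    push Not at hc
    exact hi (hc.1.trans hc.2.symm)

theorem continuous_torusEntry (hf : ∀ α β : ℝ, AnalyticAt ℂ D.fac
      (qpow q (2 * (circlePoint q α - circlePoint q β)))) {w : Momentum → ℂ → ℂ}
    (hw : ∀ p, Continuous fun θ => w p (circlePoint q θ)) (N : ℕ) (p : Momentum) (e f : Basis) :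
    Continuous (D.torusEntry q k r w N p e f) := by
  refine Continuous.mul (continuous_iff_continuousAt.mpr fun θ => ?_)
    (continuous_weightProduct hw _ _ _)
  have h1 : AnalyticAt ℂ (fun u : Fin N → ℂ => D.productEntry q k r N p e f u) (torusPoint q θ) :=
    analyticAt_productEntry q k r (fun i => analyticAt_apply i _) (fun i j _ => hf _ _) p e f
  exact h1.continuousAt.comp (continuous_torusPoint q N).continuousAt

variable {A : ℂ → Op} {R₀ : ℝ} (h : D.Represents q k r A R₀)
include h

theorem Represents.analyticAt_fac {y : ℂ} (hy : ‖y‖ < R₀) : AnalyticAt ℂ D.fac y :=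
  h.fac_diff.analyticAt (Metric.isOpen_ball.mem_nhds (by simpa using hy))

theorem Represents.continuous_torusEntry (hR₀ : 1 < R₀) {w : Momentum → ℂ → ℂ}
    (hw : ∀ p, Continuous fun θ => w p (circlePoint q θ)) (N : ℕ) (p : Momentum) (e f : Basis) :
    Continuous (D.torusEntry q k r w N p e f) :=
  CurrentData.continuous_torusEntry (fun α β => h.analyticAt_fac
    (by rwa [norm_qpow_circlePoint_sub])) hw N p e f

/-- The generating functions are jointly continuous in the angles and in `x` on the compact product
of the two boxes with the circle `|x| = R'`, because there all arguments of `fac` have modulus `1`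
or `R'`, less than `R₀`. -/
theorem Represents.exists_bound (hR₀ : 1 < R₀) {R' : ℝ} (hR' : R' < R₀)
    {a b : ℕ} (p : Momentum) (e f : Basis) :
    ∃ B : ℝ, ∀ α ∈ torusBox a, ∀ β ∈ torusBox b, ∀ x : ℂ, ‖x‖ = R' →
      ∑ ε : Fin a → ι, ∑ ε' : Fin b → ι, ‖D.tupleCoef q ε (torusPoint q α) *
        D.tupleCoef q ε' (torusPoint q β) * compGen q k r (D.fieldSum q ε (torusPoint q α))
        (D.fieldSum q ε' (torusPoint q β)) p e f
        (D.crossContraction q ε ε' (torusPoint q α) (torusPoint q β)) x‖ ≤ B := by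
  have hc : ContinuousOn (fun t : (Fin a → ℝ) × (Fin b → ℝ) × ℂ =>
      ∑ ε : Fin a → ι, ∑ ε' : Fin b → ι, ‖D.tupleCoef q ε (torusPoint q t.1) *
        D.tupleCoef q ε' (torusPoint q t.2.1) * compGen q k r (D.fieldSum q ε (torusPoint q t.1))
        (D.fieldSum q ε' (torusPoint q t.2.1)) p e f
        (D.crossContraction q ε ε' (torusPoint q t.1) (torusPoint q t.2.1)) t.2.2‖)
      (torusBox a ×ˢ torusBox b ×ˢ Metric.sphere (0 : ℂ) R') := by
    refine continuousOn_finsetSum _ fun ε _ => continuousOn_finsetSum _ fun ε' _ =>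
      ContinuousOn.norm fun t ht => ContinuousAt.continuousWithinAt ?_
    have hx : ‖t.2.2‖ = R' := by simpa using ht.2.2
    have hmap : Continuous fun t : (Fin a → ℝ) × (Fin b → ℝ) × ℂ =>
        (torusPoint q t.1, torusPoint q t.2.1, t.2.2) :=
      ((continuous_torusPoint q a).comp continuous_fst).prodMk
        (((continuous_torusPoint q b).comp (continuous_fst.comp continuous_snd)).prodMk
          (continuous_snd.comp continuous_snd))
    have h1 : AnalyticAt ℂ (fun s : (Fin a → ℂ) × (Fin b → ℂ) × ℂ =>
        D.tupleCoef q ε s.1 * D.tupleCoef q ε' s.2.1 *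
          compGen q k r (D.fieldSum q ε s.1) (D.fieldSum q ε' s.2.1) p e f
            (D.crossContraction q ε ε' s.1 s.2.1) s.2.2)
        (torusPoint q t.1, torusPoint q t.2.1, t.2.2) := by
      have hu : ∀ i, AnalyticAt ℂ (fun s : (Fin a → ℂ) × (Fin b → ℂ) × ℂ => s.1 i)
          (torusPoint q t.1, torusPoint q t.2.1, t.2.2) := fun i =>
        AnalyticAt.fun_comp (analyticAt_apply i _) analyticAt_fst
      have hv : ∀ i, AnalyticAt ℂ (fun s : (Fin a → ℂ) × (Fin b → ℂ) × ℂ => s.2.1 i)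
          (torusPoint q t.1, torusPoint q t.2.1, t.2.2) := fun i =>
        AnalyticAt.fun_comp (g := fun s : (Fin b → ℂ) × ℂ => s.1 i)
          (AnalyticAt.fun_comp (analyticAt_apply i _) analyticAt_fst) analyticAt_snd
      have hx' : AnalyticAt ℂ (fun s : (Fin a → ℂ) × (Fin b → ℂ) × ℂ => s.2.2)
          (torusPoint q t.1, torusPoint q t.2.1, t.2.2) :=
        AnalyticAt.fun_comp (g := fun s : (Fin b → ℂ) × ℂ => s.2) analyticAt_snd analyticAt_snd
      refine ((analyticAt_tupleCoef q ε hu fun i j _ => ?_).mul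
        (analyticAt_tupleCoef q ε' hv fun i j _ => ?_)).mul
        (analyticAt_compGen q k r ε ε' hu hv hx' (fun i j => ?_) p e f)
      · exact h.analyticAt_fac (by rwa [norm_qpow_torusPoint_sub])
      · exact h.analyticAt_fac (by rwa [norm_qpow_torusPoint_sub])
      · refine h.analyticAt_fac ?_
        rw [norm_mul, norm_qpow_torusPoint_sub, one_mul, hx]
        exact hR'
    exact ContinuousAt.comp (f := fun t : (Fin a → ℝ) × (Fin b → ℝ) × ℂ =>
        (torusPoint q t.1, torusPoint q t.2.1, t.2.2)) h1.continuousAt hmap.continuousAt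
  obtain ⟨B, hB⟩ := (isCompact_Icc.prod (isCompact_Icc.prod
    (isCompact_sphere (0 : ℂ) R'))).exists_bound_of_continuousOn hc
  exact ⟨B, fun α hα β hβ x hx => (Real.le_norm_self _).trans
    (hB (α, β, x) ⟨hα, hβ, by simpa using hx⟩)⟩

theorem Represents.hasSum_torusTerm (hR₀ : 1 < R₀) (w : Momentum → ℂ → ℂ) (a b : ℕ) (p : Momentum)
    (e f : Basis) (θ : Fin (a + b) → ℝ) :
    HasSum (fun d => D.torusTerm q k r w a b p e f d θ)
      (D.torusEntry q k r w (a + b) p e f θ) := by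
  have hsum := h.hasSum_productEntry (torusPoint q fun i => θ (Fin.castAdd b i))
    (torusPoint q fun j => θ (Fin.natAdd a j)) hR₀
    (fun i j => by rw [norm_qpow_torusPoint_sub, one_mul]) p e f
  refine hasSum_of_eq (hsum.1.mul_right (weightProduct (D.shift k) w (a + b) p (torusPoint q θ)))
    (fun d => torusTerm_eq w a b p e f d θ) ?_
  rw [torusEntry, ← torusPoint_split]

theorem Represents.continuous_torusTerm (hR₀ : 1 < R₀) {w : Momentum → ℂ → ℂ}
    (hw : ∀ p, Continuous fun θ => w p (circlePoint q θ)) (a b : ℕ) (p : Momentum) (e f : Basis)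
    (d : ℕ) : Continuous (D.torusTerm q k r w a b p e f d) :=
  continuous_finsetSum _ fun _ _ =>
    ((h.continuous_torusEntry hR₀ hw _ _ _ _).comp (by fun_prop)).mul
      ((h.continuous_torusEntry hR₀ hw _ _ _ _).comp (by fun_prop))

/-- Cauchy's estimate on a circle of radius strictly between `1` and `R₀`, uniformly over the torus.
This is the domination that permits exchanging the sum over the degree with the integral. -/
theorem Represents.torusTerm_le (hR₀ : 1 < R₀) {w : Momentum → ℂ → ℂ}
    (hw : ∀ p, Continuous fun θ => w p (circlePoint q θ)) (a b : ℕ) (p : Momentum) (e f : Basis) :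
    ∃ B ρ : ℝ, 0 ≤ ρ ∧ ρ < 1 ∧ ∀ θ ∈ torusBox (a + b), ∀ d,
      ‖D.torusTerm q k r w a b p e f d θ‖ ≤ B * ρ ^ d := by
  obtain ⟨R', hR'1, hR'⟩ := exists_between hR₀
  have hR'0 : 0 < R' := zero_lt_one.trans hR'1
  obtain ⟨B, hB⟩ := h.exists_bound hR₀ hR' (a := a) (b := b) p e f
  obtain ⟨C, hC⟩ := (isCompact_Icc (a := (0 : Fin (a + b) → ℝ))
    (b := fun _ => 2 * Real.pi)).exists_bound_of_continuousOn
    (continuous_weightProduct hw (D.shift k) (a + b) p).continuousOn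
  refine ⟨Fintype.card (Fin a → ι) * Fintype.card (Fin b → ι) * B * C, R'⁻¹, by positivity,
    inv_lt_one_of_one_lt₀ hR'1, fun θ hθ d => ?_⟩
  rw [torusTerm_eq, norm_mul]
  have h1 := (h.hasSum_productEntry (torusPoint q fun i => θ (Fin.castAdd b i))
    (torusPoint q fun j => θ (Fin.natAdd a j)) hR₀
    (fun i j => by rw [norm_qpow_torusPoint_sub, one_mul]) p e f).2 R' B hR'0 hR'
    (fun x hx => hB _ ⟨fun i => hθ.1 _, fun i => hθ.2 _⟩ _
      ⟨fun i => hθ.1 _, fun i => hθ.2 _⟩ x hx) d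
  have h2 := hC θ hθ
  refine (mul_le_mul h1 h2 (norm_nonneg _) ((norm_nonneg _).trans h1)).trans_eq ?_
  rw [inv_pow]
  ring

/-- The terms of the composite of two powers of a screening operator. -/
theorem Represents.hasSum_torusEntry (hR₀ : 1 < R₀) {w : Momentum → ℂ → ℂ}
    (hw : ∀ p, Continuous fun θ => w p (circlePoint q θ)) (a b : ℕ) (p : Momentum) (e f : Basis) :
    HasSum (fun d => ∑ g ∈ level d,
        torusIntegral a (D.torusEntry q k r w a (p + b • D.shift k) e g) *
          torusIntegral b (D.torusEntry q k r w b p g f))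
      (torusIntegral (a + b) (D.torusEntry q k r w (a + b) p e f)) := by
  obtain ⟨B, ρ, hρ0, hρ1, hB⟩ := h.torusTerm_le hR₀ hw a b p e f
  have hcont := fun N p e f => h.continuous_torusEntry hR₀ hw N p e f
  refine hasSum_of_eq (hasSum_torusIntegral (h.continuous_torusTerm hR₀ hw a b p e f) hρ0 hρ1 hB
    (h.hasSum_torusTerm hR₀ w a b p e f)) (fun d => ?_) rfl
  unfold torusTerm
  refine Eq.trans ?_ (torusIntegral_sum _ fun g _ => ?_).symm
  · exact Finset.sum_congr rfl fun g _ => torusIntegral_mul (hcont _ _ _ _) (hcont _ _ _ _)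
  · exact ((hcont a (p + b • D.shift k) e g).comp
      (f := fun θ : Fin (a + b) → ℝ => fun i => θ (Fin.castAdd b i)) (by fun_prop)).mul
      ((hcont b p g f).comp
      (f := fun θ : Fin (a + b) → ℝ => fun j => θ (Fin.natAdd a j)) (by fun_prop))

theorem Represents.pow_shift (w : Momentum → ℂ → ℂ) (N : ℕ) :
    (Op.prod (List.replicate N (contourOp q A w))).shift = N • D.shift k := by
  rw [prod_replicate_shift, contourOp, h.shift_eq]

theorem Represents.entry_eq_productEntry (u : ℂ) (p : Momentum) (e f : Basis) :
    (A u).entry p e f = D.productEntry q k r 1 p e f fun _ => u := by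
  rw [h.entry_eq, productEntry, ← (Equiv.funUnique (Fin 1) ι).symm.sum_comp]
  refine Finset.sum_congr rfl fun ε _ => ?_
  simp [tupleCoef, fieldSum]

theorem Represents.contourOp_entry (w : Momentum → ℂ → ℂ) (p : Momentum) (e f : Basis) :
    (contourOp q A w).entry p e f = torusIntegral 1 (D.torusEntry q k r w 1 p e f) := by
  refine (torusIntegral_one fun θ => (A (circlePoint q θ)).entry p e f *
    w p (circlePoint q θ)).symm.trans ?_
  refine torusIntegral_congr fun θ => ?_
  rw [torusEntry, h.entry_eq_productEntry, weightProduct, Fin.prod_univ_one]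
  congr 1
  simp [torusPoint]

/-- The powers of a screening operator, as compositions of operators, are multiple integrals. -/
theorem Represents.pow_contourOp (hR₀ : 1 < R₀) {w : Momentum → ℂ → ℂ}
    (hw : ∀ p, Continuous fun θ => w p (circlePoint q θ)) (N : ℕ) :
    (∀ p, (contourOp q A w).PowDefined N p) ∧
      ∀ p e f, ((contourOp q A w).pow N).entry p e f =
        torusIntegral N (D.torusEntry q k r w N p e f) := by
  induction N with
  | zero =>
    refine ⟨fun p => trivial, fun p e f => ?_⟩
    rw [torusIntegral_zero, torusEntry, productEntry_zero, weightProduct, Finset.univ_eq_empty,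
      Finset.prod_empty, mul_one]
    rfl
  | succ N ih =>
    have hterm : ∀ p e f d, Op.compTerm (contourOp q A w)
        (Op.prod (List.replicate N (contourOp q A w))) p e f d = ∑ g ∈ level d,
          torusIntegral 1 (D.torusEntry q k r w 1 (p + N • D.shift k) e g) *
            torusIntegral N (D.torusEntry q k r w N p g f) := fun p e f d => by
      refine Finset.sum_congr rfl fun g _ => ?_
      rw [h.pow_shift, h.contourOp_entry]
      exact congrArg _ (ih.2 p g f)
    have hs := fun p e f => hasSum_of_eq (h.hasSum_torusEntry hR₀ hw 1 N p e f) (hterm p e f) rfl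
    refine ⟨fun p => ⟨ih.1 p, fun e f => (hs p e f).summable⟩, fun p e f => ?_⟩
    have := (hs p e f).tsum_eq
    rw [add_comm 1 N] at this
    exact this

/-- The `N`-th power and all composites of an `a`-th and a `b`-th power with `a + b = N` have the
same integral as matrix entry, so the vanishing of this single integral settles them all. -/
theorem Represents.nilpotentOn (hR₀ : 1 < R₀) {w : Momentum → ℂ → ℂ}
    (hw : ∀ p, Continuous fun θ => w p (circlePoint q θ)) {N : ℕ} {p : Momentum}
    (hzero : ∀ e f, torusIntegral N (D.torusEntry q k r w N p e f) = 0) :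
    (contourOp q A w).NilpotentOn N p := by
  have hpow := h.pow_contourOp hR₀ hw
  refine ⟨⟨(hpow N).1 p, fun e f => ?_⟩, fun a b hab => ?_⟩
  · rw [(hpow N).2, hzero]
  · subst hab
    have hterm : ∀ e f d, Op.compTerm ((contourOp q A w).pow a) ((contourOp q A w).pow b) p e f d =
        ∑ g ∈ level d, torusIntegral a (D.torusEntry q k r w a (p + b • D.shift k) e g) *
            torusIntegral b (D.torusEntry q k r w b p g f) := fun e f d => by
      refine Finset.sum_congr rfl fun g _ => ?_
      rw [(hpow a).2, (hpow b).2, Op.pow, h.pow_shift]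
    have hs := fun e f => hasSum_of_eq (h.hasSum_torusEntry hR₀ hw a b p e f) (hterm e f) rfl
    exact ⟨(hpow b).1 p, (hpow a).1 _, fun e f => (hs e f).summable, fun e f =>
      (hs e f).tsum_eq.trans (hzero e f)⟩

end CurrentData

end ThetaScreening

namespace ThetaScreening

open Complex

/-! ## The domain of the continuation -/

theorem bracket_eq_zero_iff {q : ℂ} (hq0 : q ≠ 0) (hq1 : ‖q‖ < 1) {x : ℝ} (hx : 0 < x) (v : ℂ) :
    bracket q x v = 0 ↔ prodTheta q x v = 0 := by
  obtain ⟨c, hc, h⟩ := exists_bracket_eq_mul_prodTheta hq0 hq1 hx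
  rw [h, mul_eq_zero, or_iff_right hc]

/-- At the zeros `i x + j ω` one has `|q^{2v}| = |q|^{2 i x}`, as `q^{2ω}` is unimodular. Absolute
values alone therefore detect nonvanishing. -/
theorem bracket_ne_zero_of_norm {q : ℂ} (hq0 : q ≠ 0) (hq1 : ‖q‖ < 1) {x : ℝ} (hx : 0 < x)
    {v : ℂ} {s : ℝ} (hv : ‖qpow q (2 * v)‖ = ‖q‖ ^ (2 * s)) (hs : ∀ i : ℤ, s ≠ i * x) :
    bracket q x v ≠ 0 := by
  rw [Ne, bracket_eq_zero_iff hq0 hq1 hx]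
  intro h
  obtain ⟨i, j, rfl⟩ := exists_eq_lattice_of_prodTheta_eq_zero hq0 hq1 hx h
  have hper : ‖qpow q (2 * (j * omega q))‖ = 1 := by
    rw [qpow, show 2 * ((j : ℂ) * omega q) * log q = ((-(2 * j * Real.pi) : ℝ) : ℂ) * I by
      linear_combination (2 * j : ℂ) * omega_mul_log hq0 hq1 +
        (by push_cast; ring : (2 * j : ℂ) * -(Real.pi * I) = ((-(2 * j * Real.pi) : ℝ) : ℂ) * I),
      norm_exp_ofReal_mul_I]
  rw [mul_add, qpow_add, norm_mul, hper, mul_one,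
    show 2 * ((i : ℂ) * x) = ((2 * (i * x) : ℝ) : ℂ) by push_cast; ring, norm_qpow_real hq0] at hv
  have := (Real.rpow_right_inj (norm_pos_iff.mpr hq0) hq1.ne).mp hv
  exact hs i (by linarith)

theorem norm_qpow_circlePoint (q : ℂ) (θ : ℝ) : ‖qpow q (2 * circlePoint q θ)‖ = 1 := by
  simpa [circlePoint] using norm_qpow_circlePoint_sub q θ 0

theorem isOpen_exchangeDomain {q : ℂ} (hq0 : q ≠ 0) (hq1 : ‖q‖ < 1) {x : ℝ} (hx : 0 < x)
    (N : ℕ) : IsOpen (exchangeDomain q x N) := by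
  have hc := (isTheta_bracket hq0 hq1 hx).diff.continuous
  simp only [exchangeDomain, Set.ofPred_forall]
  exact isOpen_iInter_of_finite fun i => isOpen_iInter_of_finite fun j =>
    isOpen_iInter_of_finite fun _ => isOpen_ne_fun (hc.comp (by fun_prop)) continuous_const

/-- On the complex line through two points of the domain each removed theta factor is not
identically zero and has only countably many zeros; the complement of a countable set in the plane
is connected. -/
theorem isPreconnected_exchangeDomain {q : ℂ} (hq0 : q ≠ 0) (hq1 : ‖q‖ < 1) {x : ℝ} (hx : 0 < x)
    (N : ℕ) : IsPreconnected (exchangeDomain q x N) := by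
  refine isPreconnected_of_forall_pair fun a ha b hb => ?_
  set L : ℂ → Fin N → ℂ := fun t i => a i + t * (b i - a i) with hL
  have hcount : {t | L t ∈ exchangeDomain q x N}ᶜ.Countable := by
    have hsub : {t | L t ∈ exchangeDomain q x N}ᶜ ⊆ ⋃ i, ⋃ j, ⋃ (_ : i ≠ j),
        {t | bracket q x (L t i - L t j + 1) = 0} := fun t ht => by
      simp only [Set.mem_compl_iff, Set.mem_ofPred_eq, exchangeDomain, not_forall, not_not] at ht
      obtain ⟨i, j, hij, h⟩ := ht
      simp only [Set.mem_iUnion]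
      exact ⟨i, j, hij, h⟩
    refine Set.Countable.mono hsub (Set.countable_iUnion fun i => Set.countable_iUnion fun j =>
      Set.countable_iUnion fun hij => ?_)
    set d : ℂ := (b i - a i) - (b j - a j) with hd
    have hlin : ∀ t, L t i - L t j + 1 = (a i - a j + 1) + t * d := fun t => by
      simp only [hL, hd]; ring
    simp only [hlin]
    by_cases hd0 : d = 0
    · simp only [hd0, mul_zero, add_zero]
      convert Set.countable_empty
      ext t
      simpa using ha i j hij
    · have := (countable_zeros_prodTheta hq0 hq1 hx).preimage_of_injOn
        (f := fun t => (a i - a j + 1) + t * d) (fun s _ t _ hst => by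
          have := add_left_cancel hst
          exact mul_right_cancel₀ hd0 this)
      exact this.mono fun t ht => (bracket_eq_zero_iff hq0 hq1 hx _).mp ht
  have hpc := (hcount.isPathConnected_compl_of_one_lt_rank
    (by rw [Complex.rank_real_complex]; norm_num)).isConnected.isPreconnected
  rw [compl_compl] at hpc
  refine ⟨L '' {t | L t ∈ exchangeDomain q x N}, ?_, ⟨0, ?_, ?_⟩, ⟨1, ?_, ?_⟩,
    hpc.image L (by fun_prop)⟩
  · rintro _ ⟨t, ht, rfl⟩
    exact ht
  · simpa [hL] using ha
  · simp [hL]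
  · simpa [hL] using hb
  · simp [hL]

/-- On the torus `|q^{2(u_i - u_j + 1)}| = |q|²`, and `1` is not an integral multiple of a period `x
≥ 2`. -/
theorem torusPoint_mem_exchangeDomain {q : ℂ} (hq0 : q ≠ 0) (hq1 : ‖q‖ < 1) {x : ℝ} (hx : 2 ≤ x)
    {N : ℕ} (θ : Fin N → ℝ) : torusPoint q θ ∈ exchangeDomain q x N := by
  intro i j _
  refine bracket_ne_zero_of_norm hq0 hq1 (by linarith) (s := 1) ?_ fun m hm => ?_
  · rw [mul_add, qpow_add, norm_mul, norm_qpow_torusPoint_sub, one_mul]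
    simpa using norm_qpow_real hq0 2
  · have h1 : (0 : ℝ) < m := by
      by_contra hc
      nlinarith
    have h2 : (1 : ℝ) ≤ m := by exact_mod_cast h1
    nlinarith

/-- The exchange domain contains points of every region `|z_1| ≫ ⋯ ≫ |z_N|`. -/
theorem exists_mem_exchangeDomain {q : ℂ} (hq0 : q ≠ 0) (hq1 : ‖q‖ < 1) {x : ℝ} (hx : 2 ≤ x)
    (N : ℕ) {ε : ℝ} (hε : 0 < ε) : ∃ u ∈ exchangeDomain q x N, ∀ i j, i < j →
      ‖qpow q (2 * u j)‖ < ε * ‖qpow q (2 * u i)‖ := by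
  have hx0 : 0 < x := by linarith
  have hqpos : 0 < ‖q‖ := norm_pos_iff.mpr hq0
  obtain ⟨M, hM⟩ : ∃ M : ℕ, (‖q‖ ^ (2 * x)) ^ M < ε :=
    exists_pow_lt_of_lt_one hε (Real.rpow_lt_one hqpos.le hq1 (by linarith))
  -- Real points that are multiples of the period: differences plus `1` are never multiples of `x ≥
  -- 2`, and each step multiplies the modulus of `z` by `|q|^{2xM} < ε`.
  refine ⟨fun i => ((i : ℕ) * (M * x : ℝ) : ℝ), fun i j _ => ?_, fun i j hij => ?_⟩
  · refine bracket_ne_zero_of_norm hq0 hq1 hx0 (s := (i : ℕ) * (M * x) - (j : ℕ) * (M * x) + 1)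
      ?_ fun m hm => ?_
    · rw [← norm_qpow_real hq0]
      congr 2
      push_cast
      ring
    · have h1 : ((m - ((i : ℕ) - (j : ℕ)) * M : ℤ) : ℝ) * x = 1 := by
        push_cast
        linarith
      set n : ℤ := m - ((i : ℕ) - (j : ℕ)) * M
      have h2 : (0 : ℝ) < n := by
        by_contra hc
        nlinarith
      have h3 : (1 : ℝ) ≤ n := by exact_mod_cast h2
      nlinarith
  · have hn : ∀ i : ℕ, ‖qpow q (2 * ((i * (M * x : ℝ) : ℝ) : ℂ))‖ = ((‖q‖ ^ (2 * x)) ^ M) ^ i := by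
      intro i
      rw [← pow_mul, ← Real.rpow_natCast, ← Real.rpow_mul hqpos.le, ← norm_qpow_real hq0]
      congr 2
      push_cast
      ring
    rw [hn, hn]
    set a := (‖q‖ ^ (2 * x)) ^ M with ha
    have ha0 : 0 < a := by positivity
    have ha1 : a ≤ 1 := pow_le_one₀ (by positivity)
      (Real.rpow_lt_one hqpos.le hq1 (by linarith)).le
    obtain ⟨d, hd⟩ : ∃ d, (j : ℕ) = (i : ℕ) + 1 + d := ⟨j - (i + 1), by
      have : (i : ℕ) < j := hij
      omega⟩
    rw [hd, pow_add, pow_add, pow_one]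
    have h1 : a ^ d ≤ 1 := pow_le_one₀ ha0.le ha1
    have h2 : 0 < a ^ (i : ℕ) := by positivity
    calc a ^ (i : ℕ) * a * a ^ d ≤ a ^ (i : ℕ) * a * 1 := by gcongr
      _ = a * a ^ (i : ℕ) := by ring
      _ < ε * a ^ (i : ℕ) := by gcongr

/-- The continuation of a matrix entry is unique. -/
theorem IsContinuedProduct.eqOn {q : ℂ} (hq0 : q ≠ 0) (hq1 : ‖q‖ < 1) {A : ℂ → Op} {x : ℝ}
    (hx : 2 ≤ x) {N : ℕ} {p : Momentum} {e f : Basis} {G H : (Fin N → ℂ) → ℂ}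
    (hG : IsContinuedProduct q A x N p e f G) (hH : IsContinuedProduct q A x N p e f H) :
    Set.EqOn G H (exchangeDomain q x N) := by
  obtain ⟨hGa, ε, hε, hG⟩ := hG
  obtain ⟨hHa, ε', hε', hH⟩ := hH
  obtain ⟨u, hu, hfar⟩ := exists_mem_exchangeDomain hq0 hq1 hx N (lt_min hε hε')
  have hx0 : 0 < x := by linarith
  refine hGa.eqOn_of_preconnected_of_eventuallyEq hHa
    (isPreconnected_exchangeDomain hq0 hq1 hx0 N) hu ?_
  have hev : ∀ᶠ v in nhds u, ∀ i j, i < j →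
      ‖qpow q (2 * v j)‖ < min ε ε' * ‖qpow q (2 * v i)‖ := by
    refine Filter.eventually_all.mpr fun i => Filter.eventually_all.mpr fun j =>
      Filter.eventually_all.mpr fun hij => ?_
    have hc := fun i : Fin N => ((differentiable_qpow q).continuous.comp
      (continuous_const.mul (continuous_apply i) :
        Continuous fun v : Fin N → ℂ => 2 * v i)).norm
    exact (hc j).continuousAt.eventually_lt ((hc i).const_mul _).continuousAt (hfar i j hij)
  filter_upwards [hev, (isOpen_exchangeDomain hq0 hq1 hx0 N).mem_nhds hu] with v hv hvd
  rw [← (hG v hvd fun i j hij => ?_).2, ← (hH v hvd fun i j hij => ?_).2]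
  · rw [cpow_eq_qpow hq0, cpow_eq_qpow hq0]
    exact (hv i j hij).le.trans (mul_le_mul_of_nonneg_right (min_le_right _ _) (norm_nonneg _))
  · rw [cpow_eq_qpow hq0, cpow_eq_qpow hq0]
    exact (hv i j hij).le.trans (mul_le_mul_of_nonneg_right (min_le_left _ _) (norm_nonneg _))

namespace CurrentData

variable {ι : Type} [Fintype ι] {D : CurrentData ι} {q : ℂ} {k r : ℕ}

theorem productEntry_cast {M N : ℕ} (hMN : M = N) (p : Momentum) (e f : Basis) (u : Fin N → ℂ) :
    D.productEntry q k r M p e f (u ∘ Fin.cast hMN) = D.productEntry q k r N p e f u := by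
  subst hMN
  rfl

variable {A : ℂ → Op} {R₀ : ℝ} (h : D.Represents q k r A R₀)
include h

theorem Represents.prod_ofFn_shift {N : ℕ} (u : Fin N → ℂ) :
    (Op.prod (List.ofFn fun i => A (u i))).shift = N • D.shift k := by
  induction N with
  | zero => simp [Op.prod, Op.id]
  | succ N ih =>
    rw [List.ofFn_succ, Op.prod, Op.comp, ih fun i => u i.succ, h.shift_eq, succ_nsmul']

/-- Currents are attached one at a time on the left. The factor `2` in the hypothesis gives the
contractions a disc of radius `2 > 1` in the variable that counts the degree. -/
theorem Represents.prod_ofFn {N : ℕ} (u : Fin N → ℂ)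
    (hu : ∀ i j, i < j → ‖qpow q (2 * (u j - u i))‖ * 2 ≤ R₀) (p : Momentum) :
    Op.ProdComposable (List.ofFn fun i => A (u i)) p ∧ ∀ e f,
      (Op.prod (List.ofFn fun i => A (u i))).entry p e f = D.productEntry q k r N p e f u := by
  induction N with
  | zero =>
    refine ⟨by simp [Op.ProdComposable], fun e f => ?_⟩
    rw [productEntry_zero, List.ofFn_zero]
    rfl
  | succ N ih =>
    obtain ⟨ih1, ih2⟩ := ih (fun i => u i.succ) fun i j hij => hu _ _ (Fin.succ_lt_succ_iff.mpr hij)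
    have hterm : ∀ e f d, Op.compTerm (A (u 0)) (Op.prod (List.ofFn fun i : Fin N => A (u i.succ)))
        p e f d = ∑ g ∈ level d,
          D.productEntry q k r 1 (p + N • D.shift k) e g (fun _ => u 0) *
            D.productEntry q k r N p g f (fun i => u i.succ) := fun e f d => by
      refine Finset.sum_congr rfl fun g _ => ?_
      rw [h.prod_ofFn_shift, ih2, h.entry_eq_productEntry]
    have happ : Fin.append (fun _ : Fin 1 => u 0) (fun i => u i.succ) =
        u ∘ Fin.cast (Nat.add_comm 1 N) := by
      rw [Fin.append_left_eq_cons]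
      congr 1
      exact Fin.cons_self_tail u
    have hs : ∀ e f, HasSum (Op.compTerm (A (u 0))
        (Op.prod (List.ofFn fun i : Fin N => A (u i.succ))) p e f)
        (D.productEntry q k r (N + 1) p e f u) := fun e f => by
      refine hasSum_of_eq (h.hasSum_productEntry (fun _ : Fin 1 => u 0) (fun i => u i.succ)
        one_lt_two (fun i j => hu _ _ (Fin.succ_pos j)) p e f).1 (hterm e f) ?_
      rw [happ, productEntry_cast]
    rw [List.ofFn_succ]
    exact ⟨⟨ih1, fun e f => (hs e f).summable⟩, fun e f => (hs e f).tsum_eq⟩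

theorem Represents.isContinuedProduct (hq0 : q ≠ 0) (hR₀ : 0 < R₀) {x : ℂ}
    (hfac : ∀ u v, bracket q x (u - v + 1) ≠ 0 → bracket q x (v - u + 1) ≠ 0 →
      AnalyticAt ℂ D.fac (qpow q (2 * (v - u)))) (N : ℕ) (p : Momentum) (e f : Basis) :
    IsContinuedProduct q A x N p e f (D.productEntry q k r N p e f) := by
  refine ⟨fun u hu => analyticAt_productEntry q k r (fun i => analyticAt_apply i _)
    (fun i j hij => hfac _ _ (hu i j hij) (hu j i hij.symm)) p e f, R₀ / 2, by positivity,
    fun u _ hfar => ?_⟩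
  have := h.prod_ofFn u (fun i j hij => ?_) p
  · exact ⟨this.1, this.2 e f⟩
  · have h1 := hfar i j hij
    rw [cpow_eq_qpow hq0, cpow_eq_qpow hq0] at h1
    rw [mul_sub, qpow_sub, norm_div, ← le_div_iff₀ two_pos, div_le_iff₀ (by simp)]
    exact h1

/-- Every continuation agrees with `productEntry` on the torus by uniqueness, so each integral has
exactly one value. The radius may be less than one here, since holomorphy on the torus comes from
the exchange domain. -/
theorem Represents.contourNilpotentOn (hq0 : q ≠ 0) (hq1 : ‖q‖ < 1) (hR₀ : 0 < R₀) {x : ℝ}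
    (hx : 2 ≤ x) (hfac : ∀ u v, bracket q x (u - v + 1) ≠ 0 → bracket q x (v - u + 1) ≠ 0 →
      AnalyticAt ℂ D.fac (qpow q (2 * (v - u)))) {w : Momentum → ℂ → ℂ}
    (hw : ∀ p, Continuous fun θ => w p (circlePoint q θ)) {N : ℕ} {p : Momentum}
    (hzero : ∀ e f, torusIntegral N (D.torusEntry q k r w N p e f) = 0) :
    ContourNilpotentOn q A w x N p := by
  have hcp := h.isContinuedProduct hq0 hR₀ hfac
  have hcircle : ∀ α β : ℝ, AnalyticAt ℂ D.fac
      (qpow q (2 * (circlePoint q α - circlePoint q β))) := fun α β => by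
    have hmem := torusPoint_mem_exchangeDomain hq0 hq1 hx ![α, β]
    exact hfac _ _ (hmem 1 0 (by decide)) (hmem 0 1 (by decide))
  have hcont := fun e f => CurrentData.continuous_torusEntry (k := k) (r := r) hcircle hw N p e f
  have hone : ∀ e f G, IsContinuedProduct q A x N p e f G →
      ∀ θ, G (torusPoint q θ) * weightProduct (A 0).shift w N p (torusPoint q θ) =
        D.torusEntry q k r w N p e f θ := fun e f G hG θ => by
    rw [hG.eqOn hq0 hq1 hx (hcp N p e f) (torusPoint_mem_exchangeDomain hq0 hq1 hx θ),
      h.shift_eq, torusEntry]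
  refine ⟨fun e f c => ⟨?_, ?_⟩, fun a b hab e f c => ⟨?_, ?_⟩⟩
  · rintro ⟨G, hG, rfl⟩
    rw [torusIntegral_congr (hone e f G hG), hzero]
  · rintro rfl
    exact ⟨_, hcp N p e f, by rw [torusIntegral_congr (hone e f _ (hcp N p e f)), hzero]⟩
  all_goals
    subst hab
    have htwo : ∀ G, IsContinuedProduct q A x (a + b) p e f G →
        (torusIntegral a fun α => torusIntegral b fun β =>
          G (Fin.append (torusPoint q α) (torusPoint q β)) *
            (weightProduct (A 0).shift w a (p + b • (A 0).shift) (torusPoint q α) *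
              weightProduct (A 0).shift w b p (torusPoint q β))) = 0 := fun G hG => by
      refine Eq.trans ?_ (hzero e f)
      rw [← torusIntegral_append (hcont e f)]
      refine torusIntegral_congr fun α => torusIntegral_congr fun β => ?_
      rw [← hone e f G hG, torusPoint_append, weightProduct_append]
  · rintro ⟨G, hG, rfl⟩
    exact htwo G hG
  · rintro rfl
    exact ⟨_, hcp (a + b) p e f, (htwo _ (hcp (a + b) p e f)).symm⟩

end CurrentData

end ThetaScreening

namespace ThetaScreening

open Complex

/-! ## Vanishing of the multiple integrals -/

theorem antisymSum_one {N : ℕ} (u : Fin N → ℂ) (hN : 2 ≤ N) :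
    antisymSum (fun _ => 1) (fun (_ : Fin N) _ => 1) u = 0 :=
  antisymSum_eq_zero_of_eq (fun _ => 1) (fun _ _ => 1) (fun _ => 0)
    (a := ⟨0, by omega⟩) (b := ⟨1, by omega⟩) (by simp [Fin.ext_iff]) rfl

theorem poch_ne_zero_of_prodTheta {q x : ℂ} {δ : ℤ} (u v : ℂ) (h : prodTheta q x (v - u + δ) ≠ 0) :
    poch (qpow q (2 * x)) (qpow q (2 * (v - u + δ))) ≠ 0 := fun hz => h (by
  rw [prodTheta, hz, mul_zero, zero_mul])

namespace CurrentData

variable {ι : Type} (D : CurrentData ι) (q : ℂ) (k r : ℕ)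

theorem fieldSum_comp_perm {N : ℕ} (ε : Fin N → ι) (u : Fin N → ℂ) (σ : Equiv.Perm (Fin N)) :
    D.fieldSum q (ε ∘ σ) (u ∘ σ) = D.fieldSum q ε u :=
  Equiv.sum_comp σ fun i => D.field q (ε i) (u i)

section

variable [Fintype ι]

/-- A matrix entry of a product of currents, divided by symmetric or exchanged factors. -/
def reducedEntry (Ξ : ι → ι → ℂ → ℂ → ℂ) (N : ℕ) (p : Momentum) (e f : Basis)
    (u : Fin N → ℂ) : ℂ :=
  ∑ ε : Fin N → ι, (∏ i, D.coef (ε i)) *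
    (∏ i, ∏ j ∈ Finset.Ioi i, Ξ (ε i) (ε j) (u i) (u j)) *
      (normalExp q k r (D.fieldSum q ε u)).entry p e f

/-- The sum over all choices of terms absorbs the simultaneous permutation of terms and variables;
the normal ordered field is unchanged, and the antisymmetric pair factors produce the sign. -/
theorem reducedEntry_comp_perm {Ξ : ι → ι → ℂ → ℂ → ℂ}
    (hΞ : ∀ ε ε' u v, Ξ ε ε' u v = -Ξ ε' ε v u) {N : ℕ} (p : Momentum) (e f : Basis)
    (u : Fin N → ℂ) (σ : Equiv.Perm (Fin N)) :
    D.reducedEntry q k r Ξ N p e f (u ∘ σ) =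
      ((Equiv.Perm.sign σ : ℤ) : ℂ) * D.reducedEntry q k r Ξ N p e f u := by
  unfold reducedEntry
  rw [← (Equiv.arrowCongr σ.symm (Equiv.refl ι)).sum_comp, Finset.mul_sum]
  refine Finset.sum_congr rfl fun ε _ => ?_
  have he : Equiv.arrowCongr σ.symm (Equiv.refl ι) ε = ε ∘ σ := rfl
  rw [he, fieldSum_comp_perm]
  have h1 := Equiv.Perm.prod_Ioi_comp_eq_sign_mul_prod σ
    (f := fun i j => Ξ (ε i) (ε j) (u i) (u j)) fun i j => hΞ _ _ _ _
  simp only [Function.comp_apply]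
  rw [h1, Equiv.prod_comp σ fun i => D.coef (ε i)]
  ring

variable {D q k r}

theorem productEntry_eq_reducedEntry {Ξ : ι → ι → ℂ → ℂ → ℂ} {T : ℂ → ℂ}
    (hT : ∀ ε ε' (α β : ℝ), D.pairFactor q ε ε' (circlePoint q α) (circlePoint q β) =
      T (circlePoint q α - circlePoint q β) * Ξ ε ε' (circlePoint q α) (circlePoint q β))
    {N : ℕ} (p : Momentum) (e f : Basis) (θ : Fin N → ℝ) :
    D.productEntry q k r N p e f (torusPoint q θ) =
      (∏ i, ∏ j ∈ Finset.Ioi i, T (torusPoint q θ i - torusPoint q θ j)) *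
        D.reducedEntry q k r Ξ N p e f (torusPoint q θ) := by
  rw [productEntry, reducedEntry, Finset.mul_sum]
  refine Finset.sum_congr rfl fun ε _ => ?_
  have h1 : D.tupleCoef q ε (torusPoint q θ) = (∏ i, D.coef (ε i)) *
      ((∏ i, ∏ j ∈ Finset.Ioi i, T (torusPoint q θ i - torusPoint q θ j)) *
        ∏ i, ∏ j ∈ Finset.Ioi i, Ξ (ε i) (ε j) (torusPoint q θ i) (torusPoint q θ j)) := by
    rw [tupleCoef]
    simp only [torusPoint, hT, Finset.prod_mul_distrib]
  rw [h1]
  ring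

/-- Averaging over permutations: `N!` times the integral is the integral of the sum over `σ`. The
antisymmetric entry and the symmetric denominators are common factors, and what remains is
`antisymSum`. -/
theorem torusIntegral_torusEntry_eq_zero
    (hfac : ∀ α β : ℝ, AnalyticAt ℂ D.fac (qpow q (2 * (circlePoint q α - circlePoint q β))))
    {w : Momentum → ℂ → ℂ} (hw : ∀ p, Continuous fun θ => w p (circlePoint q θ))
    {Ξ : ι → ι → ℂ → ℂ → ℂ} {T : ℂ → ℂ} (hΞ : ∀ ε ε' u v, Ξ ε ε' u v = -Ξ ε' ε v u)
    (hT : ∀ ε ε' (α β : ℝ), D.pairFactor q ε ε' (circlePoint q α) (circlePoint q β) =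
      T (circlePoint q α - circlePoint q β) * Ξ ε ε' (circlePoint q α) (circlePoint q β))
    {N : ℕ} {p : Momentum} {W : Fin N → ℂ → ℂ} {den : ℂ → ℂ}
    (hweight : ∀ (j : Fin N) u, w (p + (N - 1 - (j : ℕ)) • D.shift k) u = W j u * den u)
    (hanti : ∀ u, antisymSum T W u = 0) (e f : Basis) :
    torusIntegral N (D.torusEntry q k r w N p e f) = 0 := by
  have hcont := continuous_torusEntry (k := k) (r := r) hfac hw N p e f
  have hperm : ∀ (σ : Equiv.Perm (Fin N)) θ, D.torusEntry q k r w N p e f (θ ∘ σ) =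
      D.reducedEntry q k r Ξ N p e f (torusPoint q θ) * (∏ j, den (torusPoint q θ j)) *
        (((Equiv.Perm.sign σ : ℤ) : ℂ) * permTerm T W (torusPoint q θ) σ) := fun σ θ => by
    have h1 : torusPoint q (θ ∘ σ) = torusPoint q θ ∘ σ := rfl
    rw [torusEntry, productEntry_eq_reducedEntry hT, weightProduct, h1,
      reducedEntry_comp_perm D q k r hΞ]
    simp only [hweight, Finset.prod_mul_distrib, permTerm, Function.comp_apply]
    rw [Equiv.prod_comp σ fun j => den (torusPoint q θ j)]
    ring
  have hsum : torusIntegral N (fun θ => ∑ σ : Equiv.Perm (Fin N),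
      D.torusEntry q k r w N p e f (θ ∘ σ)) =
      (N.factorial : ℂ) * torusIntegral N (D.torusEntry q k r w N p e f) := by
    rw [torusIntegral_sum (F := fun (σ : Equiv.Perm (Fin N)) θ =>
      D.torusEntry q k r w N p e f (θ ∘ σ)) _ fun σ _ =>
      hcont.comp (continuous_pi fun i => continuous_apply (σ i))]
    simp only [torusIntegral_comp_perm, Finset.sum_const, Finset.card_univ, Fintype.card_perm,
      Fintype.card_fin, nsmul_eq_mul]
  have hzero : torusIntegral N (fun θ => ∑ σ : Equiv.Perm (Fin N),
      D.torusEntry q k r w N p e f (θ ∘ σ)) = 0 := by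
    have : ∀ θ, ∑ σ : Equiv.Perm (Fin N), D.torusEntry q k r w N p e f (θ ∘ σ) = 0 * 0 :=
      fun θ => by
        simp only [hperm]
        rw [← Finset.mul_sum]
        have := hanti (torusPoint q θ)
        rw [antisymSum] at this
        rw [this, mul_zero, mul_zero]
    rw [torusIntegral_congr this, torusIntegral_mul_left, zero_mul]
  rw [hsum] at hzero
  exact (mul_eq_zero.mp hzero).resolve_left (by exact_mod_cast N.factorial_ne_zero)

end

variable {D q}

/-- The contractions of the currents with exchange relations governed by a theta function. -/
structure IsThetaType (D : CurrentData ι) (q : ℂ) (x : ℝ) (δ : ℤ) : Prop where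
  unit : IsUnit δ
  lam_eq : D.lam = 4 * δ / x * log q
  fac_eq : ∀ y, D.fac y = poch (qpow q (2 * x)) (qpow q (2 * x - 2 * δ) * y) /
    poch (qpow q (2 * x)) (qpow q (2 * δ) * y)

/-- The quotient of the contraction by a theta function. -/
def thetaQuotient (D : CurrentData ι) (q : ℂ) (x : ℝ) (δ : ℤ) (ε ε' : ι) (u v : ℂ) : ℂ :=
  (D.zero ε * qpow q (u - v) - D.zero ε' * qpow q (v - u)) *
    qpow q (2 * δ / x * (u + v) - ((u - v) ^ 2 + 1) / x + δ) /
    (poch (qpow q (2 * x)) (qpow q (2 * (v - u + δ))) *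
      poch (qpow q (2 * x)) (qpow q (2 * (u - v + δ))))

theorem thetaQuotient_neg (x : ℝ) (δ : ℤ) (ε ε' : ι) (u v : ℂ) :
    D.thetaQuotient q x δ ε ε' u v = -D.thetaQuotient q x δ ε' ε v u := by
  unfold thetaQuotient
  rw [add_comm v u, show (v - u) ^ 2 = (u - v) ^ 2 by ring,
    mul_comm (poch _ (qpow q (2 * (v - u + δ))))]
  ring

variable {x : ℝ} {δ : ℤ} (ht : D.IsThetaType q x δ)
include ht

/-- The numerator product of `fac` is one of the two products in `prodTheta`. The other one joins
the denominator and makes it symmetric. The value of `lam` and `δ² = 1` make the remaining exponent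
of `q` symmetric as well, so only `z q^{u-v} - z' q^{v-u}` carries the sign. -/
theorem IsThetaType.pairFactor_eq (hx : x ≠ 0) (ε ε' : ι) (u v : ℂ)
    (h : prodTheta q x (u - v + δ) ≠ 0) : D.pairFactor q ε ε' u v =
      prodTheta q x (u - v + δ) * D.thetaQuotient q x δ ε ε' u v := by
  have hne := poch_ne_zero_of_prodTheta v u h
  have hxc : (x : ℂ) ≠ 0 := by exact_mod_cast hx
  have hδ : (δ : ℂ) ^ 2 = 1 := by
    rcases Int.isUnit_iff.mp ht.unit with h | h <;> simp [h]
  have e0 : exp (D.lam * u) = qpow q (4 * δ / x * u) := by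
    rw [ht.lam_eq, qpow]; ring_nf
  have e1 : qpow q (2 * x - 2 * δ) * qpow q (2 * (v - u)) = qpow q (2 * x - 2 * (u - v + δ)) := by
    rw [← qpow_add]; ring_nf
  have e2 : qpow q (2 * δ) * qpow q (2 * (v - u)) = qpow q (2 * (v - u + δ)) := by
    rw [← qpow_add]; ring_nf
  have e3 : qpow q ((u - v + δ) ^ 2 / x - (u - v + δ)) *
      qpow q (2 * δ / x * (u + v) - ((u - v) ^ 2 + 1) / x + δ) * qpow q (u - v) =
        qpow q (4 * δ / x * u) := by
    rw [← qpow_add, ← qpow_add]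
    congr 1
    field_simp
    linear_combination hδ
  have e4 : qpow q (v - u) = qpow q (2 * (v - u)) * qpow q (u - v) := by
    rw [← qpow_add]; ring_nf
  rw [pairFactor, thetaQuotient, ht.fac_eq, e0, e1, e2, ← e3, e4, prodTheta]
  -- At a pole both sides are `0` by the convention for division by zero.
  by_cases hz : poch (qpow q (2 * x)) (qpow q (2 * (v - u + δ))) = 0
  · simp [hz]
  · field_simp

theorem IsThetaType.analyticAt_fac (hq0 : q ≠ 0) (hq1 : ‖q‖ < 1) (hx : 0 < x) {y : ℂ}
    (hy : poch (qpow q (2 * x)) (qpow q (2 * δ) * y) ≠ 0) : AnalyticAt ℂ D.fac y := by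
  have hp := differentiable_poch (norm_nome_lt_one hq0 hq1 hx)
  have e : D.fac = fun y => poch (qpow q (2 * x)) (qpow q (2 * x - 2 * δ) * y) /
    poch (qpow q (2 * x)) (qpow q (2 * δ) * y) := funext ht.fac_eq
  rw [e]
  exact ((hp.comp (differentiable_id.const_mul _)).analyticAt y).div
    ((hp.comp (differentiable_id.const_mul _)).analyticAt y) hy

/-- The denominator of `fac` divides `[v - u + δ]_x`, and by oddness the two signs of `δ` correspond
to the two removed brackets. -/
theorem IsThetaType.analyticAt_fac_exchange (hq0 : q ≠ 0) (hq1 : ‖q‖ < 1) (hx : 0 < x)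
    (u v : ℂ) (huv : bracket q x (u - v + 1) ≠ 0) (hvu : bracket q x (v - u + 1) ≠ 0) :
    AnalyticAt ℂ D.fac (qpow q (2 * (v - u))) := by
  rw [Ne, bracket_eq_zero_iff hq0 hq1 hx] at huv hvu
  refine ht.analyticAt_fac hq0 hq1 hx ?_
  rw [← qpow_add, show 2 * (δ : ℂ) + 2 * (v - u) = 2 * (v - u + δ) by ring]
  refine poch_ne_zero_of_prodTheta u v ?_
  rcases Int.isUnit_iff.mp ht.unit with h | h
  · simpa [h] using hvu
  · rw [h, show v - u + ((-1 : ℤ) : ℂ) = -(u - v + 1) by push_cast; ring, prodTheta_neg hq0 hq1 hx]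
    exact neg_ne_zero.mpr huv

end CurrentData

/-! ### Screening operators of theta type -/

section

variable {q : ℂ} (hq0 : q ≠ 0) (hq1 : ‖q‖ < 1) {N : ℕ} (hN : 2 ≤ N)
include hq0 hq1 hN

theorem prodTheta_circlePoint_ne_zero {δ : ℤ} (hδ : IsUnit δ) (α β : ℝ) :
    prodTheta q (N : ℝ) (circlePoint q α - circlePoint q β + δ) ≠ 0 := by
  have hN' : (2 : ℝ) ≤ N := by exact_mod_cast hN
  have hx : (0 : ℝ) < N := by linarith
  have h1 := torusPoint_mem_exchangeDomain hq0 hq1 hN' ![α, β]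
  have h2 := h1 0 1 (by decide)
  have h3 := h1 1 0 (by decide)
  rw [Ne, bracket_eq_zero_iff hq0 hq1 hx] at h2 h3
  rcases Int.isUnit_iff.mp hδ with h | h
  · simpa [h, torusPoint] using h2
  · rw [h, show circlePoint q α - circlePoint q β + ((-1 : ℤ) : ℂ) =
      -(circlePoint q β - circlePoint q α + 1) by push_cast; ring, prodTheta_neg hq0 hq1 hx]
    exact neg_ne_zero.mpr (by simpa [torusPoint] using h3)

theorem continuous_bracket_weight {b : ℝ} (hb : ∀ i : ℤ, b ≠ i * (N : ℝ)) (a : ℂ) :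
    Continuous fun θ => bracket q (N : ℝ) (circlePoint q θ + a) /
      bracket q (N : ℝ) (circlePoint q θ + b) := by
  have hx : (0 : ℝ) < N := by exact_mod_cast (by omega : 0 < N)
  have hc := (isTheta_bracket hq0 hq1 hx).diff.continuous
  refine (hc.comp ((continuous_circlePoint q).add continuous_const)).div
    (hc.comp ((continuous_circlePoint q).add continuous_const)) fun θ =>
    bracket_ne_zero_of_norm hq0 hq1 hx (s := b) ?_ hb
  rw [mul_add, qpow_add, norm_mul, norm_qpow_circlePoint, one_mul, ← norm_qpow_real hq0]
  congr 2
  push_cast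
  ring

/-- The hypothesis `ha` produces the progression: the `j`-th weight acts after `N - 1 - j` currents,
so its numerator is shifted by `a p - 2δ (N - 1) + 2δ j`. The denominators are the same for all `j`.
-/
theorem CurrentData.IsThetaType.torusIntegral_eq_zero {ι : Type} [Fintype ι] {D : CurrentData ι}
    {k r : ℕ} {δ : ℤ} (ht : D.IsThetaType q (N : ℝ) δ) {w : Momentum → ℂ → ℂ}
    {a : Momentum → ℂ} {b : ℝ} (hb : ∀ i : ℤ, b ≠ i * (N : ℝ))
    (hw : ∀ p u, w p u = bracket q (N : ℝ) (u + a p) / bracket q (N : ℝ) (u + b))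
    (ha : ∀ p (n : ℕ), a (p + n • D.shift k) = a p - 2 * δ * n) (p : Momentum) (e f : Basis) :
    torusIntegral N (D.torusEntry q k r w N p e f) = 0 := by
  have hN' : (2 : ℝ) ≤ N := by exact_mod_cast hN
  have hx : (0 : ℝ) < N := by linarith
  refine torusIntegral_torusEntry_eq_zero (fun α β => ?_)
    (fun p => by simpa only [hw] using continuous_bracket_weight hq0 hq1 hN hb (a p))
    (thetaQuotient_neg (q := q) (N : ℝ) δ)
    (fun ε ε' α β => ht.pairFactor_eq hx.ne' ε ε' _ _
      (prodTheta_circlePoint_ne_zero hq0 hq1 hN ht.unit α β))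
    (W := fun j u => bracket q (N : ℝ) (u + (a p - 2 * δ * (N - 1) + 2 * δ * (j : ℕ))))
    (den := fun u => (bracket q (N : ℝ) (u + b))⁻¹) (fun j u => ?_) (fun u =>
      antisymSum_eq_zero hq0 hq1 hN ht.unit (c := a p - 2 * δ * (N - 1)) (fun j => ?_) u) e f
  · have hmem := torusPoint_mem_exchangeDomain hq0 hq1 hN' ![α, β]
    exact ht.analyticAt_fac_exchange hq0 hq1 hx _ _ (hmem 1 0 (by decide))
      (hmem 0 1 (by decide))
  · rw [hw, ha, div_eq_mul_inv, Nat.cast_sub (by omega), Nat.cast_sub (by omega)]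
    congr 3
    push_cast
    ring
  · simpa using (isTheta_bracket hq0 hq1 hx).comp_add (a p - 2 * δ * (N - 1) + 2 * δ * (j : ℕ))

end

end ThetaScreening

namespace ThetaScreening

open Complex

/-! ## Geometrically bounded sequences -/

/-- Sequences bounded by a geometric one. -/
def GeomBdd (f : ℕ → ℂ) : Prop := ∃ C K : ℝ, 0 ≤ C ∧ 0 ≤ K ∧ ∀ n, ‖f n‖ ≤ C * K ^ n

namespace GeomBdd

variable {f g : ℕ → ℂ}

theorem const (c : ℂ) : GeomBdd fun _ => c := ⟨‖c‖, 1, norm_nonneg _, zero_le_one, by simp⟩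

theorem mul (hf : GeomBdd f) (hg : GeomBdd g) : GeomBdd fun n => f n * g n := by
  obtain ⟨C, K, hC, hK, hf⟩ := hf
  obtain ⟨C', K', hC', hK', hg⟩ := hg
  refine ⟨C * C', K * K', by positivity, by positivity, fun n => ?_⟩
  rw [norm_mul, mul_pow]
  calc _ ≤ (C * K ^ n) * (C' * K' ^ n) := mul_le_mul (hf n) (hg n) (norm_nonneg _) (by positivity)
    _ = _ := by ring

theorem neg (hf : GeomBdd f) : GeomBdd fun n => -f n := by
  obtain ⟨C, K, hC, hK, hf⟩ := hf
  exact ⟨C, K, hC, hK, fun n => by rw [norm_neg]; exact hf n⟩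

theorem add (hf : GeomBdd f) (hg : GeomBdd g) : GeomBdd fun n => f n + g n := by
  obtain ⟨C, K, hC, hK, hf⟩ := hf
  obtain ⟨C', K', hC', hK', hg⟩ := hg
  refine ⟨C + C', max K K', by positivity, by positivity, fun n => ?_⟩
  have h1 : K ^ n ≤ max K K' ^ n := by gcongr; exact le_max_left _ _
  have h2 : K' ^ n ≤ max K K' ^ n := by gcongr; exact le_max_right _ _
  calc _ ≤ ‖f n‖ + ‖g n‖ := norm_add_le _ _
    _ ≤ C * K ^ n + C' * K' ^ n := add_le_add (hf n) (hg n)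
    _ ≤ C * max K K' ^ n + C' * max K K' ^ n := by gcongr
    _ = _ := by ring

theorem sub (hf : GeomBdd f) (hg : GeomBdd g) : GeomBdd fun n => f n - g n := by
  simpa only [sub_eq_add_neg] using hf.add hg.neg

theorem qpow (q s : ℂ) : GeomBdd fun n : ℕ => ThetaScreening.qpow q (s * ((n : ℂ) + 1)) := by
  refine ⟨‖ThetaScreening.qpow q s‖, ‖ThetaScreening.qpow q s‖, norm_nonneg _, norm_nonneg _,
    fun n => ?_⟩
  have := qpow_mul_nat q s (n + 1)
  push_cast at this
  simp only [this]
  rw [norm_pow, pow_succ']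

theorem inv_nat : GeomBdd fun n : ℕ => ((n : ℂ) + 1)⁻¹ := by
  refine ⟨1, 1, zero_le_one, zero_le_one, fun n => ?_⟩
  rw [one_pow, mul_one, norm_inv]
  refine inv_le_one_of_one_le₀ ?_
  have : (n : ℂ) + 1 = ((n + 1 : ℕ) : ℂ) := by push_cast; rfl
  rw [this, Complex.norm_natCast]
  exact_mod_cast Nat.succ_pos n

theorem eventually_summable (hf : GeomBdd f) :
    ∀ᶠ y : ℂ in nhds 0, Summable fun n => f n * y ^ (n + 1) := by
  obtain ⟨C, K, hC, hK, hf⟩ := hf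
  have hc : Continuous fun y : ℂ => K * ‖y‖ := by fun_prop
  have hev : ∀ᶠ y : ℂ in nhds 0, K * ‖y‖ < 1 :=
    hc.continuousAt.eventually_lt continuousAt_const (by simp)
  filter_upwards [hev] with y hy
  refine Summable.of_norm_bounded
    ((summable_geometric_of_lt_one (by positivity) hy).mul_left (C * ‖y‖)) fun n => ?_
  rw [norm_mul, norm_pow]
  calc _ ≤ (C * K ^ n) * ‖y‖ ^ (n + 1) := by gcongr; exact hf n
    _ = _ := by rw [mul_pow]; ring

end GeomBdd

/-! ## `q`-numbers -/

theorem qnum_eq {q : ℂ} (hq0 : q ≠ 0) (s : ℂ) :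
    qnum q s = (qpow q s - (qpow q s)⁻¹) / (q - q⁻¹) := by
  rw [qnum, cpow_eq_qpow hq0, cpow_eq_qpow hq0, qpow_neg]

theorem qnum_neg (q s : ℂ) : qnum q (-s) = -qnum q s := by
  rw [qnum, qnum, neg_neg, ← neg_div, neg_sub]

theorem sub_inv_ne_zero {q : ℂ} (hq0 : q ≠ 0) (hq1 : ‖q‖ < 1) : q - q⁻¹ ≠ 0 := by
  intro h
  have h1 : q * q = 1 := by
    rw [sub_eq_zero] at h
    nth_rewrite 2 [h]
    exact mul_inv_cancel₀ hq0
  have h2 : ‖q‖ * ‖q‖ = 1 := by rw [← norm_mul, h1, norm_one]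
  nlinarith [norm_nonneg q]

theorem qpow_real_sub_inv_ne_zero {q : ℂ} (hq0 : q ≠ 0) (hq1 : ‖q‖ < 1) {s : ℝ} (hs : 0 < s) :
    qpow q s - (qpow q s)⁻¹ ≠ 0 :=
  sub_inv_ne_zero (qpow_ne_zero q s) (norm_qpow_lt_one hq0 hq1 hs)

theorem qnum_ne_zero {q : ℂ} (hq0 : q ≠ 0) (hq1 : ‖q‖ < 1) {s : ℝ} (hs : 0 < s) :
    qnum q s ≠ 0 := by
  rw [qnum_eq hq0]
  exact div_ne_zero (qpow_real_sub_inv_ne_zero hq0 hq1 hs) (sub_inv_ne_zero hq0 hq1)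

theorem GeomBdd.qnum {q : ℂ} (hq0 : q ≠ 0) (s : ℂ) :
    GeomBdd fun n : ℕ => ThetaScreening.qnum q (s * ((n : ℂ) + 1)) := by
  simp only [qnum_eq hq0, ← qpow_neg, div_eq_mul_inv, ← neg_mul]
  exact ((GeomBdd.qpow q s).sub (GeomBdd.qpow q (-s))).mul (GeomBdd.const _)

theorem GeomBdd.inv_qnum {q : ℂ} (hq0 : q ≠ 0) (hq1 : ‖q‖ < 1) {s : ℝ} (hs : 0 < s) :
    GeomBdd fun n : ℕ => (ThetaScreening.qnum q (s * ((n : ℂ) + 1)))⁻¹ := by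
  have h1 : GeomBdd fun n : ℕ =>
      ((ThetaScreening.qpow q (s * ((n : ℂ) + 1))) ^ 2 - 1)⁻¹ := by
    have hlt := norm_qpow_lt_one hq0 hq1 hs
    refine ⟨(1 - ‖ThetaScreening.qpow q s‖)⁻¹, 1, by
      have : 0 < 1 - ‖ThetaScreening.qpow q s‖ := by linarith
      positivity, zero_le_one, fun n => ?_⟩
    have hpow := qpow_mul_nat q s (n + 1)
    push_cast at hpow
    rw [one_pow, mul_one, norm_inv]
    refine inv_anti₀ (by linarith) ?_
    rw [hpow, norm_sub_rev]
    refine le_trans ?_ (norm_sub_norm_le _ _)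
    rw [norm_one, norm_pow, norm_pow, ← pow_mul]
    have : ‖ThetaScreening.qpow q s‖ ^ ((n + 1) * 2) ≤ ‖ThetaScreening.qpow q s‖ ^ 1 :=
      pow_le_pow_of_le_one (norm_nonneg _) hlt.le (by omega)
    rw [pow_one] at this
    linarith
  have h2 := ((GeomBdd.const (q - q⁻¹)).mul (GeomBdd.qpow q s)).mul h1
  convert h2 using 2 with n
  rw [qnum_eq hq0, inv_div]
  have := qpow_ne_zero q (s * ((n : ℂ) + 1))
  rw [show (ThetaScreening.qpow q (s * ((n : ℂ) + 1))) ^ 2 - 1 =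
    ThetaScreening.qpow q (s * ((n : ℂ) + 1)) * (ThetaScreening.qpow q (s * ((n : ℂ) + 1)) -
      (ThetaScreening.qpow q (s * ((n : ℂ) + 1)))⁻¹) by field_simp, mul_inv]
  field_simp

theorem geomBdd_oscComm {q : ℂ} (hq0 : q ≠ 0) (hq1 : ‖q‖ < 1) {k r : ℕ} (hkr : k < r)
    (j : Fin 3) : GeomBdd fun n => oscComm q k r j ((n : ℂ) + 1) := by
  have hrk : (0 : ℝ) < (r : ℝ) - k := by
    rw [sub_pos]
    exact_mod_cast hkr
  have hinv := GeomBdd.inv_qnum hq0 hq1 hrk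
  have hq := fun s => GeomBdd.qnum hq0 s
  simp only [oscComm, div_eq_mul_inv]
  push_cast at hinv
  fin_cases j
  · exact (((hq 2).mul (hq k)).mul GeomBdd.inv_nat).mul ((hq r).mul hinv)
  · exact ((hq 2).mul (hq _)).mul GeomBdd.inv_nat
  · exact (((hq 2).mul (hq k)).mul GeomBdd.inv_nat).neg

/-! ## Fields with homogeneous oscillator part -/

/-- The field depends on the point `u` as the bosons of the theorem do. -/
def Homogeneous (q : ℂ) (X : ℂ → BosonField) (slope : Fin 3 → ℂ) : Prop :=
  ∀ u j, X u j = ((X 0 j).1, (X 0 j).2.1 + slope j * u,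
    fun n => (X 0 j).2.2 n * qpow q (-(2 * u * n)))

/-- The oscillator coefficients of the field are geometrically bounded. -/
def OscBdd (X : BosonField) : Prop := ∀ j,
  (GeomBdd fun n : ℕ => (X j).2.2 ((n : ℤ) + 1)) ∧ GeomBdd fun n : ℕ => (X j).2.2 (-((n : ℤ) + 1))

theorem Homogeneous.add {q : ℂ} {X Y : ℂ → BosonField} {s t : Fin 3 → ℂ} (hX : Homogeneous q X s)
    (hY : Homogeneous q Y t) : Homogeneous q (fun u => X u + Y u) (s + t) := fun u j => by
  change X u j + Y u j = _
  rw [hX u j, hY u j]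
  refine Prod.ext rfl (Prod.ext ?_ (funext fun n => ?_))
  · simp only [Pi.add_apply, Prod.snd_add, Prod.fst_add]; ring
  · simp only [Pi.add_apply, Prod.snd_add]; ring

theorem Homogeneous.neg {q : ℂ} {X : ℂ → BosonField} {s : Fin 3 → ℂ} (hX : Homogeneous q X s) :
    Homogeneous q (fun u => -X u) (-s) := fun u j => by
  change -X u j = _
  rw [hX u j]
  refine Prod.ext rfl (Prod.ext ?_ (funext fun n => ?_))
  · simp only [Pi.neg_apply, Prod.snd_neg, Prod.fst_neg]; ring
  · simp only [Pi.neg_apply, Prod.snd_neg]; ring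

theorem Homogeneous.sub {q : ℂ} {X Y : ℂ → BosonField} {s t : Fin 3 → ℂ} (hX : Homogeneous q X s)
    (hY : Homogeneous q Y t) : Homogeneous q (fun u => X u - Y u) (s - t) := by
  simpa only [sub_eq_add_neg] using hX.add hY.neg

theorem Homogeneous.single {q : ℂ} (j₀ : Fin 3) {c d s : ℂ} {o : ℂ → ℤ → ℂ}
    (ho : ∀ u n, o u n = o 0 n * qpow q (-(2 * u * n))) :
    Homogeneous q (fun u => Pi.single j₀ (c, d + s * u, o u)) (Pi.single j₀ s) := fun u j => by
  by_cases h : j = j₀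
  · subst h
    simp only [Pi.single_eq_same, mul_zero, add_zero]
    exact Prod.ext rfl (Prod.ext rfl (funext fun n => ho u n))
  · simp only [Pi.single_eq_of_ne h]
    refine Prod.ext rfl (Prod.ext ?_ (funext fun n => ?_)) <;> simp

theorem OscBdd.add {X Y : BosonField} (hX : OscBdd X) (hY : OscBdd Y) : OscBdd (X + Y) :=
  fun j => ⟨(hX j).1.add (hY j).1, (hX j).2.add (hY j).2⟩

theorem OscBdd.neg {X : BosonField} (hX : OscBdd X) : OscBdd (-X) :=
  fun j => ⟨(hX j).1.neg, (hX j).2.neg⟩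

theorem OscBdd.sub {X Y : BosonField} (hX : OscBdd X) (hY : OscBdd Y) : OscBdd (X - Y) := by
  simpa only [sub_eq_add_neg] using hX.add hY.neg

section

variable {q : ℂ} (hq0 : q ≠ 0) (hq1 : ‖q‖ < 1)
include hq0

theorem oscCoeff_eq (A B C u D : ℂ) (m : ℤ) :
    oscCoeff q A B C u D m = oscCoeff q A B C 0 D m * qpow q (-(2 * u * m)) := by
  unfold oscCoeff
  simp only [cpow_eq_qpow hq0, mul_zero, zero_mul, neg_zero, qpow_zero, mul_one]
  split_ifs <;> ring

include hq1

theorem oscCoeff_pos (C D : ℂ) (n : ℕ) : oscCoeff q 1 1 C 0 D ((n : ℤ) + 1) =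
    qpow q (D * ((n : ℂ) + 1)) * (qnum q (C * ((n : ℂ) + 1)))⁻¹ := by
  have h1 : ((n : ℤ) + 1) ≠ 0 := by omega
  have h2 : qnum q ((n : ℂ) + 1) ≠ 0 := by
    have := qnum_ne_zero hq0 hq1 (s := (n : ℝ) + 1) (by positivity)
    simpa using this
  have h3 : |(n : ℤ) + 1| = (n : ℤ) + 1 := abs_of_pos (by omega)
  simp only [oscCoeff, h1, if_false, h3, cpow_eq_qpow hq0, mul_zero, zero_mul, neg_zero, qpow_zero,
    mul_one, one_mul]
  push_cast
  field_simp

theorem oscCoeff_neg (C D : ℂ) (n : ℕ) : oscCoeff q 1 1 C 0 D (-((n : ℤ) + 1)) =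
    -(qpow q (D * ((n : ℂ) + 1)) * (qnum q (C * ((n : ℂ) + 1)))⁻¹) := by
  have h1 : -((n : ℤ) + 1) ≠ 0 := by omega
  have h2 : qnum q ((n : ℂ) + 1) ≠ 0 := by
    have := qnum_ne_zero hq0 hq1 (s := (n : ℝ) + 1) (by positivity)
    simpa using this
  have h3 : |-((n : ℤ) + 1)| = (n : ℤ) + 1 := by rw [abs_neg]; exact abs_of_pos (by omega)
  simp only [oscCoeff, h1, if_false, h3, cpow_eq_qpow hq0, mul_zero, zero_mul, neg_zero, qpow_zero,
    mul_one, one_mul]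
  push_cast
  rw [mul_neg, qnum_neg, qnum_neg]
  field_simp

end

end ThetaScreening

namespace ThetaScreening

open Complex

/-! ## Currents built from homogeneous fields -/

namespace CurrentData

variable {ι : Type}

/-- The data of the current `∑ ε, coef ε :exp X_ε(u):`. -/
def ofFields (X : ι → ℂ → BosonField) (coef : ι → ℂ) (charge slope : Fin 3 → ℂ) (zero : ι → ℂ)
    (lam : ℂ) (fac : ℂ → ℂ) : CurrentData ι where
  coef := coef
  charge := charge
  momConst ε j := (X ε 0 j).2.1
  momSlope := slope
  osc ε j n := (X ε 0 j).2.2 n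
  zero := zero
  lam := lam
  fac := fac

variable {q : ℂ} {k r : ℕ} {X : ι → ℂ → BosonField} {coef : ι → ℂ} {charge slope : Fin 3 → ℂ}
  {zero : ι → ℂ} {lam : ℂ} {fac : ℂ → ℂ}

theorem ofFields_field (hX : ∀ ε, Homogeneous q (X ε) slope)
    (hc : ∀ ε j, (X ε 0 j).1 = charge j) (ε : ι) (u : ℂ) :
    (ofFields X coef charge slope zero lam fac).field q ε u = X ε u := by
  funext j
  rw [hX ε u j, field, hc]
  rfl

theorem eventually_hasSum_log (c : ℂ) : ∀ᶠ y : ℂ in nhds 0, ∃ L,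
    HasSum (fun n : ℕ => -(c ^ (n + 1) / ((n : ℂ) + 1)) * y ^ (n + 1)) L ∧ exp L = 1 - c * y := by
  have hc : Continuous fun y : ℂ => ‖c * y‖ := by fun_prop
  have hev : ∀ᶠ y : ℂ in nhds 0, ‖c * y‖ < 1 :=
    hc.continuousAt.eventually_lt continuousAt_const (by simp)
  filter_upwards [hev] with y hy
  have h1 := Complex.hasSum_taylorSeries_neg_log hy
  rw [← hasSum_nat_add_iff' 1] at h1
  refine ⟨log (1 - c * y), hasSum_of_eq h1.neg (fun n => ?_) (by simp), exp_log ?_⟩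
  · push_cast
    rw [mul_pow]
    ring
  · intro h0
    have : c * y = 1 := (sub_eq_zero.mp h0).symm
    rw [this, norm_one] at hy
    exact lt_irrefl _ hy

theorem eventually_hasSum_poch {p : ℂ} (hp : ‖p‖ < 1) (a b : ℂ) : ∀ᶠ y : ℂ in nhds 0, ∃ L,
    HasSum (fun n : ℕ => -((a ^ (n + 1) - b ^ (n + 1)) / (1 - p ^ (n + 1))) / ((n : ℂ) + 1) *
      y ^ (n + 1)) L ∧ exp L = poch p (a * y) / poch p (b * y) := by
  have hc : ∀ c : ℂ, Continuous fun y : ℂ => ‖c * y‖ := fun c => by fun_prop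
  have hev : ∀ c : ℂ, ∀ᶠ y : ℂ in nhds 0, ‖c * y‖ < 1 := fun c =>
    (hc c).continuousAt.eventually_lt continuousAt_const (by simp)
  filter_upwards [hev a, hev b] with y ha hb
  obtain ⟨L, hL, hLe⟩ := exists_hasSum_exp_eq_poch hp ha
  obtain ⟨L', hL', hLe'⟩ := exists_hasSum_exp_eq_poch hp hb
  refine ⟨L - L', hasSum_of_eq (hL.sub hL') (fun n => ?_) rfl, by rw [exp_sub, hLe, hLe']⟩
  rw [mul_pow, mul_pow]
  ring

variable [Finite ι]

/-- Geometric bounds on coefficients and commutators give absolute convergence for small `y`. Mode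
by mode the contraction splits into `t`, the logarithm of `fac`, and the logarithmic series of `1 -
(z'/z) y`. -/
theorem ofFields_small {t : ℕ → ℂ} (hosc : ∀ ε, OscBdd (X ε 0))
    (hcomm : ∀ j, GeomBdd fun n => oscComm q k r j ((n : ℂ) + 1))
    (hfac : ∀ᶠ y : ℂ in nhds 0, ∃ L, HasSum (fun n => t n * y ^ (n + 1)) L ∧ exp L = fac y)
    (hsum : ∀ ε ε' (n : ℕ), ∑ j, (X ε 0 j).2.2 ((n : ℤ) + 1) * oscComm q k r j ((n : ℂ) + 1) *
      (X ε' 0 j).2.2 (-((n : ℤ) + 1)) = t n - (zero ε' / zero ε) ^ (n + 1) / ((n : ℂ) + 1)) :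
    ∃ ρ : ℝ, 0 < ρ ∧ ∀ ε ε' (y : ℂ), ‖y‖ < ρ → ∃ L, HasSum (fun i : Osc =>
      (ofFields X coef charge slope zero lam fac).osc ε i.1 ((i.2 : ℤ) + 1) *
        oscComm q k r i.1 ((i.2 : ℂ) + 1) *
        (ofFields X coef charge slope zero lam fac).osc ε' i.1 (-((i.2 : ℤ) + 1)) *
          y ^ (i.2 + 1)) L ∧
      exp L = (ofFields X coef charge slope zero lam fac).contraction ε ε' y := by
  have hev : ∀ᶠ y : ℂ in nhds 0, ∀ ε ε', ∃ L, HasSum (fun i : Osc =>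
      (X ε 0 i.1).2.2 ((i.2 : ℤ) + 1) * oscComm q k r i.1 ((i.2 : ℂ) + 1) *
        (X ε' 0 i.1).2.2 (-((i.2 : ℤ) + 1)) * y ^ (i.2 + 1)) L ∧
      exp L = (1 - zero ε' / zero ε * y) * fac y := by
    refine Filter.eventually_all.mpr fun ε => Filter.eventually_all.mpr fun ε' => ?_
    have hb : ∀ j, GeomBdd fun n : ℕ => (X ε 0 j).2.2 ((n : ℤ) + 1) *
        oscComm q k r j ((n : ℂ) + 1) * (X ε' 0 j).2.2 (-((n : ℤ) + 1)) := fun j =>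
      ((hosc ε j).1.mul (hcomm j)).mul (hosc ε' j).2
    filter_upwards [hfac, eventually_hasSum_log (zero ε' / zero ε),
      Filter.eventually_all.mpr fun j => (hb j).eventually_summable] with y h1 h2 h3
    obtain ⟨L, hL, hLe⟩ := h1
    obtain ⟨L', hL', hLe'⟩ := h2
    refine ⟨L + L', ?_, by rw [exp_add, hLe, hLe', mul_comm]⟩
    have hsummable : Summable fun i : Osc => (X ε 0 i.1).2.2 ((i.2 : ℤ) + 1) *
        oscComm q k r i.1 ((i.2 : ℂ) + 1) * (X ε' 0 i.1).2.2 (-((i.2 : ℤ) + 1)) *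
          y ^ (i.2 + 1) := by
      rw [← summable_norm_iff, summable_prod_of_nonneg fun _ => norm_nonneg _]
      exact ⟨fun j => (h3 j).norm, Summable.of_finite⟩
    have h4 := hsummable.hasSum
    rw [hsummable.tsum_prod, tsum_fintype, ← Summable.tsum_finsetSum fun j _ => h3 j] at h4
    refine hasSum_of_eq h4 (fun _ => rfl) ?_
    rw [← (hL.add hL').tsum_eq]
    refine tsum_congr fun n => ?_
    rw [← Finset.sum_mul, hsum]
    ring
  obtain ⟨ρ, hρ, h⟩ := Metric.eventually_nhds_iff_ball.mp hev
  exact ⟨ρ, hρ, fun ε ε' y hy => h y (by simpa using hy) ε ε'⟩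

end CurrentData

end ThetaScreening

namespace ThetaScreening

open Complex

/-! ## The bosons of the theorem -/

section

variable (q : ℂ) (k r : ℕ) (i j : Fin 3) (C D : ℂ)

theorem phi_charge : (phi q j 1 1 C 0 D i).1 = if i = j then -C⁻¹ else 0 := by
  by_cases h : i = j
  · subst h; simp [phi]
  · simp [phi, h]

theorem phi_mom : (phi q j 1 1 C 0 D i).2.1 = 0 := by
  by_cases h : i = j
  · subst h; simp [phi]
  · simp [phi, h]

theorem phiPlus_charge : (phiPlus q j 1 2 0 C i).1 = 0 := by
  by_cases h : i = j
  · subst h; simp [phiPlus]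
  · simp [phiPlus, h]

theorem phiPlus_mom : (phiPlus q j 1 2 0 C i).2.1 = if i = j then log q / 2 else 0 := by
  by_cases h : i = j
  · subst h; simp [phiPlus]
  · simp [phiPlus, h]

theorem phiMinus_charge : (phiMinus q j 1 2 0 C i).1 = 0 := by
  by_cases h : i = j
  · subst h; simp [phiMinus]
  · simp [phiMinus, h]

theorem phiMinus_mom : (phiMinus q j 1 2 0 C i).2.1 = if i = j then log q / 2 else 0 := by
  by_cases h : i = j
  · subst h; simp [phiMinus]
  · simp [phiMinus, h]

/-- The coefficient of `i Q_0` in `φ_0`. -/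
def phiZeroConst : ℂ := (k : ℂ)⁻¹ * (Real.sqrt (2 * k * r / ((r : ℝ) - k)) : ℝ)

/-- The coefficient of `i Q_0` in `φ'_0`. -/
def phiZeroConst' : ℂ := (k : ℂ)⁻¹ * (Real.sqrt (2 * k * ((r : ℝ) - k) / r) : ℝ)

theorem phiZero_charge :
    (phiZero q k r 1 1 k 0 0 i).1 = if i = 0 then phiZeroConst k r * I else 0 := by
  by_cases h : i = 0
  · subst h; simp [phiZero, phiZeroConst]
  · simp [phiZero, h]

theorem phiZero_mom : (phiZero q k r 1 1 k 0 0 i).2.1 = 0 := by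
  by_cases h : i = 0
  · subst h; simp [phiZero]
  · simp [phiZero, h]

theorem phiZero'_charge :
    (phiZero' q k r 1 1 k 0 0 i).1 = if i = 0 then phiZeroConst' k r * I else 0 := by
  by_cases h : i = 0
  · subst h; simp [phiZero', phiZeroConst']
  · simp [phiZero', h]

theorem phiZero'_mom : (phiZero' q k r 1 1 k 0 0 i).2.1 = 0 := by
  by_cases h : i = 0
  · subst h; simp [phiZero']
  · simp [phiZero', h]

end

section

variable {q : ℂ} (hq0 : q ≠ 0) (hq1 : ‖q‖ < 1)
include hq0

theorem homogeneous_phi (j : Fin 3) (C D : ℂ) : Homogeneous q (fun u => phi q j 1 1 C u D)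
    (Pi.single j (-C⁻¹ * (2 * log q))) := by
  have h := Homogeneous.single (q := q) j (c := -C⁻¹) (d := 0) (s := -C⁻¹ * (2 * log q))
    (o := fun u => oscCoeff q 1 1 C u D) fun u n => oscCoeff_eq hq0 _ _ _ _ _ _
  convert h using 2 with u
  rw [phi]
  congr 2
  · simp
  · congr 1
    rw [one_mul, one_div]; ring

theorem homogeneous_phiPlus (j : Fin 3) (C : ℂ) :
    Homogeneous q (fun u => phiPlus q j 1 2 u C) 0 := by
  have h := Homogeneous.single (q := q) j (c := 0) (d := log q / 2) (s := 0)
    (o := fun u => (phiPlus q j 1 2 u C j).2.2) fun u n => by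
      simp only [phiPlus, Pi.single_eq_same, cpow_eq_qpow hq0, mul_zero, zero_mul, neg_zero,
        qpow_zero, mul_one]
      split_ifs <;> ring
  rw [Pi.single_zero] at h
  convert h using 2 with u
  simp [phiPlus]

theorem homogeneous_phiMinus (j : Fin 3) (C : ℂ) :
    Homogeneous q (fun u => phiMinus q j 1 2 u C) 0 := by
  have h := Homogeneous.single (q := q) j (c := 0) (d := log q / 2) (s := 0)
    (o := fun u => (phiMinus q j 1 2 u C j).2.2) fun u n => by
      simp only [phiMinus, Pi.single_eq_same, cpow_eq_qpow hq0, mul_zero, zero_mul,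
        qpow_zero, mul_one]
      split_ifs
      · push_cast
        rw [mul_neg]
        ring_nf
      · ring
  rw [Pi.single_zero] at h
  convert h using 2 with u
  simp [phiMinus]

theorem homogeneous_phiZero (k r : ℕ) : Homogeneous q (fun u => phiZero q k r 1 1 k u 0)
    (Pi.single 0 (phiZeroConst k r * (2 * log q))) := by
  have h := Homogeneous.single (q := q) 0 (c := phiZeroConst k r * I) (d := 0)
    (s := phiZeroConst k r * (2 * log q))
    (o := fun u => oscCoeff q 1 1 k u 0) fun u n => oscCoeff_eq hq0 _ _ _ _ _ _
  convert h using 2 with u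
  simp only [phiZero, phiZeroConst, one_mul, one_div]
  congr 3
  ring

theorem homogeneous_phiZero' (k r : ℕ) : Homogeneous q (fun u => phiZero' q k r 1 1 k u 0)
    (Pi.single 0 (phiZeroConst' k r * (2 * log q))) := by
  have h := Homogeneous.single (q := q) 0 (c := phiZeroConst' k r * I) (d := 0)
    (s := phiZeroConst' k r * (2 * log q))
    (o := fun u m => oscCoeff q 1 1 k u 0 m * (qnum q (((r : ℂ) - k) * m) / qnum q (r * m)))
    fun u n => by rw [oscCoeff_eq hq0]; ring
  convert h using 2 with u
  simp only [phiZero', phiZeroConst', one_mul, one_div]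
  congr 3
  ring

theorem phiPlus_osc_pos (i j : Fin 3) (C : ℂ) (n : ℕ) :
    (phiPlus q j 1 2 0 C i).2.2 ((n : ℤ) + 1) = if i = j then (q - q⁻¹) *
      (qnum q ((n : ℂ) + 1) * (qnum q (2 * ((n : ℂ) + 1)))⁻¹) * qpow q (C * ((n : ℂ) + 1))
      else 0 := by
  have h1 : 0 < (n : ℤ) + 1 := by omega
  by_cases h : i = j
  · subst h
    simp [phiPlus, h1, cpow_eq_qpow hq0, div_eq_mul_inv]
  · simp [phiPlus, h]

omit hq0 in
theorem phiPlus_osc_neg (i j : Fin 3) (C : ℂ) (n : ℕ) :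
    (phiPlus q j 1 2 0 C i).2.2 (-((n : ℤ) + 1)) = 0 := by
  have h1 : ¬ 0 < -((n : ℤ) + 1) := by omega
  by_cases h : i = j
  · subst h
    simp only [phiPlus, h1, Pi.single_eq_same, if_false]
  · simp [phiPlus, h]

theorem phiMinus_osc_neg (i j : Fin 3) (C : ℂ) (n : ℕ) :
    (phiMinus q j 1 2 0 C i).2.2 (-((n : ℤ) + 1)) = if i = j then (q - q⁻¹) *
      (qnum q ((n : ℂ) + 1) * (qnum q (2 * ((n : ℂ) + 1)))⁻¹) * qpow q (C * ((n : ℂ) + 1))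
      else 0 := by
  have h1 : -((n : ℤ) + 1) < 0 := by omega
  by_cases h : i = j
  · subst h
    simp only [phiMinus, Pi.single_eq_same, h1, if_true, cpow_eq_qpow hq0, div_eq_mul_inv, neg_neg]
    push_cast
    simp
  · simp [phiMinus, h]

omit hq0 in
theorem phiMinus_osc_pos (i j : Fin 3) (C : ℂ) (n : ℕ) :
    (phiMinus q j 1 2 0 C i).2.2 ((n : ℤ) + 1) = 0 := by
  have h1 : ¬ ((n : ℤ) + 1 < 0) := by omega
  by_cases h : i = j
  · subst h
    simp only [phiMinus, h1, Pi.single_eq_same, if_false]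
  · simp [phiMinus, h]

include hq1

theorem phi_osc_pos (i j : Fin 3) (C D : ℂ) (n : ℕ) :
    (phi q j 1 1 C 0 D i).2.2 ((n : ℤ) + 1) =
      if i = j then qpow q (D * ((n : ℂ) + 1)) * (qnum q (C * ((n : ℂ) + 1)))⁻¹ else 0 := by
  by_cases h : i = j
  · subst h; simp only [phi, Pi.single_eq_same, if_true, oscCoeff_pos hq0 hq1]
  · simp [phi, h]

theorem phi_osc_neg (i j : Fin 3) (C D : ℂ) (n : ℕ) :
    (phi q j 1 1 C 0 D i).2.2 (-((n : ℤ) + 1)) =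
      if i = j then -(qpow q (D * ((n : ℂ) + 1)) * (qnum q (C * ((n : ℂ) + 1)))⁻¹) else 0 := by
  by_cases h : i = j
  · subst h; simp only [phi, Pi.single_eq_same, if_true, oscCoeff_neg hq0 hq1]
  · simp [phi, h]

theorem phiZero_osc_pos (k r : ℕ) (i : Fin 3) (n : ℕ) :
    (phiZero q k r 1 1 k 0 0 i).2.2 ((n : ℤ) + 1) =
      if i = 0 then (qnum q (k * ((n : ℂ) + 1)))⁻¹ else 0 := by
  by_cases h : i = 0
  · subst h
    simp only [phiZero, Pi.single_eq_same, if_true, oscCoeff_pos hq0 hq1, zero_mul, qpow_zero,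
      one_mul]
  · simp [phiZero, h]

theorem phiZero_osc_neg (k r : ℕ) (i : Fin 3) (n : ℕ) :
    (phiZero q k r 1 1 k 0 0 i).2.2 (-((n : ℤ) + 1)) =
      if i = 0 then -(qnum q (k * ((n : ℂ) + 1)))⁻¹ else 0 := by
  by_cases h : i = 0
  · subst h
    simp only [phiZero, Pi.single_eq_same, if_true, oscCoeff_neg hq0 hq1, zero_mul, qpow_zero,
      one_mul]
  · simp [phiZero, h]

theorem phiZero'_osc_pos (k r : ℕ) (i : Fin 3) (n : ℕ) :
    (phiZero' q k r 1 1 k 0 0 i).2.2 ((n : ℤ) + 1) =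
      if i = 0 then (qnum q (k * ((n : ℂ) + 1)))⁻¹ *
        (qnum q (((r : ℂ) - k) * ((n : ℂ) + 1)) * (qnum q (r * ((n : ℂ) + 1)))⁻¹) else 0 := by
  by_cases h : i = 0
  · subst h
    simp only [phiZero', Pi.single_eq_same, if_true, oscCoeff_pos hq0 hq1, zero_mul, qpow_zero,
      one_mul, div_eq_mul_inv]
    push_cast
    rfl
  · simp [phiZero', h]

theorem phiZero'_osc_neg (k r : ℕ) (i : Fin 3) (n : ℕ) :
    (phiZero' q k r 1 1 k 0 0 i).2.2 (-((n : ℤ) + 1)) =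
      if i = 0 then -((qnum q (k * ((n : ℂ) + 1)))⁻¹ *
        (qnum q (((r : ℂ) - k) * ((n : ℂ) + 1)) * (qnum q (r * ((n : ℂ) + 1)))⁻¹)) else 0 := by
  by_cases h : i = 0
  · subst h
    simp only [phiZero', Pi.single_eq_same, if_true, oscCoeff_neg hq0 hq1, zero_mul, qpow_zero,
      one_mul, div_eq_mul_inv]
    push_cast
    rw [mul_neg, mul_neg, qnum_neg, qnum_neg, inv_neg]
    ring
  · simp [phiZero', h]

theorem oscBdd_phi (j : Fin 3) {C : ℝ} (hC : 0 < C) (D : ℂ) : OscBdd (phi q j 1 1 C 0 D) := by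
  have h := (GeomBdd.qpow q D).mul (GeomBdd.inv_qnum hq0 hq1 hC)
  refine fun i => ⟨?_, ?_⟩
  · simp only [phi_osc_pos hq0 hq1]
    split_ifs
    exacts [h, GeomBdd.const 0]
  · simp only [phi_osc_neg hq0 hq1]
    split_ifs
    exacts [h.neg, GeomBdd.const 0]

theorem geomBdd_phiPlus (C : ℂ) : GeomBdd fun n : ℕ => (q - q⁻¹) *
    (qnum q ((n : ℂ) + 1) * (qnum q (2 * ((n : ℂ) + 1)))⁻¹) * qpow q (C * ((n : ℂ) + 1)) := by
  have h1 := GeomBdd.inv_qnum hq0 hq1 two_pos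
  have h2 := GeomBdd.qnum hq0 1
  simp only [one_mul, ofReal_ofNat] at h1 h2
  exact ((GeomBdd.const _).mul (h2.mul h1)).mul (GeomBdd.qpow q C)

theorem oscBdd_phiPlus (j : Fin 3) (C : ℂ) : OscBdd (phiPlus q j 1 2 0 C) := by
  refine fun i => ⟨?_, ?_⟩
  · simp only [phiPlus_osc_pos hq0]
    split_ifs
    exacts [geomBdd_phiPlus hq0 hq1 C, GeomBdd.const 0]
  · simp only [phiPlus_osc_neg]
    exact GeomBdd.const 0

theorem oscBdd_phiMinus (j : Fin 3) (C : ℂ) : OscBdd (phiMinus q j 1 2 0 C) := by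
  refine fun i => ⟨?_, ?_⟩
  · simp only [phiMinus_osc_pos]
    exact GeomBdd.const 0
  · simp only [phiMinus_osc_neg hq0]
    split_ifs
    exacts [geomBdd_phiPlus hq0 hq1 C, GeomBdd.const 0]

theorem oscBdd_phiZero {k : ℕ} (r : ℕ) (hk : 1 ≤ k) : OscBdd (phiZero q k r 1 1 k 0 0) := by
  have h := GeomBdd.inv_qnum hq0 hq1 (s := k) (by exact_mod_cast hk)
  rw [ofReal_natCast] at h
  refine fun i => ⟨?_, ?_⟩
  · simp only [phiZero_osc_pos hq0 hq1]
    split_ifs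
    exacts [h, GeomBdd.const 0]
  · simp only [phiZero_osc_neg hq0 hq1]
    split_ifs
    exacts [h.neg, GeomBdd.const 0]

theorem oscBdd_phiZero' {k r : ℕ} (hk : 1 ≤ k) (hr : 1 ≤ r) :
    OscBdd (phiZero' q k r 1 1 k 0 0) := by
  have h1 := GeomBdd.inv_qnum hq0 hq1 (s := k) (by exact_mod_cast hk)
  have h2 := GeomBdd.inv_qnum hq0 hq1 (s := r) (by exact_mod_cast hr)
  rw [ofReal_natCast] at h1 h2
  have h := h1.mul ((GeomBdd.qnum hq0 ((r : ℂ) - k)).mul h2)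
  refine fun i => ⟨?_, ?_⟩
  · simp only [phiZero'_osc_pos hq0 hq1]
    split_ifs
    exacts [h, GeomBdd.const 0]
  · simp only [phiZero'_osc_neg hq0 hq1]
    split_ifs
    exacts [h.neg, GeomBdd.const 0]

end

end ThetaScreening

namespace ThetaScreening

open Complex CurrentData

/-! ## The contractions of the currents -/

theorem qnum_of_qpow {q : ℂ} (hq0 : q ≠ 0) {s a : ℂ} (h : qpow q s = a) :
    qnum q s = (a ^ 2 - 1) / (a * (q - q⁻¹)) := by
  have ha : a ≠ 0 := h ▸ qpow_ne_zero q s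
  rw [qnum_eq hq0, h, show a - a⁻¹ = (a ^ 2 - 1) / a by field_simp, div_div]

/-- The values `a = q ^ m`, `h = q ^ (k m / 2)`, `d = q ^ (r m)` for `m = n + 1`. -/
structure ModeValues (q : ℂ) (k r n : ℕ) (a h d : ℂ) : Prop where
  qpow_one_mul : q ^ (n + 1) = a
  half : qpow q ((k : ℂ) / 2 * ((n : ℂ) + 1)) = h
  rank : qpow q (r * ((n : ℂ) + 1)) = d
  a_ne : a ≠ 0
  h_ne : h ≠ 0
  d_ne : d ≠ 0
  two_sub : a ^ 4 - 1 ≠ 0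
  k_sub : h ^ 4 - 1 ≠ 0
  r_sub : d ^ 2 - 1 ≠ 0
  rk_sub : d ^ 2 - h ^ 4 ≠ 0
  k2_sub : h ^ 4 * a ^ 4 - 1 ≠ 0

namespace ModeValues

theorem exists_values {q : ℂ} (hq0 : q ≠ 0) (hq1 : ‖q‖ < 1) {k r : ℕ} (hk : 1 ≤ k) (hkr : k < r)
    (n : ℕ) : ∃ a h d, ModeValues q k r n a h d := by
  have key : ∀ s : ℝ, 0 < s → ∀ b : ℂ, qpow q s = b → b - 1 ≠ 0 := fun s hs b hb h0 => by
    have := norm_qpow_lt_one hq0 hq1 hs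
    rw [hb, sub_eq_zero.mp h0, norm_one] at this
    exact lt_irrefl _ this
  have hk' : (0 : ℝ) < k := by exact_mod_cast hk
  have hr' : (0 : ℝ) < r := by exact_mod_cast (by omega : 0 < r)
  have hkr' : (0 : ℝ) < (r : ℝ) - k := by rw [sub_pos]; exact_mod_cast hkr
  have hpow : q ^ (n + 1) = qpow q ((n : ℂ) + 1) := by
    have := qpow_mul_nat q 1 (n + 1)
    rw [qpow_one hq0, one_mul] at this
    rw [← this]
    push_cast
    rfl
  refine ⟨qpow q ((n : ℂ) + 1), qpow q ((k : ℂ) / 2 * ((n : ℂ) + 1)), qpow q (r * ((n : ℂ) + 1)),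
    hpow, rfl, rfl, qpow_ne_zero _ _, qpow_ne_zero _ _, qpow_ne_zero _ _, ?_, ?_, ?_, ?_, ?_⟩
  · refine key (4 * (n + 1)) (by positivity) _ ?_
    rw [← qpow_mul_nat]
    push_cast
    ring_nf
  · refine key (2 * k * (n + 1)) (by positivity) _ ?_
    rw [← qpow_mul_nat]
    push_cast
    ring_nf
  · refine key (2 * r * (n + 1)) (by positivity) _ ?_
    rw [← qpow_mul_nat]
    push_cast
    ring_nf
  · have h1 := key (2 * (r - k) * (n + 1)) (by positivity) _ rfl
    have h2 : qpow q (r * ((n : ℂ) + 1)) ^ 2 = qpow q ((2 * ((r : ℝ) - k) * (n + 1) : ℝ) : ℂ) *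
        qpow q ((k : ℂ) / 2 * ((n : ℂ) + 1)) ^ 4 := by
      rw [← qpow_mul_nat, ← qpow_mul_nat, ← qpow_add]
      push_cast
      ring_nf
    rw [h2, ← sub_one_mul]
    exact mul_ne_zero h1 (pow_ne_zero _ (qpow_ne_zero _ _))
  · refine key (2 * (k + 2) * (n + 1)) (by positivity) _ ?_
    rw [← qpow_mul_nat, ← qpow_mul_nat, ← qpow_add]
    push_cast
    ring_nf

variable {q : ℂ} {k r n : ℕ} {a h d : ℂ} (hv : ModeValues q k r n a h d)
include hv

theorem qpow_half_neg : qpow q (-((k : ℂ) / 2) * ((n : ℂ) + 1)) = h⁻¹ := by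
  rw [neg_mul, qpow_neg, hv.half]

theorem pow_nome_r : qpow q (2 * r) ^ (n + 1) = d ^ 2 := by
  rw [← qpow_mul_nat, ← hv.rank, ← qpow_mul_nat]
  push_cast
  ring_nf

theorem pow_nome_k : qpow q (2 * k) ^ (n + 1) = h ^ 4 := by
  rw [← qpow_mul_nat, ← hv.half, ← qpow_mul_nat]
  push_cast
  ring_nf

variable (hq0 : q ≠ 0)
include hq0

theorem qpow_m : qpow q ((n : ℂ) + 1) = a := by
  rw [← hv.qpow_one_mul]
  have := qpow_mul_nat q 1 (n + 1)
  rw [qpow_one hq0, one_mul] at this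
  rw [← this]
  push_cast
  rfl

theorem qpow_half_two : qpow q (((k : ℂ) + 2) / 2 * ((n : ℂ) + 1)) = h * a := by
  rw [← hv.half, ← hv.qpow_m hq0, ← qpow_add]
  ring_nf

theorem qpow_half_two_neg : qpow q (-(((k : ℂ) + 2) / 2) * ((n : ℂ) + 1)) = (h * a)⁻¹ := by
  rw [neg_mul, qpow_neg, hv.qpow_half_two hq0]

theorem pow_two : qpow q 2 ^ (n + 1) = a ^ 2 := by
  rw [← qpow_mul_nat, ← hv.qpow_m hq0, ← qpow_mul_nat]
  push_cast
  ring_nf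

theorem qnum_one_mul : qnum q ((n : ℂ) + 1) = (a ^ 2 - 1) / (a * (q - q⁻¹)) :=
  qnum_of_qpow hq0 (hv.qpow_m hq0)

theorem qnum_two_mul : qnum q (2 * ((n : ℂ) + 1)) = (a ^ 4 - 1) / (a ^ 2 * (q - q⁻¹)) := by
  have h1 : qpow q (2 * ((n : ℂ) + 1)) = a ^ 2 := by
    rw [two_mul, qpow_add, hv.qpow_m hq0, sq]
  rw [qnum_of_qpow hq0 h1]
  ring

theorem qnum_k_mul : qnum q (k * ((n : ℂ) + 1)) = (h ^ 4 - 1) / (h ^ 2 * (q - q⁻¹)) := by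
  have h1 : qpow q (k * ((n : ℂ) + 1)) = h ^ 2 := by
    rw [← hv.half, sq, ← qpow_add]
    ring_nf
  rw [qnum_of_qpow hq0 h1]
  ring

theorem qnum_r_mul : qnum q (r * ((n : ℂ) + 1)) = (d ^ 2 - 1) / (d * (q - q⁻¹)) :=
  qnum_of_qpow hq0 hv.rank

theorem qnum_k2_mul : qnum q (((k : ℂ) + 2) * ((n : ℂ) + 1)) =
    (h ^ 4 * a ^ 4 - 1) / (h ^ 2 * a ^ 2 * (q - q⁻¹)) := by
  have h1 : qpow q (((k : ℂ) + 2) * ((n : ℂ) + 1)) = h ^ 2 * a ^ 2 := by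
    rw [← hv.half, ← hv.qpow_m hq0, sq, sq, ← qpow_add, ← qpow_add, ← qpow_add]
    ring_nf
  rw [qnum_of_qpow hq0 h1]
  ring

theorem qnum_rk_mul : qnum q (((r : ℂ) - k) * ((n : ℂ) + 1)) =
    (d ^ 2 - h ^ 4) / (d * h ^ 2 * (q - q⁻¹)) := by
  have h1 : qpow q (((r : ℂ) - k) * ((n : ℂ) + 1)) = d / h ^ 2 := by
    rw [← hv.half, ← hv.rank, sq, ← qpow_add, ← qpow_sub]
    ring_nf
  have := hv.h_ne
  have := hv.d_ne
  rw [qnum_of_qpow hq0 h1]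
  field_simp

end ModeValues

/-- The fields of the two summands of `E`. -/
def fieldsE (q : ℂ) (k r : ℕ) (ε : Bool) (u : ℂ) : BosonField :=
  -phiZero q k r 1 1 k u 0 - phi q 2 1 1 k u (-(k / 2)) +
    cond ε (-phiPlus q 2 1 2 u ((k + 2) / 2) - phiPlus q 1 1 2 u (k / 2))
      (phiMinus q 2 1 2 u ((k + 2) / 2) + phiMinus q 1 1 2 u (k / 2))

/-- The fields of the two summands of `F`. -/
def fieldsF (q : ℂ) (k r : ℕ) (ε : Bool) (u : ℂ) : BosonField :=
  phiZero' q k r 1 1 k u 0 + phi q 2 1 1 k u (k / 2) +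
    cond ε (-phiPlus q 2 1 2 u (-((k + 2) / 2)) + phiPlus q 1 1 2 u (-(k / 2)))
      (phiMinus q 2 1 2 u (-((k + 2) / 2)) - phiMinus q 1 1 2 u (-(k / 2)))

/-- The fields of the two summands of `S`. -/
def fieldsS (q : ℂ) (k : ℕ) (ε : Bool) (u : ℂ) : BosonField :=
  phi q 1 1 1 (k + 2) u (-((k + 2) / 2)) +
    cond ε (phiPlus q 2 1 2 u ((k + 2) / 2) + phiPlus q 1 1 2 u (k / 2))
      (-phiMinus q 2 1 2 u ((k + 2) / 2) - phiMinus q 1 1 2 u (k / 2))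

/-- The field of `η`. -/
def fieldsEta (q : ℂ) (k : ℕ) (_ : Unit) (u : ℂ) : BosonField :=
  -phi q 1 1 1 2 u (k / 2) - phi q 2 1 1 2 u ((k + 2) / 2)

section

variable {q : ℂ} (hq0 : q ≠ 0) (hq1 : ‖q‖ < 1) {k r : ℕ} (hk : 1 ≤ k) (hkr : k < r)
include hq0 hq1 hk hkr

/-- In terms of `a = q^m`, `h = q^{km/2}`, `d = q^{rm}` this is an identity of rational functions,
checked for each pair of summands. The right side is the `m`-th coefficient of the logarithm of `(p
q⁻² y; p)/(q² y; p)` times the linear factor, with `p = q^{2(r-k)}`. -/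
theorem contraction_fieldsE (ε ε' : Bool) (n : ℕ) :
    ∑ j, (fieldsE q k r ε 0 j).2.2 ((n : ℤ) + 1) * oscComm q k r j ((n : ℂ) + 1) *
      (fieldsE q k r ε' 0 j).2.2 (-((n : ℤ) + 1)) =
    -((qpow q (2 * r + -(2 * k) + -2) ^ (n + 1) - qpow q 2 ^ (n + 1)) /
      (1 - qpow q (2 * r + -(2 * k)) ^ (n + 1))) / ((n : ℂ) + 1) -
      (cond ε' q q⁻¹ / cond ε q q⁻¹) ^ (n + 1) / ((n : ℂ) + 1) := by
  obtain ⟨a, h, d, hv⟩ := ModeValues.exists_values hq0 hq1 hk hkr n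
  have hh := hv.h_ne
  have hd := hv.d_ne
  have h2 := hv.two_sub
  have h3 := hv.k_sub
  have h4 := hv.rk_sub
  have h6 : h ^ 4 - d ^ 2 ≠ 0 := fun h0 => h4 (by linear_combination -h0)
  have he := sub_inv_ne_zero hq0 hq1
  cases ε <;> cases ε' <;>
  simp only [fieldsE, Fin.sum_univ_three, Pi.add_apply, Pi.sub_apply, Pi.neg_apply, Prod.snd_add,
    Prod.snd_sub, Prod.snd_neg, phiZero_osc_pos hq0 hq1, phiZero_osc_neg hq0 hq1,
    phi_osc_pos hq0 hq1, phi_osc_neg hq0 hq1, phiPlus_osc_pos hq0, phiPlus_osc_neg,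
    phiMinus_osc_pos, phiMinus_osc_neg hq0, oscComm, cond_true, cond_false, reduceIte, Fin.isValue,
    Fin.reduceEq, Matrix.cons_val, hv.half, hv.qpow_half_neg, hv.qpow_half_two hq0,
    hv.qnum_one_mul hq0, hv.qnum_two_mul hq0, hv.qnum_k_mul hq0,
    hv.qnum_r_mul hq0, hv.qnum_k2_mul hq0, hv.qnum_rk_mul hq0, qpow_add, qpow_neg q (2 * (k : ℂ)),
    qpow_neg q 2, mul_pow, inv_pow, div_pow, hv.pow_nome_r, hv.pow_nome_k, hv.pow_two hq0,
    hv.qpow_one_mul, neg_zero, zero_add, add_zero, sub_zero, zero_sub, mul_zero, zero_mul] <;>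
  generalize q - q⁻¹ = e at he ⊢ <;>
  field_simp <;>
  ring

theorem contraction_fieldsF (ε ε' : Bool) (n : ℕ) :
    ∑ j, (fieldsF q k r ε 0 j).2.2 ((n : ℤ) + 1) * oscComm q k r j ((n : ℂ) + 1) *
      (fieldsF q k r ε' 0 j).2.2 (-((n : ℤ) + 1)) =
    -((qpow q (2 * r + 2) ^ (n + 1) - qpow q (-2) ^ (n + 1)) /
      (1 - qpow q (2 * r) ^ (n + 1))) / ((n : ℂ) + 1) -
      (cond ε' q⁻¹ q / cond ε q⁻¹ q) ^ (n + 1) / ((n : ℂ) + 1) := by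
  obtain ⟨a, h, d, hv⟩ := ModeValues.exists_values hq0 hq1 hk hkr n
  have ha := hv.a_ne
  have hh := hv.h_ne
  have hd := hv.d_ne
  have h2 := hv.two_sub
  have h3 := hv.k_sub
  have h8 := hv.r_sub
  have h9 : 1 - d ^ 2 ≠ 0 := fun h0 => h8 (by linear_combination -h0)
  have he := sub_inv_ne_zero hq0 hq1
  cases ε <;> cases ε' <;>
  simp only [fieldsF, Fin.sum_univ_three, Pi.add_apply, Pi.sub_apply, Pi.neg_apply, Prod.snd_add,
    Prod.snd_sub, Prod.snd_neg, phiZero'_osc_pos hq0 hq1, phiZero'_osc_neg hq0 hq1,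
    phi_osc_pos hq0 hq1, phi_osc_neg hq0 hq1, phiPlus_osc_pos hq0, phiPlus_osc_neg,
    phiMinus_osc_pos, phiMinus_osc_neg hq0, oscComm, cond_true, cond_false, reduceIte, Fin.isValue,
    Fin.reduceEq, Matrix.cons_val, hv.half, hv.qpow_half_neg,
    hv.qpow_half_two_neg hq0, hv.qnum_one_mul hq0, hv.qnum_two_mul hq0, hv.qnum_k_mul hq0,
    hv.qnum_r_mul hq0, hv.qnum_k2_mul hq0, hv.qnum_rk_mul hq0, qpow_add,
    qpow_neg q 2, mul_pow, inv_pow, div_pow, hv.pow_nome_r, hv.pow_two hq0,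
    hv.qpow_one_mul, neg_zero, zero_add, add_zero, sub_zero, zero_sub, mul_zero, zero_mul] <;>
  generalize q - q⁻¹ = e at he ⊢ <;>
  field_simp <;>
  ring

theorem contraction_fieldsS (ε ε' : Bool) (n : ℕ) :
    ∑ j, (fieldsS q k ε 0 j).2.2 ((n : ℤ) + 1) * oscComm q k r j ((n : ℂ) + 1) *
      (fieldsS q k ε' 0 j).2.2 (-((n : ℤ) + 1)) =
    -((qpow q (2 * k + 2) ^ (n + 1) - qpow q 2 ^ (n + 1)) /
      (1 - qpow q (2 * k + 2 + 2) ^ (n + 1))) / ((n : ℂ) + 1) -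
      (cond ε' q⁻¹ q / cond ε q⁻¹ q) ^ (n + 1) / ((n : ℂ) + 1) := by
  obtain ⟨a, h, d, hv⟩ := ModeValues.exists_values hq0 hq1 hk hkr n
  have ha := hv.a_ne
  have hh := hv.h_ne
  have h2 := hv.two_sub
  have h7 := hv.k2_sub
  have h10 : 1 - h ^ 4 * a ^ 4 ≠ 0 := fun h0 => h7 (by linear_combination -h0)
  have he := sub_inv_ne_zero hq0 hq1
  cases ε <;> cases ε' <;>
  simp only [fieldsS, Fin.sum_univ_three, Pi.add_apply, Pi.sub_apply, Pi.neg_apply, Prod.snd_add,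
    Prod.snd_sub, Prod.snd_neg,
    phi_osc_pos hq0 hq1, phi_osc_neg hq0 hq1, phiPlus_osc_pos hq0, phiPlus_osc_neg,
    phiMinus_osc_pos, phiMinus_osc_neg hq0, oscComm, cond_true, cond_false, reduceIte, Fin.isValue,
    Fin.reduceEq, Matrix.cons_val, hv.half, hv.qpow_half_two hq0,
    hv.qpow_half_two_neg hq0, hv.qnum_one_mul hq0, hv.qnum_two_mul hq0, hv.qnum_k_mul hq0,
    hv.qnum_r_mul hq0, hv.qnum_k2_mul hq0, hv.qnum_rk_mul hq0, qpow_add,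
    mul_pow, inv_pow, div_pow, hv.pow_nome_k, hv.pow_two hq0,
    hv.qpow_one_mul, neg_zero, zero_add, add_zero, sub_zero, zero_sub, mul_zero, zero_mul] <;>
  generalize q - q⁻¹ = e at he ⊢ <;>
  field_simp <;>
  ring

/-- The contributions of the bosons `1` and `2` nearly cancel; what is left is the logarithmic
series of `1 - y`, so `η` behaves like a free fermion. -/
theorem contraction_fieldsEta (ε ε' : Unit) (n : ℕ) :
    ∑ j, (fieldsEta q k ε 0 j).2.2 ((n : ℤ) + 1) * oscComm q k r j ((n : ℂ) + 1) *
      (fieldsEta q k ε' 0 j).2.2 (-((n : ℤ) + 1)) = -(1 / ((n : ℂ) + 1)) := by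
  obtain ⟨a, h, d, hv⟩ := ModeValues.exists_values hq0 hq1 hk hkr n
  have ha := hv.a_ne
  have hh := hv.h_ne
  have h2 := hv.two_sub
  have he := sub_inv_ne_zero hq0 hq1
  simp only [fieldsEta, Fin.sum_univ_three, Pi.sub_apply, Pi.neg_apply,
    Prod.snd_sub, Prod.snd_neg, phi_osc_pos hq0 hq1, phi_osc_neg hq0 hq1, oscComm, reduceIte,
    Fin.isValue, Fin.reduceEq, Matrix.cons_val, hv.half, hv.qpow_half_two hq0,
    hv.qnum_two_mul hq0, hv.qnum_k_mul hq0, hv.qnum_k2_mul hq0, neg_zero, zero_add,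
    sub_zero, zero_sub, mul_zero, zero_mul]
  generalize q - q⁻¹ = e at he ⊢
  field_simp
  ring

end

end ThetaScreening

namespace ThetaScreening

open Complex CurrentData

/-! ## The data of the currents -/

section

variable {q : ℂ} {k r : ℕ}

/-- The data of a current of theta type with two summands. -/
def thetaData (q : ℂ) (X : Bool → ℂ → BosonField) (slope : Fin 3 → ℂ) (c z : ℂ) (x : ℝ) (δ : ℤ) :
    CurrentData Bool :=
  ofFields X (fun ε => cond ε c (-c)) (fun j => (X true 0 j).1) slope
    (fun ε => cond ε z z⁻¹) (4 * δ / x * log q)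
    (fun y => poch (qpow q (2 * x)) (qpow q (2 * x - 2 * δ) * y) /
      poch (qpow q (2 * x)) (qpow q (2 * δ) * y))

theorem isThetaType_thetaData (X : Bool → ℂ → BosonField) (slope : Fin 3 → ℂ) (c z : ℂ) (x : ℝ)
    {δ : ℤ} (hδ : IsUnit δ) : (thetaData q X slope c z x δ).IsThetaType q x δ :=
  ⟨hδ, rfl, fun _ => rfl⟩

theorem represents_thetaData (hq0 : q ≠ 0) (hq1 : ‖q‖ < 1) (hkr : k < r)
    {X : Bool → ℂ → BosonField} {slope : Fin 3 → ℂ} {c z : ℂ} {x : ℝ} {δ : ℤ} (hx : 0 < x)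
    (hδ : IsUnit δ) (hz : z ≠ 0) {A : ℂ → Op}
    (hA : ∀ u, A u = twoTerm q k r c (X true u) (X false u))
    (hX : ∀ ε, Homogeneous q (X ε) slope) (hcharge : ∀ ε j, (X ε 0 j).1 = (X true 0 j).1)
    (hosc : ∀ ε, OscBdd (X ε 0))
    (hzero : ∀ ε u, exp (∑ j, ((X ε 0 j).2.1 + slope j * u) * (zeroComm k j * (X true 0 j).1)) =
      cond ε z z⁻¹ * exp (4 * δ / x * log q * u))
    (hsum : ∀ ε ε' (n : ℕ), ∑ j, (X ε 0 j).2.2 ((n : ℤ) + 1) * oscComm q k r j ((n : ℂ) + 1) *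
      (X ε' 0 j).2.2 (-((n : ℤ) + 1)) =
      -((qpow q (2 * x - 2 * δ) ^ (n + 1) - qpow q (2 * δ) ^ (n + 1)) /
        (1 - qpow q (2 * x) ^ (n + 1))) / ((n : ℂ) + 1) -
        (cond ε' z z⁻¹ / cond ε z z⁻¹) ^ (n + 1) / ((n : ℂ) + 1)) :
    (thetaData q X slope c z x δ).Represents q k r A ‖qpow q (-(2 * δ))‖ where
  shift_eq u := by
    rw [hA]
    funext j
    change zeroComm k j * (X true u j).1 = zeroComm k j * (X true 0 j).1
    rw [hX true u j]
  entry_eq u p e f := by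
    rw [hA, Fintype.sum_bool]
    simp only [thetaData, ofFields_field hX hcharge]
    simp only [ofFields, twoTerm, cond_true, cond_false]
    ring
  zero_ne ε := by cases ε <;> simpa [thetaData, ofFields] using hz
  zero_eq := hzero
  -- The first pole of `fac` lies at `y = q^{-2δ}`, which determines the radius.
  fac_diff := fun y hy => by
    refine ((isThetaType_thetaData X slope c z x hδ).analyticAt_fac hq0 hq1 hx
      (poch_ne_zero_of_norm_lt (norm_nome_lt_one hq0 hq1 hx) ?_)).differentiableAt.differentiableWithinAt
    rw [mem_ball_zero_iff, qpow_neg, norm_inv] at hy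
    have hQ : 0 < ‖qpow q (2 * δ)‖ := norm_pos_iff.mpr (qpow_ne_zero _ _)
    rw [norm_mul]
    calc _ < ‖qpow q (2 * δ)‖ * ‖qpow q (2 * δ)‖⁻¹ := by gcongr
      _ = 1 := mul_inv_cancel₀ hQ.ne'
  small := ofFields_small hosc (geomBdd_oscComm hq0 hq1 hkr)
    (eventually_hasSum_poch (norm_nome_lt_one hq0 hq1 hx) _ _) hsum

end

theorem phiZeroConst_sq {k r : ℕ} (hk : 1 ≤ k) (hkr : k < r) :
    phiZeroConst k r ^ 2 = 2 * r / (k * ((r : ℂ) - k)) := by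
  have hk' : (k : ℂ) ≠ 0 := by exact_mod_cast (by omega : k ≠ 0)
  have hrk : (0 : ℝ) < (r : ℝ) - k := by rw [sub_pos]; exact_mod_cast hkr
  have hrk' : (r : ℂ) - k ≠ 0 := by
    intro h0
    exact hrk.ne' (by exact_mod_cast h0)
  rw [phiZeroConst, mul_pow, ← ofReal_pow, Real.sq_sqrt (by positivity)]
  push_cast
  field_simp

theorem phiZeroConst'_sq {k r : ℕ} (hk : 1 ≤ k) (hkr : k < r) :
    phiZeroConst' k r ^ 2 = 2 * ((r : ℂ) - k) / (k * r) := by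
  have hk' : (k : ℂ) ≠ 0 := by exact_mod_cast (by omega : k ≠ 0)
  have hr' : (r : ℂ) ≠ 0 := by exact_mod_cast (by omega : r ≠ 0)
  have hrk : (0 : ℝ) < (r : ℝ) - k := by rw [sub_pos]; exact_mod_cast hkr
  rw [phiZeroConst', mul_pow, ← ofReal_pow, Real.sq_sqrt (by positivity)]
  push_cast
  field_simp

theorem sqrt_mul_phiZeroConst {k r : ℕ} (hk : 1 ≤ k) (hkr : k < r) :
    (Real.sqrt (2 * r * ((r : ℝ) - k) / k) : ℝ) * phiZeroConst k r = 2 * (r : ℂ) / k := by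
  have hk' : (0 : ℝ) < k := by exact_mod_cast hk
  have hrk : (0 : ℝ) < (r : ℝ) - k := by rw [sub_pos]; exact_mod_cast hkr
  rw [phiZeroConst, mul_left_comm, ← ofReal_mul, ← Real.sqrt_mul (by positivity),
    show 2 * (r : ℝ) * ((r : ℝ) - k) / k * (2 * k * r / ((r : ℝ) - k)) = (2 * r) ^ 2 by
      field_simp, Real.sqrt_sq (by positivity)]
  push_cast
  ring

theorem sqrt_mul_phiZeroConst' {k r : ℕ} (hk : 1 ≤ k) (hkr : k < r) :
    (Real.sqrt (2 * r * ((r : ℝ) - k) / k) : ℝ) * phiZeroConst' k r =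
      2 * ((r : ℂ) - k) / k := by
  have hk' : (0 : ℝ) < k := by exact_mod_cast hk
  have hr' : (0 : ℝ) < r := by exact_mod_cast (by omega : 0 < r)
  have hrk : (0 : ℝ) < (r : ℝ) - k := by rw [sub_pos]; exact_mod_cast hkr
  rw [phiZeroConst', mul_left_comm, ← ofReal_mul, ← Real.sqrt_mul (by positivity),
    show 2 * (r : ℝ) * ((r : ℝ) - k) / k * (2 * k * ((r : ℝ) - k) / r) = (2 * (r - k)) ^ 2 by
      field_simp, Real.sqrt_sq (by positivity)]
  push_cast
  ring

section

variable {q : ℂ} (hq0 : q ≠ 0) (hq1 : ‖q‖ < 1) {k r : ℕ} (hk : 1 ≤ k) (hkr : k < r)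

/-- The slopes of the zero modes in `E`. -/
def slopeE (q : ℂ) (k r : ℕ) : Fin 3 → ℂ :=
  -Pi.single 0 (phiZeroConst k r * (2 * log q)) - Pi.single 2 (-(k : ℂ)⁻¹ * (2 * log q))

/-- The slopes of the zero modes in `F`. -/
def slopeF (q : ℂ) (k r : ℕ) : Fin 3 → ℂ :=
  Pi.single 0 (phiZeroConst' k r * (2 * log q)) + Pi.single 2 (-(k : ℂ)⁻¹ * (2 * log q))

/-- The slopes of the zero modes in `S`. -/
def slopeS (q : ℂ) (k : ℕ) : Fin 3 → ℂ := Pi.single 1 (-((k : ℂ) + 2)⁻¹ * (2 * log q))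

/-- The data of `E`. -/
def dataE (q : ℂ) (k r : ℕ) : CurrentData Bool :=
  thetaData q (fieldsE q k r) (slopeE q k r) (1 / (q - q⁻¹)) q ((r - k : ℕ) : ℝ) 1

/-- The data of `F`. -/
def dataF (q : ℂ) (k r : ℕ) : CurrentData Bool :=
  thetaData q (fieldsF q k r) (slopeF q k r) (-1 / (q - q⁻¹)) q⁻¹ (r : ℝ) (-1)

/-- The data of `S`. -/
def dataS (q : ℂ) (k : ℕ) : CurrentData Bool :=
  thetaData q (fieldsS q k) (slopeS q k) (-1 / (q - q⁻¹)) q⁻¹ ((k + 2 : ℕ) : ℝ) 1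

include hq0

theorem homogeneous_fieldsE (ε : Bool) : Homogeneous q (fieldsE q k r ε) (slopeE q k r) := by
  have h1 := ((homogeneous_phiZero hq0 k r).neg).sub (homogeneous_phi hq0 2 k (-(k / 2)))
  cases ε
  · have h2 := h1.add ((homogeneous_phiMinus hq0 2 ((k + 2) / 2)).add
      (homogeneous_phiMinus hq0 1 (k / 2)))
    simp only [add_zero] at h2
    exact h2
  · have h2 := h1.add (((homogeneous_phiPlus hq0 2 ((k + 2) / 2)).neg).sub
      (homogeneous_phiPlus hq0 1 (k / 2)))
    simp only [add_zero, sub_zero, neg_zero] at h2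
    exact h2

theorem homogeneous_fieldsF (ε : Bool) : Homogeneous q (fieldsF q k r ε) (slopeF q k r) := by
  have h1 := (homogeneous_phiZero' hq0 k r).add (homogeneous_phi hq0 2 k (k / 2))
  cases ε
  · have h2 := h1.add ((homogeneous_phiMinus hq0 2 (-((k + 2) / 2))).sub
      (homogeneous_phiMinus hq0 1 (-(k / 2))))
    simp only [add_zero, sub_zero] at h2
    exact h2
  · have h2 := h1.add (((homogeneous_phiPlus hq0 2 (-((k + 2) / 2))).neg).add
      (homogeneous_phiPlus hq0 1 (-(k / 2))))
    simp only [add_zero, neg_zero] at h2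
    exact h2

theorem homogeneous_fieldsS (ε : Bool) : Homogeneous q (fieldsS q k ε) (slopeS q k) := by
  have h1 := homogeneous_phi hq0 1 ((k : ℂ) + 2) (-((k + 2) / 2))
  cases ε
  · have h2 := h1.add (((homogeneous_phiMinus hq0 2 ((k + 2) / 2)).neg).sub
      (homogeneous_phiMinus hq0 1 (k / 2)))
    simp only [add_zero, sub_zero, neg_zero] at h2
    exact h2
  · have h2 := h1.add ((homogeneous_phiPlus hq0 2 ((k + 2) / 2)).add
      (homogeneous_phiPlus hq0 1 (k / 2)))
    simp only [add_zero] at h2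
    exact h2

include hq1 hk

theorem oscBdd_fieldsE (ε : Bool) : OscBdd (fieldsE q k r ε 0) := by
  have hp := oscBdd_phiPlus hq0 hq1
  have hm := oscBdd_phiMinus hq0 hq1
  have h1 := oscBdd_phi hq0 hq1 2 (C := k) (by exact_mod_cast hk) (-(k / 2))
  rw [ofReal_natCast] at h1
  have h2 := (oscBdd_phiZero hq0 hq1 r hk).neg.sub h1
  cases ε
  exacts [h2.add ((hm _ _).add (hm _ _)), h2.add ((hp _ _).neg.sub (hp _ _))]

theorem oscBdd_fieldsF (hr : 1 ≤ r) (ε : Bool) : OscBdd (fieldsF q k r ε 0) := by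
  have hp := oscBdd_phiPlus hq0 hq1
  have hm := oscBdd_phiMinus hq0 hq1
  have h1 := oscBdd_phi hq0 hq1 2 (C := k) (by exact_mod_cast hk) (k / 2)
  rw [ofReal_natCast] at h1
  have h2 := (oscBdd_phiZero' hq0 hq1 hk hr).add h1
  cases ε
  exacts [h2.add ((hm _ _).sub (hm _ _)), h2.add ((hp _ _).neg.add (hp _ _))]

omit hk in
theorem oscBdd_fieldsS (ε : Bool) : OscBdd (fieldsS q k ε 0) := by
  have hp := oscBdd_phiPlus hq0 hq1
  have hm := oscBdd_phiMinus hq0 hq1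
  have h1 := oscBdd_phi hq0 hq1 1 (C := k + 2) (by positivity) (-((k + 2) / 2))
  push_cast at h1
  cases ε
  exacts [h1.add ((hm _ _).neg.sub (hm _ _)), h1.add ((hp _ _).add (hp _ _))]

include hkr

theorem represents_dataE : (dataE q k r).Represents q k r (currentE q k r) ‖qpow q (-2)‖ := by
  have hkc : (k : ℂ) ≠ 0 := by exact_mod_cast (by omega : k ≠ 0)
  have hrk : ((r : ℂ) - k) ≠ 0 := by
    rw [← Nat.cast_sub hkr.le]
    exact_mod_cast (by omega : r - k ≠ 0)
  have h := represents_thetaData (A := currentE q k r) (X := fieldsE q k r) (slope := slopeE q k r)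
    (c := 1 / (q - q⁻¹)) (z := q) (x := ((r - k : ℕ) : ℝ)) (δ := 1) hq0 hq1 hkr
    (by exact_mod_cast (by omega : 0 < r - k)) isUnit_one hq0 (fun u => rfl)
    (homogeneous_fieldsE hq0) (fun ε j => ?_) (oscBdd_fieldsE hq0 hq1 hk) (fun ε u => ?_)
    (fun ε ε' n => ?_)
  · rwa [show -(2 * ((1 : ℤ) : ℂ)) = -2 by norm_num] at h
  · cases ε <;> simp [fieldsE, phiPlus_charge, phiMinus_charge]
  · have hkk : (k : ℂ) * (k : ℂ)⁻¹ = 1 := mul_inv_cancel₀ hkc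
    -- The zero modes of bosons `0` and `2` combine to the exponent `4 δ / x` with `x = r - k`, as
    -- the theta form of the contraction demands.
    have hsq : 2 * phiZeroConst k r ^ 2 - 4 * (k : ℂ)⁻¹ = 4 / ((r : ℂ) - k) := by
      rw [phiZeroConst_sq hk hkr]
      field_simp
      ring
    have he : ∑ j, ((fieldsE q k r ε 0 j).2.1 + slopeE q k r j * u) *
        (zeroComm k j * (fieldsE q k r true 0 j).1) =
        cond ε (log q) (-log q) + 4 / ((r : ℂ) - k) * log q * u := by
      cases ε <;>
      simp [fieldsE, slopeE, Fin.sum_univ_three, phiPlus_charge, phiPlus_mom,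
        phiMinus_mom, phiZero_charge, phiZero_mom, phi_charge, phi_mom, zeroComm]
      · linear_combination log q * u * hsq - 2 * phiZeroConst k r ^ 2 * log q * u * I_sq +
          (-log q - 4 * (k : ℂ)⁻¹ * log q * u) * hkk
      · linear_combination log q * u * hsq - 2 * phiZeroConst k r ^ 2 * log q * u * I_sq +
          (log q - 4 * (k : ℂ)⁻¹ * log q * u) * hkk
    rw [he, exp_add]
    cases ε <;> simp [exp_neg, exp_log hq0, hkr.le]
  · rw [contraction_fieldsE hq0 hq1 hk hkr]
    push_cast [hkr.le]
    ring_nf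

/-- Here `δ = -1`, so the first pole is at `y = q²`, inside the unit circle: the convergence disc
does not reach the torus. -/
theorem represents_dataF : (dataF q k r).Represents q k r (currentF q k r) ‖qpow q 2‖ := by
  have hkc : (k : ℂ) ≠ 0 := by exact_mod_cast (by omega : k ≠ 0)
  have hrc : (r : ℂ) ≠ 0 := by exact_mod_cast (by omega : r ≠ 0)
  have h := represents_thetaData (A := currentF q k r) (X := fieldsF q k r) (slope := slopeF q k r)
    (c := -1 / (q - q⁻¹)) (z := q⁻¹) (x := r) (δ := -1) hq0 hq1 hkr
    (by exact_mod_cast (by omega : 0 < r)) isUnit_one.neg (inv_ne_zero hq0) (fun u => rfl)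
    (homogeneous_fieldsF hq0) (fun ε j => ?_) (oscBdd_fieldsF hq0 hq1 hk (by omega)) (fun ε u => ?_)
    (fun ε ε' n => ?_)
  · rwa [show -(2 * ((-1 : ℤ) : ℂ)) = 2 by norm_num] at h
  · cases ε <;> simp [fieldsF, phiPlus_charge, phiMinus_charge]
  · have hkk : (k : ℂ) * (k : ℂ)⁻¹ = 1 := mul_inv_cancel₀ hkc
    have hsq : 2 * phiZeroConst' k r ^ 2 - 4 * (k : ℂ)⁻¹ = -4 / (r : ℂ) := by
      rw [phiZeroConst'_sq hk hkr]
      field_simp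
      ring
    have he : ∑ j, ((fieldsF q k r ε 0 j).2.1 + slopeF q k r j * u) *
        (zeroComm k j * (fieldsF q k r true 0 j).1) =
        cond ε (-log q) (log q) + -4 / (r : ℂ) * log q * u := by
      cases ε <;>
      simp [fieldsF, slopeF, Fin.sum_univ_three, phiPlus_charge, phiPlus_mom,
        phiMinus_mom, phiZero'_charge, phiZero'_mom, phi_charge, phi_mom, zeroComm]
      · linear_combination log q * u * hsq - 2 * phiZeroConst' k r ^ 2 * log q * u * I_sq +
          (log q - 4 * (k : ℂ)⁻¹ * log q * u) * hkk
      · linear_combination log q * u * hsq - 2 * phiZeroConst' k r ^ 2 * log q * u * I_sq +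
          (-log q - 4 * (k : ℂ)⁻¹ * log q * u) * hkk
    rw [he, exp_add]
    cases ε <;> simp [exp_neg, exp_log hq0]
  · rw [contraction_fieldsF hq0 hq1 hk hkr]
    simp

theorem represents_dataS : (dataS q k).Represents q k r (currentS q k r) ‖qpow q (-2)‖ := by
  have hkc : (k : ℂ) + 2 ≠ 0 := by exact_mod_cast (by omega : k + 2 ≠ 0)
  have h := represents_thetaData (A := currentS q k r) (X := fieldsS q k) (slope := slopeS q k)
    (c := -1 / (q - q⁻¹)) (z := q⁻¹) (x := ((k + 2 : ℕ) : ℝ)) (δ := 1) hq0 hq1 hkr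
    (by positivity) isUnit_one (inv_ne_zero hq0) (fun u => rfl)
    (homogeneous_fieldsS hq0) (fun ε j => ?_) (oscBdd_fieldsS hq0 hq1) (fun ε u => ?_)
    (fun ε ε' n => ?_)
  · rwa [show -(2 * ((1 : ℤ) : ℂ)) = -2 by norm_num] at h
  · cases ε <;> simp [fieldsS, phiPlus_charge, phiMinus_charge]
  · have he : ∑ j, ((fieldsS q k ε 0 j).2.1 + slopeS q k j * u) *
        (zeroComm k j * (fieldsS q k true 0 j).1) =
        cond ε (-log q) (log q) + 4 / ((k : ℂ) + 2) * log q * u := by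
      cases ε <;>
      simp [fieldsS, slopeS, phiPlus_charge, phiPlus_mom,
        phiMinus_mom, phi_charge, phi_mom, zeroComm]
      all_goals
        field_simp
        ring
    rw [he, exp_add]
    cases ε <;> simp [exp_neg, exp_log hq0]
  · rw [contraction_fieldsS hq0 hq1 hk hkr]
    push_cast
    simp only [inv_inv]
    ring_nf

end

end ThetaScreening

namespace ThetaScreening

open Complex CurrentData

/-! ## The screening operators -/

section

variable {q : ℂ} {k r : ℕ}

/-- The slopes of the zero modes in `η`. -/
def slopeEta (q : ℂ) : Fin 3 → ℂ :=
  -Pi.single 1 (-(2 : ℂ)⁻¹ * (2 * log q)) - Pi.single 2 (-(2 : ℂ)⁻¹ * (2 * log q))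

/-- The data of `η`. -/
def dataEta (q : ℂ) (k : ℕ) : CurrentData Unit :=
  ofFields (fieldsEta q k) (fun _ => 1) (fun j => (fieldsEta q k () 0 j).1) (slopeEta q)
    (fun _ => 1) (2 * log q) (fun _ => 1)

theorem homogeneous_fieldsEta (hq0 : q ≠ 0) (ε : Unit) :
    Homogeneous q (fieldsEta q k ε) (slopeEta q) :=
  ((homogeneous_phi hq0 1 2 (k / 2)).neg).sub (homogeneous_phi hq0 2 2 ((k + 2) / 2))

theorem oscBdd_fieldsEta (hq0 : q ≠ 0) (hq1 : ‖q‖ < 1) (ε : Unit) :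
    OscBdd (fieldsEta q k ε 0) := by
  have h (j D) := oscBdd_phi hq0 hq1 j (C := 2) two_pos D
  simp only [ofReal_ofNat] at h
  exact (h 1 _).neg.sub (h 2 _)

theorem represents_dataEta (hq0 : q ≠ 0) (hq1 : ‖q‖ < 1) (hk : 1 ≤ k) (hkr : k < r) :
    (dataEta q k).Represents q k r (currentEta q k r) 2 where
  shift_eq u := by
    funext j
    change zeroComm k j * (fieldsEta q k () u j).1 = zeroComm k j * (fieldsEta q k () 0 j).1
    rw [homogeneous_fieldsEta hq0 () u j]
  entry_eq u p e f := by
    rw [Fintype.sum_unique, dataEta,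
      ofFields_field (homogeneous_fieldsEta hq0) (fun ε j => by cases ε; rfl)]
    exact (one_mul _).symm
  zero_ne _ := one_ne_zero
  zero_eq ε u := by
    simp only [dataEta, ofFields, CurrentData.shift]
    rw [one_mul]
    congr 1
    simp [fieldsEta, slopeEta, Fin.sum_univ_three, phi_charge, phi_mom, zeroComm]
    ring
  fac_diff := differentiableOn_const _
  small := ofFields_small (t := 0) (oscBdd_fieldsEta hq0 hq1) (geomBdd_oscComm hq0 hq1 hkr)
    (Filter.Eventually.of_forall fun y => ⟨0, by simp, exp_zero⟩)
    fun ε ε' n => by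
      rw [contraction_fieldsEta hq0 hq1 hk hkr]
      simp

theorem continuous_cpow_circlePoint (hq0 : q ≠ 0) :
    Continuous fun θ => q ^ (2 * circlePoint q θ) := by
  simp only [cpow_eq_qpow hq0]
  unfold qpow
  have := continuous_circlePoint q
  fun_prop

/-- The contraction `q^{2u} - q^{2v}` is antisymmetric without any theta factor, and the weights are
independent of the momentum, so the alternating sum over two permutations is `1 - 1`. -/
theorem torusIntegral_dataEta (hq0 : q ≠ 0) (p : Momentum) (e f : Basis) :
    torusIntegral 2 ((dataEta q k).torusEntry q k r (fun _ u => q ^ (2 * u)) 2 p e f) = 0 := by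
  refine torusIntegral_torusEntry_eq_zero (fun _ _ => analyticAt_const)
    (fun _ => continuous_cpow_circlePoint hq0)
    (Ξ := fun ε ε' u v => (dataEta q k).pairFactor q ε ε' u v) (T := fun _ => 1)
    (fun ε ε' u v => ?_) (fun _ _ _ _ => (one_mul _).symm) (W := fun _ _ => 1)
    (den := fun u => q ^ (2 * u)) (fun _ _ => (one_mul _).symm)
    (fun u => antisymSum_one u le_rfl) e f
  simp only [pairFactor, dataEta, ofFields, one_mul, mul_one]
  have h (u : ℂ) : exp (2 * log q * u) = qpow q (2 * u) := by rw [qpow]; congr 1; ring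
  have h2 (u v : ℂ) : qpow q (2 * (v - u)) * qpow q (2 * u) = qpow q (2 * v) := by
    rw [← qpow_add]; congr 1; ring
  rw [h, h, sub_mul, sub_mul, h2, h2]
  ring

theorem shift_dataE_zero : (dataE q k r).shift k 0 = -phiZeroConst k r := by
  simp [dataE, thetaData, ofFields, CurrentData.shift, fieldsE, phiPlus_charge, phiZero_charge,
    phi_charge, zeroComm]
  ring_nf
  simp

theorem shift_dataE_two (hk : 1 ≤ k) : (dataE q k r).shift k 2 = -2 := by
  have hkc : (k : ℂ) ≠ 0 := by exact_mod_cast (by omega : k ≠ 0)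
  simp [dataE, thetaData, ofFields, CurrentData.shift, fieldsE, phiPlus_charge, phiZero_charge,
    phi_charge, zeroComm, hkc]

theorem shift_dataF_zero : (dataF q k r).shift k 0 = phiZeroConst' k r := by
  simp [dataF, thetaData, ofFields, CurrentData.shift, fieldsF, phiPlus_charge, phiZero'_charge,
    phi_charge, zeroComm]
  ring_nf
  simp

theorem shift_dataF_two (hk : 1 ≤ k) : (dataF q k r).shift k 2 = 2 := by
  have hkc : (k : ℂ) ≠ 0 := by exact_mod_cast (by omega : k ≠ 0)
  simp [dataF, thetaData, ofFields, CurrentData.shift, fieldsF, phiPlus_charge, phiZero'_charge,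
    phi_charge, zeroComm, hkc]

theorem shift_dataS_one : (dataS q k).shift k 1 = -2 := by
  have hkc : (k : ℂ) + 2 ≠ 0 := by exact_mod_cast (by omega : k + 2 ≠ 0)
  simp [dataS, thetaData, ofFields, CurrentData.shift, fieldsS, phiPlus_charge,
    phi_charge, zeroComm]
  field_simp

/-- Per current, `P_0` contributes `-2r/k` and `P_2` contributes `2(r - k)/k`, which add up to `-2`:
the step `-2δ` required of the weights. -/
theorem hatPi_add_shift (hk : 1 ≤ k) (hkr : k < r) (p : Momentum) (n : ℕ) :
    hatPi k r (p + n • (dataE q k r).shift k) = hatPi k r p - 2 * n := by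
  have hkc : (k : ℂ) ≠ 0 := by exact_mod_cast (by omega : k ≠ 0)
  rw [hatPi, hatPi, Pi.add_apply, Pi.add_apply, Pi.smul_apply, Pi.smul_apply,
    shift_dataE_zero, shift_dataE_two hk, nsmul_eq_mul, nsmul_eq_mul]
  have h2 : ((r : ℂ) - k) / k = r / k - 1 := by field_simp
  rw [h2]
  linear_combination -(n : ℂ) * sqrt_mul_phiZeroConst hk hkr

theorem hatPi'_add_shift (hk : 1 ≤ k) (hkr : k < r) (p : Momentum) (n : ℕ) :
    hatPi' k r (p + n • (dataF q k r).shift k) = hatPi' k r p - 2 * n := by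
  have hkc : (k : ℂ) ≠ 0 := by exact_mod_cast (by omega : k ≠ 0)
  rw [hatPi', hatPi', Pi.add_apply, Pi.add_apply, Pi.smul_apply, Pi.smul_apply,
    shift_dataF_zero, shift_dataF_two hk, nsmul_eq_mul, nsmul_eq_mul]
  have h2 : 2 * ((r : ℂ) - k) / k = 2 * (r / k) - 2 := by field_simp
  linear_combination (n : ℂ) * (sqrt_mul_phiZeroConst' hk hkr) + n * h2

theorem half_ne_intCast_mul (N : ℕ) (i : ℤ) : (1 / 2 : ℝ) ≠ i * (N : ℝ) := by
  intro h
  have h1 : (1 : ℤ) = 2 * (i * N) := by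
    have : (1 : ℝ) = 2 * (i * N) := by linarith
    exact_mod_cast this
  omega

theorem neg_half_ne_intCast_mul (N : ℕ) (i : ℤ) : (-(1 / 2) : ℝ) ≠ i * (N : ℝ) := by
  have h := half_ne_intCast_mul N (-i)
  rw [Int.cast_neg, neg_mul] at h
  exact fun h' => h (by rw [← h', neg_neg])

theorem one_lt_norm_qpow_neg_two (hq0 : q ≠ 0) (hq1 : ‖q‖ < 1) : 1 < ‖qpow q (-2)‖ := by
  rw [qpow_neg, norm_inv, ← cpow_eq_qpow hq0]
  norm_cast
  rw [norm_pow]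
  exact (one_lt_inv₀ (by positivity)).mpr (pow_lt_one₀ (norm_nonneg _) hq1 two_ne_zero)

variable (hq0 : q ≠ 0) (hq1 : ‖q‖ < 1)
include hq0 hq1

/-- A screening operator of theta type is nilpotent in the sense of contour integrals, and
literally if the product of currents converges in a neighbourhood of the torus. -/
theorem CurrentData.IsThetaType.nilpotent {ι : Type} [Fintype ι] {D : CurrentData ι} {N : ℕ}
    (hN : 2 ≤ N) {δ : ℤ} (ht : D.IsThetaType q (N : ℝ) δ) {A : ℂ → Op} {R₀ : ℝ}
    (h : D.Represents q k r A R₀) (hR₀ : 0 < R₀) {w : Momentum → ℂ → ℂ} {a : Momentum → ℂ} {b : ℝ}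
    (hb : ∀ i : ℤ, b ≠ i * (N : ℝ))
    (hw : ∀ p u, w p u = bracket q (N : ℝ) (u + a p) / bracket q (N : ℝ) (u + b))
    (ha : ∀ p (n : ℕ), a (p + n • D.shift k) = a p - 2 * δ * n) (p : Momentum) :
    ContourNilpotentOn q A w (N : ℝ) N p ∧ (1 < R₀ → (contourOp q A w).NilpotentOn N p) := by
  have hN' : (2 : ℝ) ≤ N := by exact_mod_cast hN
  have hwc : ∀ p, Continuous fun θ => w p (circlePoint q θ) := fun p => by
    simpa only [hw] using continuous_bracket_weight hq0 hq1 hN hb (a p)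
  have hzero := ht.torusIntegral_eq_zero (k := k) (r := r) hq0 hq1 hN hb hw ha p
  exact ⟨h.contourNilpotentOn hq0 hq1 hR₀ hN'
    (ht.analyticAt_fac_exchange hq0 hq1 (by linarith)) hwc hzero,
    fun hR => h.nilpotentOn hR hwc hzero⟩

end

end ThetaScreening

/-! ### Nilpotency of the individual screening operators -/

namespace ThetaScreening

open Complex CurrentData

section

variable {q : ℂ} (hq0 : q ≠ 0) (hq1 : ‖q‖ < 1) {k r : ℕ} (hk : 1 ≤ k) (p : Momentum)
include hq0 hq1 hk

theorem nilpotent_screenPlus (hr : k + 2 ≤ r) :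
    ContourNilpotentOn q (currentE q k r) (weightPlus q k r) ((r : ℂ) - k) (r - k) p ∧
      (screenPlus q k r).NilpotentOn (r - k) p := by
  have hkr : k < r := by omega
  have hx : (r : ℂ) - k = (((r - k : ℕ) : ℝ) : ℂ) := by push_cast [hkr.le]; rfl
  have h := (isThetaType_thetaData (fieldsE q k r) (slopeE q k r) (1 / (q - q⁻¹)) q
    ((r - k : ℕ) : ℝ) isUnit_one).nilpotent hq0 hq1 (by omega)
    (represents_dataE hq0 hq1 hk hkr) (zero_lt_one.trans (one_lt_norm_qpow_neg_two hq0 hq1))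
    (w := weightPlus q k r) (a := fun p => hatPi k r p - 1 / 2) (neg_half_ne_intCast_mul (r - k))
    (fun p u => ?_) (fun p n => ?_) p
  · exact ⟨by rw [hx]; exact h.1, h.2 (one_lt_norm_qpow_neg_two hq0 hq1)⟩
  · rw [weightPlus, hx]
    push_cast
    ring_nf
  · rw [← dataE, hatPi_add_shift hk hkr]
    push_cast
    ring

/-- The zero mode enters the weight with a minus sign, so its step per current is `+2 = -2δ` for `δ
= -1`. Only the contour form is drawn, the radius `|q|²` being less than one. -/
theorem contourNilpotentOn_currentF (hr : k + 2 ≤ r) :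
    ContourNilpotentOn q (currentF q k r) (weightMinus q k r) (r : ℂ) r p := by
  have hkr : k < r := by omega
  have h := (isThetaType_thetaData (fieldsF q k r) (slopeF q k r) (-1 / (q - q⁻¹)) q⁻¹
    (r : ℝ) isUnit_one.neg).nilpotent hq0 hq1 (by omega)
    (represents_dataF hq0 hq1 hk hkr) (norm_pos_iff.mpr (qpow_ne_zero _ _))
    (w := weightMinus q k r) (a := fun p => 1 / 2 - hatPi' k r p) (half_ne_intCast_mul r)
    (fun p u => ?_) (fun p n => ?_) p
  · simpa only [ofReal_natCast] using h.1
  · rw [weightMinus]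
    push_cast
    ring_nf
  · rw [← dataF, hatPi'_add_shift hk hkr]
    push_cast
    ring

theorem nilpotent_screenS (hr : k + 2 ≤ r) :
    ContourNilpotentOn q (currentS q k r) (weightS q k) ((k : ℂ) + 2) (k + 2) p ∧
      (screenS q k r).NilpotentOn (k + 2) p := by
  have hx : (k : ℂ) + 2 = (((k + 2 : ℕ) : ℝ) : ℂ) := by push_cast; rfl
  have h := (isThetaType_thetaData (fieldsS q k) (slopeS q k) (-1 / (q - q⁻¹)) q⁻¹
    ((k + 2 : ℕ) : ℝ) isUnit_one).nilpotent hq0 hq1 (by omega)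
    (represents_dataS (r := r) hq0 hq1 hk (by omega))
    (zero_lt_one.trans (one_lt_norm_qpow_neg_two hq0 hq1))
    (w := weightS q k) (a := fun p => p 1 - 1 / 2) (neg_half_ne_intCast_mul (k + 2))
    (fun p u => ?_) (fun p n => ?_) p
  · exact ⟨by rw [hx]; exact h.1, h.2 (one_lt_norm_qpow_neg_two hq0 hq1)⟩
  · rw [weightS, hx]
    push_cast
    ring_nf
  · rw [← dataS, Pi.add_apply, Pi.smul_apply, shift_dataS_one, nsmul_eq_mul]
    push_cast
    ring

theorem nilpotentOn_screenEta (hkr : k < r) : (screenEta q k r).NilpotentOn 2 p :=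
  (represents_dataEta hq0 hq1 hk hkr).nilpotentOn one_lt_two
    (fun _ => continuous_cpow_circlePoint hq0) (torusIntegral_dataEta hq0 p)

end

end ThetaScreening
end

theorem theorem5p5 (q : ℂ) (hq0 : q ≠ 0) (hq1 : ‖q‖ < 1) (k r : ℕ) (hk : 1 ≤ k) (hr : k + 2 ≤ r)
    (J M n' n : ℤ) :
    -- powers and products as compositions of operators
    (ThetaScreening.screenPlus q k r).NilpotentOn (r - k)
        (ThetaScreening.fockMomentum k r J M n' n) ∧
    (ThetaScreening.screenS q k r).NilpotentOn (k + 2)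
        (ThetaScreening.fockMomentum k r J M n' n) ∧
    (J ≡ M [ZMOD 2] →
      (ThetaScreening.screenEta q k r).NilpotentOn 2
        (ThetaScreening.fockMomentum k r J M n' n)) ∧
    -- powers and products as multiple contour integrals over the unit circle
    ThetaScreening.ContourNilpotentOn q (ThetaScreening.currentE q k r)
      (ThetaScreening.weightPlus q k r) ((r : ℂ) - k) (r - k)
      (ThetaScreening.fockMomentum k r J M n' n) ∧
    ThetaScreening.ContourNilpotentOn q (ThetaScreening.currentF q k r)
      (ThetaScreening.weightMinus q k r) (r : ℂ) r
      (ThetaScreening.fockMomentum k r J M n' n) ∧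
    ThetaScreening.ContourNilpotentOn q (ThetaScreening.currentS q k r)
      (ThetaScreening.weightS q k) ((k : ℂ) + 2) (k + 2)
      (ThetaScreening.fockMomentum k r J M n' n) := by
  have hE := ThetaScreening.nilpotent_screenPlus hq0 hq1 hk
    (ThetaScreening.fockMomentum k r J M n' n) hr
  have hS := ThetaScreening.nilpotent_screenS hq0 hq1 hk
    (ThetaScreening.fockMomentum k r J M n' n) hr
  exact ⟨hE.2, hS.2, fun _ => ThetaScreening.nilpotentOn_screenEta hq0 hq1 hk _ (by omega), hE.1,
    ThetaScreening.contourNilpotentOn_currentF hq0 hq1 hk _ hr, hS.1⟩
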